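/- Let $K\in\{-1,0,1\}$ and $\varepsilon>0$. Put $D_\varepsilon^+=\{z\in\mathbb C:|z|<\varepsilon,\ \operatorname{Im}z>0\}$, $\Omega=\{z\in\mathbb C:0<|z|<\varepsilon,\ \operatorname{Im}z\ge 0\}$ and $D_\varepsilon^*=\{z\in\mathbb C:0<|z|<\varepsilon\}$, and write $z=s+it$. For $c_1,c_2\in\mathbb R$, a solution of problem (L) is a function $v\in C^2(\Omega)$ (real valued, $C^2$ up to the two boundary segments) with $$\Delta v+2Ke^v=0\ \text{ in } D_\varepsilon^+,\qquad \frac{\partial v}{\partial t}=c_1e^{v/2}\ \text{ on } (0,\varepsilon),\qquad \frac{\partial v}{\partial t}=c_2e^{v/2}\ \text{ on } (-\varepsilon,0).$$ A function $g:\Omega\to\overline{\mathbb C}=\mathbb C\cup\{\infty\}$ is called locally univalent meromorphic if near each point of $\Omega$ it is the restriction to $\Omega$ of a meromorphic function that is injective on a full neighbourhood (in $\mathbb C$) of that point. Consider the formula $$v=\log\frac{4|g'|^2}{(1+K|g|^2)^2}\ \text{ on }\Omega, \tag{1}$$ where at points with $g=\infty$ the right-hand side is understood as $\log\frac{4|u'|^2}{(|u|^2+K)^2}$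 with $u=1/g$. Call a pair $(F,g)$ admissible if $F:D_\varepsilon^*\to\overline{\mathbb C}$ is meromorphic, $g:\Omega\to\overline{\mathbb C}$ is locally univalent meromorphic, if $K\le 0$ then moreover $g$ is holomorphic with $1+K|g|^2>0$ on $\Omega$, and for some Möbius transformation $\psi$ one of the following holds on $\Omega$ (with $\log z=\ln|z|+i\arg z$, $\arg z\in[0,\pi]$, and $z^a=e^{a\log z}$): (i) $g(z)=\psi(z^{\gamma}F(z))$ with $\gamma\in[0,1)$, and $F(r)\in\mathbb R\cup\{\infty\}$ for all $r\in\mathbb R\cap D_\varepsilon^*$; (ii) $g(z)=\psi(F(z)+\log z)$, and $F(r)\in\mathbb R\cup\{\infty\}$ for all $r\in\mathbb R\cap D_\varepsilon^*$; (iii) $g(z)=\psi(z^{i\gamma}F(z))$ with $\gamma<0$, and $|F(r)|=1$ for all $r\in\mathbb R\cap D_\varepsilon^*$. **Theorem.** If $v$ is a solution of (L) for some $c_1,c_2\in\mathbb R$, then there is an admissible pair $(F,g)$ such that $v$ is given by (1). Conversely, if $(F,g)$ is an admissible pair, then the function $v$ given by (1) is a solution of (L) for some constants $c_1,c_2\in\mathbb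 R$. -/

import Mathlib

noncomputable section
namespace LiouvilleNeumann

open Filter Topology Set

/-- The punctured disk `0 < |z| < ε`. -/
def puncturedDisk (ε : ℝ) : Set ℂ := {z | 0 < ‖z‖ ∧ ‖z‖ < ε}

/-- The open upper half-disk `|z| < ε`, `Im z > 0`. -/
def halfDisk (ε : ℝ) : Set ℂ := {z | ‖z‖ < ε ∧ 0 < z.im}

/-- The half-disk together with the two open segments of its diameter, without the origin:
`0 < |z| < ε`, `Im z ≥ 0`. -/
def puncturedHalfDisk (ε : ℝ) : Set ℂ := {z | 0 < ‖z‖ ∧ ‖z‖ < ε ∧ 0 ≤ z.im}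

/-- `v` solves the local geometric Neumann problem: `v` is `C²` up to the two open boundary
segments, `Δ v + 2 K e^v = 0` inside, `∂v/∂t = c₁ e^{v/2}` on `(0, ε)` and
`∂v/∂t = c₂ e^{v/2}` on `(-ε, 0)`, where `z = s + i t` and `∂v/∂t` is the one-sided
derivative from `t ≥ 0`. -/
structure IsSolution (K c₁ c₂ ε : ℝ) (v : ℂ → ℝ) : Prop where
  contDiffOn : ContDiffOn ℝ 2 v (puncturedHalfDisk ε)
  liouville : ∀ z ∈ halfDisk ε, Laplacian.laplacian v z + 2 * K * Real.exp (v z) = 0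
  neumann_pos : ∀ s : ℝ, 0 < s → s < ε →
    HasDerivWithinAt (fun t : ℝ => v ⟨s, t⟩) (c₁ * Real.exp (v ⟨s, 0⟩ / 2)) (Ici 0) 0
  neumann_neg : ∀ s : ℝ, -ε < s → s < 0 →
    HasDerivWithinAt (fun t : ℝ => v ⟨s, t⟩) (c₂ * Real.exp (v ⟨s, 0⟩ / 2)) (Ici 0) 0

/-- A map into the Riemann sphere is meromorphic at `z`: it is continuous at `z`, and near `z`,
apart from `z` itself, it is given by a meromorphic function with finite values. (The map that
is constantly `∞` near `z` is excluded.) -/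
def SphereMeromorphicAt (f : ℂ → OnePoint ℂ) (z : ℂ) : Prop :=
  ContinuousAt f z ∧ ∃ φ : ℂ → ℂ, MeromorphicAt φ z ∧ ∀ᶠ w in 𝓝[≠] z, f w = (φ w : OnePoint ℂ)

/-- `g` is a locally univalent meromorphic function on a set `S` which need not be open: near each
point of `S` it is the restriction to `S` of a meromorphic function that is injective on a full
neighbourhood of the point. -/
def LocallyUnivalentMeromorphicOn (g : ℂ → OnePoint ℂ) (S : Set ℂ) : Prop :=
  ∀ z ∈ S, ∃ G : ℂ → OnePoint ℂ, SphereMeromorphicAt G z ∧ (∃ U ∈ 𝓝 z, InjOn G U) ∧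
    G =ᶠ[𝓝[S] z] g

/-- The affine coordinate on the Riemann sphere, with the junk value `0` at `∞`. Its inverse
`(coord p)⁻¹` is then the coordinate `1 / p` around `∞`, which takes the value `0` at `∞`. -/
def coord (p : OnePoint ℂ) : ℂ := p.elim 0 id

open Classical in
/-- The conformal factor `4 |g'|² / (1 + K |g|²)²` at `z`, for `g` defined on `S`. At a point where
`g = ∞` it is written in the coordinate `u = 1 / g`, in which it is
`4 |u'|² / (|u|² + K)²`. -/
def conformalFactor (K : ℝ) (g : ℂ → OnePoint ℂ) (S : Set ℂ) (z : ℂ) : ℝ :=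
  if g z = OnePoint.infty then
    4 * ‖derivWithin (fun w => (coord (g w))⁻¹) S z‖ ^ 2 / (‖(coord (g z))⁻¹‖ ^ 2 + K) ^ 2
  else
    4 * ‖derivWithin (fun w => coord (g w)) S z‖ ^ 2 / (1 + K * ‖coord (g z)‖ ^ 2) ^ 2

/-- `F` takes values in `ℝ ∪ {∞}` at the real points of the punctured disk. -/
def RealOnAxis (ε : ℝ) (F : ℂ → OnePoint ℂ) : Prop :=
  ∀ r : ℝ, (r : ℂ) ∈ puncturedDisk ε →
    F r = OnePoint.infty ∨ ∃ x : ℝ, F r = ((x : ℂ) : OnePoint ℂ)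

/-- `|F| = 1` at the real points of the punctured disk. -/
def UnimodularOnAxis (ε : ℝ) (F : ℂ → OnePoint ℂ) : Prop :=
  ∀ r : ℝ, (r : ℂ) ∈ puncturedDisk ε → ∃ x : ℂ, ‖x‖ = 1 ∧ F r = (x : OnePoint ℂ)

/-- `g` is given on the punctured half-disk by one of the three expressions
`ψ (z^γ F(z))`, `ψ (F(z) + log z)`, `ψ (z^{iγ} F(z))`, where `ψ` is a Möbius transformation
(an invertible matrix acting on the Riemann sphere). The principal branch of the logarithm is used,
for which `arg z ∈ [0, π]` when `Im z ≥ 0`. The maps `w ↦ z^γ w`, `w ↦ w + log z` and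
`w ↦ z^{iγ} w` fix `∞`. -/
def HasCanonicalForm (ε : ℝ) (F g : ℂ → OnePoint ℂ) : Prop :=
  ∃ ψ : GL (Fin 2) ℂ,
    (∃ γ : ℝ, 0 ≤ γ ∧ γ < 1 ∧ RealOnAxis ε F ∧
      ∀ z ∈ puncturedHalfDisk ε,
        g z = ψ • OnePoint.map (fun w : ℂ => z ^ (γ : ℂ) * w) (F z)) ∨
    (RealOnAxis ε F ∧
      ∀ z ∈ puncturedHalfDisk ε,
        g z = ψ • OnePoint.map (fun w : ℂ => w + Complex.log z) (F z)) ∨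
    (∃ γ : ℝ, γ < 0 ∧ UnimodularOnAxis ε F ∧
      ∀ z ∈ puncturedHalfDisk ε,
        g z = ψ • OnePoint.map (fun w : ℂ => z ^ (Complex.I * (γ : ℂ)) * w) (F z))

/-- `g` is an admissible map on the punctured half-disk, constructed from `F`: `F` is meromorphic on
the punctured disk, `g` has one of the three forms, `g` is locally univalent meromorphic, and if
`K ≤ 0` then `g` is holomorphic (has no value `∞`) with `1 + K |g|² > 0`. -/
structure IsAdmissible (K ε : ℝ) (F g : ℂ → OnePoint ℂ) : Prop where
  meromorphic : ∀ z ∈ puncturedDisk ε, SphereMeromorphicAt F z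
  form : HasCanonicalForm ε F g
  univalent : LocallyUnivalentMeromorphicOn g (puncturedHalfDisk ε)
  holomorphic : K ≤ 0 → ∀ z ∈ puncturedHalfDisk ε,
    ∃ w : ℂ, g z = (w : OnePoint ℂ) ∧ 0 < 1 + K * ‖w‖ ^ 2

/-- `v = log (4 |g'|² / (1 + K |g|²)²)` on the punctured half-disk. -/
def IsRepresentedBy (K ε : ℝ) (v : ℂ → ℝ) (g : ℂ → OnePoint ℂ) : Prop :=
  ∀ z ∈ puncturedHalfDisk ε, v z = Real.log (conformalFactor K g (puncturedHalfDisk ε) z)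

end LiouvilleNeumann

end

/-! Write `g` as a quotient `a / b` of holomorphic functions with nonvanishing Wronskian `W = a' b -
a b'`. With `H = |b|² + K |a|²`, formula (1) reads `e^v = 4 |W|² / H²`, at poles as well.

Converse. Locally `v = log 4 + log |W|² - 2 log H`. The term `log |W|²` is harmonic, and `H H_{z z̄}
- |H_z|² = K |W|²` gives the Liouville equation (`liouville_logFactor`). On each boundary segment
`arg z` is constant, so each of the three forms is a Möbius image of a function with values in `ℝ ∪
{∞}` (`exists_real_coordinates`). Thus `g` maps the segment into a circle, which has constant
geodesic curvature in the metric of constant curvature; this is the Neumann condition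
(`exists_neumann_constant`).

Direct part. The Schwarzian `f = v_zz - v_z² / 2` is holomorphic inside by the Liouville equation
and real on the two segments by the Neumann condition. It has primitives up to the boundary although
`v` is only `C²`, so it reflects to a holomorphic function on the whole punctured disk
(`differentiableOn_reflect_schwarzian`). The function `e^{-v/2}` and its derivatives obey a closed
first-order system depending on `f` alone. The form `(|y₁|² + K |y₂|²) / 2` obeys the same system
when `y₁, y₂` solve `y'' + (f/2) y = 0`. Matching the data at one point gives `2 e^{-v/2} = |y₁|² +
K |y₂|²` with unit Wronskian (`exists_isSol_hermitian`), so `g = y₂ / y₁` satisfies (1).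

The solutions live on the logarithmic cover, in the variable `w = log z`. Since `f` is real on the
axis, there is a basis real on the axis, and in it the monodromy is `τ + i N` with `τ` real and `N`
a real traceless matrix, `N² = (α² + β κ) I`. The number `α² + β κ` separates the three forms:
positive, or `N = 0`, gives `z^γ F`; zero with `N ≠ 0` gives `F + log z`; negative gives `z^{iγ} F`
(`exists_monodromy_basis`). Removing the explicit multivalued factor leaves a single-valued `F`, and
the symmetry of the basis gives its values on the axis (`exists_canonicalForm`). -/

noncomputable section
namespace LiouvilleNeumann

open Filter Topology Set ComplexConjugate

/-! ### Injective holomorphic functions. -/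

/-- A holomorphic function which is injective near a point has nonzero derivative there. -/
theorem deriv_ne_zero_of_injOn {f : ℂ → ℂ} {z : ℂ} (hf : AnalyticAt ℂ f z) {U : Set ℂ}
    (hU : U ∈ 𝓝 z) (hinj : InjOn f U) : deriv f z ≠ 0 := by
  intro hd
  have hsub : AnalyticAt ℂ (fun w => f w - f z) z := hf.sub analyticAt_const
  have hne : ¬ ∀ᶠ w in 𝓝 z, f w - f z = 0 := by
    intro h
    have h1 : ∀ᶠ w in 𝓝[≠] z, f w - f z = 0 ∧ w ∈ U ∧ w ≠ z :=
      (h.filter_mono nhdsWithin_le_nhds).and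
        ((Filter.Eventually.filter_mono nhdsWithin_le_nhds hU).and self_mem_nhdsWithin)
    obtain ⟨w, hw, hwU, hwz⟩ := h1.exists
    exact hwz (hinj hwU (mem_of_mem_nhds hU) (sub_eq_zero.mp hw))
  obtain ⟨n, g, hg, hg0, hfg⟩ := hsub.exists_eventuallyEq_pow_smul_nonzero_iff.mpr hne
  -- The order `n` of the zero of `f - f z` is at least two: the function vanishes at `z`, and so
  -- does its derivative by assumption.
  have hn0 : n ≠ 0 := by
    rintro rfl
    have := hfg.self_of_nhds
    simp at this
    exact hg0 this.symm
  have hn1 : n ≠ 1 := by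
    rintro rfl
    have h1 : HasDerivAt (fun w => (w - z) ^ 1 • g w) (g z) z := by
      have := ((hasDerivAt_id z).sub_const z).fun_mul hg.differentiableAt.hasDerivAt
      simpa [pow_one] using this
    have h2 : HasDerivAt (fun w => f w - f z) (deriv f z) z :=
      hf.differentiableAt.hasDerivAt.sub_const _
    exact hg0 (by rw [(h1.congr_of_eventuallyEq hfg).unique h2, hd])
  obtain ⟨c, hc⟩ := IsAlgClosed.exists_pow_nat_eq (g z) (Nat.pos_of_ne_zero hn0)
  have hc0 : c ≠ 0 := by
    rintro rfl
    rw [zero_pow hn0] at hc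
    exact hg0 hc.symm
  -- A holomorphic `n`-th root of `g` near `z`; the principal logarithm is available because `g w /
  -- g z` is near `1`.
  set r : ℂ → ℂ := fun w => c * Complex.exp (Complex.log (g w / g z) / n) with hr
  have hnC : (n : ℂ) ≠ 0 := Nat.cast_ne_zero.mpr hn0
  have hra : AnalyticAt ℂ r z := by
    have h1 : AnalyticAt ℂ (fun w => Complex.log (g w / g z)) z :=
      (hg.div analyticAt_const hg0).clog (by simp [hg0])
    have h2 : AnalyticAt ℂ (fun w => Complex.log (g w / g z) / n) z :=
      h1.div analyticAt_const hnC
    exact analyticAt_const.mul h2.cexp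
  have hrz : r z = c := by simp [hr, hg0]
  have hrn : ∀ᶠ w in 𝓝 z, r w ^ n = g w := by
    filter_upwards [hg.continuousAt.eventually_ne hg0] with w hw
    rw [hr]
    simp only
    rw [mul_pow, hc, ← Complex.exp_nat_mul, mul_div_cancel₀ _ hnC,
      Complex.exp_log (div_ne_zero hw hg0), mul_div_cancel₀ _ hg0]
  -- A local coordinate in which `f` is `f z + φ ^ n`.
  set φ : ℂ → ℂ := fun w => (w - z) * r w with hφ
  have hφa : AnalyticAt ℂ φ z := (analyticAt_id.sub analyticAt_const).mul hra
  have hφd : HasStrictDerivAt φ c z := by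
    have h1 : HasDerivAt φ c z := by
      have := ((hasDerivAt_id z).sub_const z).fun_mul hra.differentiableAt.hasDerivAt
      simpa [hrz] using this
    have := hφa.hasStrictDerivAt
    rwa [h1.deriv] at this
  have hφz : φ z = 0 := by simp [hφ]
  have hfφ : ∀ᶠ w in 𝓝 z, f w = f z + φ w ^ n := by
    filter_upwards [hfg, hrn] with w h1 h2
    rw [hφ]
    simp only
    rw [mul_pow, h2, ← smul_eq_mul, ← h1]
    ring
  set L := hφd.localInverse φ c z hc0 with hL
  have hright : ∀ᶠ t in 𝓝 (0 : ℂ), φ (L t) = t := by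
    have := HasStrictDerivAt.eventually_right_inverse hφd hc0
    rwa [hφz] at this
  have hLt : Tendsto L (𝓝 0) (𝓝 z) := by
    have h1 := (HasStrictDerivAt.to_localInverse hφd hc0).hasDerivAt.continuousAt
    have h2 : L (φ z) = z := (HasStrictDerivAt.eventually_left_inverse hφd hc0).self_of_nhds
    have h3 : Tendsto L (𝓝 (φ z)) (𝓝 (L (φ z))) := h1
    rwa [h2, hφz] at h3
  -- The points with coordinates `t` and `η t` have the same image under `f`, and they differ
  -- because `n ≥ 2` gives `η ≠ 1`.
  obtain ⟨η, hη⟩ : ∃ η : ℂ, IsPrimitiveRoot η n := ⟨_, Complex.isPrimitiveRoot_exp n hn0⟩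
  have hη1 : η ≠ 1 := hη.ne_one (by omega)
  have hmul : Tendsto (fun t : ℂ => η * t) (𝓝 0) (𝓝 0) := by
    have : Continuous (fun t : ℂ => η * t) := by fun_prop
    simpa using this.tendsto 0
  have hgood : ∀ᶠ t in 𝓝 (0 : ℂ), φ (L t) = t ∧ L t ∈ U ∧ f (L t) = f z + φ (L t) ^ n :=
    hright.and ((hLt.eventually hU).and (hLt.eventually hfφ))
  have hall : ∀ᶠ t in 𝓝[≠] (0 : ℂ), (φ (L t) = t ∧ L t ∈ U ∧ f (L t) = f z + φ (L t) ^ n) ∧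
      (φ (L (η * t)) = η * t ∧ L (η * t) ∈ U ∧ f (L (η * t)) = f z + φ (L (η * t)) ^ n) ∧
      t ≠ 0 :=
    (hgood.filter_mono nhdsWithin_le_nhds).and
      (((hmul.eventually hgood).filter_mono nhdsWithin_le_nhds).and self_mem_nhdsWithin)
  obtain ⟨t, ⟨h1, h2, h3⟩, ⟨h4, h5, h6⟩, ht⟩ := hall.exists
  have heq : L t = L (η * t) := by
    apply hinj h2 h5
    rw [h3, h6, h1, h4, mul_pow, hη.pow_eq_one, one_mul]
  have : t = η * t := by rw [← h4, ← heq, h1]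
  exact hη1 (mul_right_cancel₀ ht (by rw [one_mul, ← this]))

/-! ### Homogeneous coordinates on the Riemann sphere. -/

open Classical in
/-- The point of the Riemann sphere with homogeneous coordinates `[a : b]`. -/
def ratio (a b : ℂ) : OnePoint ℂ := if b = 0 then OnePoint.infty else ((a / b : ℂ) : OnePoint ℂ)

theorem ratio_of_ne {a b : ℂ} (hb : b ≠ 0) : ratio a b = ((a / b : ℂ) : OnePoint ℂ) := if_neg hb

@[simp] theorem ratio_zero (a : ℂ) : ratio a 0 = OnePoint.infty := if_pos rfl

@[simp] theorem ratio_one (a : ℂ) : ratio a 1 = (a : OnePoint ℂ) := by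
  rw [ratio_of_ne one_ne_zero, div_one]

theorem ratio_mul_left {c : ℂ} (hc : c ≠ 0) (a b : ℂ) : ratio (c * a) (c * b) = ratio a b := by
  by_cases hb : b = 0
  · simp [hb]
  · rw [ratio_of_ne hb, ratio_of_ne (mul_ne_zero hc hb), mul_div_mul_left _ _ hc]

theorem map_mul_ratio (c a b : ℂ) :
    OnePoint.map (fun w : ℂ => c * w) (ratio a b) = ratio (c * a) b := by
  by_cases hb : b = 0
  · simp [hb]
  · rw [ratio_of_ne hb, ratio_of_ne hb, OnePoint.map_some, mul_div_assoc]

theorem map_add_ratio (c a b : ℂ) :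
    OnePoint.map (fun w : ℂ => w + c) (ratio a b) = ratio (a + c * b) b := by
  by_cases hb : b = 0
  · simp [hb]
  · rw [ratio_of_ne hb, ratio_of_ne hb, OnePoint.map_some, add_div, mul_div_cancel_right₀ _ hb]

/-- The pair `(0, 0)` must be excluded: `ratio 0 0` has the default value `∞`, which a Möbius map
may move. -/
theorem smul_ratio (ψ : GL (Fin 2) ℂ) {a b : ℂ} (h : a ≠ 0 ∨ b ≠ 0) :
    ψ • ratio a b = ratio (ψ 0 0 * a + ψ 0 1 * b) (ψ 1 0 * a + ψ 1 1 * b) := by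
  by_cases hb : b = 0
  · have ha : a ≠ 0 := by simpa [hb] using h
    subst hb
    rw [ratio_zero, OnePoint.smul_infty_eq_ite]
    simp only [mul_zero, add_zero]
    by_cases hc : ψ 1 0 = 0
    · simp [hc]
    · rw [if_neg hc, ratio_of_ne (mul_ne_zero hc ha), mul_div_mul_right _ _ ha]
  · rw [ratio_of_ne hb, OnePoint.smul_some_eq_ite]
    have h1 : ψ 1 0 * (a / b) + ψ 1 1 = (ψ 1 0 * a + ψ 1 1 * b) / b := by field_simp
    have h0 : ψ 0 0 * (a / b) + ψ 0 1 = (ψ 0 0 * a + ψ 0 1 * b) / b := by field_simp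
    rw [h1, h0]
    by_cases hc : ψ 1 0 * a + ψ 1 1 * b = 0
    · simp [hc]
    · rw [if_neg (div_ne_zero hc hb), ratio_of_ne hc, div_div_div_cancel_right₀ hb]

theorem exists_smul_ratio_of_det_ne_zero {p q r s : ℂ} (h : p * s - q * r ≠ 0) :
    ∃ ψ : GL (Fin 2) ℂ, ∀ a b : ℂ, (a ≠ 0 ∨ b ≠ 0) →
      ψ • ratio a b = ratio (p * a + q * b) (r * a + s * b) := by
  refine ⟨Matrix.GeneralLinearGroup.mkOfDetNeZero !![p, q; r, s]
    (by rwa [Matrix.det_fin_two_of]), fun a b hab => ?_⟩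
  rw [smul_ratio _ hab]
  rfl

theorem linear_ne_zero {p q r s a b : ℂ} (h : p * s - q * r ≠ 0) (hab : a ≠ 0 ∨ b ≠ 0) :
    p * a + q * b ≠ 0 ∨ r * a + s * b ≠ 0 := by
  by_contra! hcon
  obtain ⟨h1, h2⟩ := hcon
  have ha : (p * s - q * r) * a = 0 := by linear_combination s * h1 - q * h2
  have hb : (p * s - q * r) * b = 0 := by linear_combination p * h2 - r * h1
  rcases hab with hab | hab
  · exact hab ((mul_eq_zero.mp ha).resolve_left h)
  · exact hab ((mul_eq_zero.mp hb).resolve_left h)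

theorem coord_coe (x : ℂ) : coord (x : OnePoint ℂ) = x := rfl

theorem coord_infty : coord OnePoint.infty = 0 := rfl

theorem coe_coord {p : OnePoint ℂ} (hp : p ≠ OnePoint.infty) : (coord p : OnePoint ℂ) = p := by
  induction p using OnePoint.rec with
  | infty => exact absurd rfl hp
  | coe x => rfl

/-- The Wronskian `a' b - a b'`, which is the numerator of the derivative of `a / b`. -/
def wronskian (a b : ℂ → ℂ) (z : ℂ) : ℂ := deriv a z * b z - a z * deriv b z

theorem ne_zero_of_wronskian {a b : ℂ → ℂ} {z : ℂ} (h : wronskian a b z ≠ 0) :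
    a z ≠ 0 ∨ b z ≠ 0 := by
  by_contra! hcon
  exact h (by simp [wronskian, hcon.1, hcon.2])

theorem hasDerivAt_div_wronskian {a b : ℂ → ℂ} {z : ℂ} (ha : AnalyticAt ℂ a z)
    (hb : AnalyticAt ℂ b z) (h : b z ≠ 0) :
    HasDerivAt (fun w => a w / b w) (wronskian a b z / b z ^ 2) z :=
  ha.differentiableAt.hasDerivAt.div hb.differentiableAt.hasDerivAt h

theorem continuousAt_ratio {a b : ℂ → ℂ} {z : ℂ} (ha : AnalyticAt ℂ a z)
    (hb : AnalyticAt ℂ b z) (h : a z ≠ 0 ∨ b z ≠ 0) :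
    ContinuousAt (fun w => ratio (a w) (b w)) z := by
  by_cases hbz : b z = 0
  · have haz : a z ≠ 0 := by simpa [hbz] using h
    have hlim : Tendsto (fun w => ratio (a w) (b w)) (𝓝 z) (𝓝 OnePoint.infty) := by
      rw [Tendsto, OnePoint.le_nhds_infty]
      intro s _ hs
      -- A neighbourhood of `∞` omits only a bounded set, of radius `R` say; `‖a‖ > R ‖b‖` holds at
      -- `z`, where `b = 0`, and persists nearby.
      obtain ⟨R, hR⟩ := hs.isBounded.exists_norm_le
      have h1 : ContinuousAt (fun w => ‖a w‖ - R * ‖b w‖) z :=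
        ha.continuousAt.norm.sub (continuousAt_const.mul hb.continuousAt.norm)
      have h2 : 0 < ‖a z‖ - R * ‖b z‖ := by simp [hbz, haz]
      rw [mem_map]
      filter_upwards [h1.eventually (lt_mem_nhds h2)] with w hw
      by_cases hbw : b w = 0
      · right
        simp [hbw]
      · left
        refine ⟨a w / b w, fun hmem => ?_, (ratio_of_ne hbw).symm⟩
        have := hR _ hmem
        rw [norm_div, div_le_iff₀ (norm_pos_iff.mpr hbw)] at this
        linarith
    have : ratio (a z) (b z) = OnePoint.infty := by simp [hbz]
    rw [ContinuousAt, this]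
    exact hlim
  · have h1 : ContinuousAt (fun w => ((a w / b w : ℂ) : OnePoint ℂ)) z :=
      OnePoint.continuous_coe.continuousAt.comp (ha.continuousAt.div hb.continuousAt hbz)
    refine h1.congr ?_
    filter_upwards [hb.continuousAt.eventually_ne hbz] with w hw
    rw [ratio_of_ne hw]

theorem eventually_ne_of_wronskian {a b : ℂ → ℂ} {z : ℂ}
    (hb : AnalyticAt ℂ b z) (h : wronskian a b z ≠ 0) : ∀ᶠ w in 𝓝[≠] z, b w ≠ 0 := by
  by_cases hbz : b z = 0
  · have hd : deriv b z ≠ 0 := by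
      intro hd
      exact h (by simp [wronskian, hbz, hd])
    exact hb.differentiableAt.hasDerivAt.eventually_ne hd
  · exact (hb.continuousAt.eventually_ne hbz).filter_mono nhdsWithin_le_nhds

theorem sphereMeromorphicAt_ratio {a b : ℂ → ℂ} {z : ℂ} (ha : AnalyticAt ℂ a z)
    (hb : AnalyticAt ℂ b z) (h : a z ≠ 0 ∨ b z ≠ 0) (hne : ∀ᶠ w in 𝓝[≠] z, b w ≠ 0) :
    SphereMeromorphicAt (fun w => ratio (a w) (b w)) z :=
  ⟨continuousAt_ratio ha hb h, fun w => a w / b w, ha.meromorphicAt.div hb.meromorphicAt,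
    hne.mono fun _ hw => ratio_of_ne hw⟩

theorem SphereMeromorphicAt.congr {f g : ℂ → OnePoint ℂ} {z : ℂ} (hf : SphereMeromorphicAt f z)
    (h : f =ᶠ[𝓝 z] g) : SphereMeromorphicAt g z := by
  obtain ⟨h1, φ, h2, h3⟩ := hf
  refine ⟨h1.congr h, φ, h2, ?_⟩
  filter_upwards [h3, h.filter_mono nhdsWithin_le_nhds] with w hw1 hw2
  rw [← hw2, hw1]

theorem exists_injOn_of_deriv_ne_zero {f : ℂ → ℂ} {z : ℂ} (hf : AnalyticAt ℂ f z)
    (h : deriv f z ≠ 0) : ∃ U ∈ 𝓝 z, InjOn f U := by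
  have h1 := hf.hasStrictDerivAt
  refine ⟨_, HasStrictDerivAt.eventually_left_inverse h1 h, fun x hx y hy hxy => ?_⟩
  rw [← hx, ← hy, hxy]

theorem exists_injOn_ratio {a b : ℂ → ℂ} {z : ℂ} (ha : AnalyticAt ℂ a z)
    (hb : AnalyticAt ℂ b z) (h : wronskian a b z ≠ 0) :
    ∃ U ∈ 𝓝 z, InjOn (fun w => ratio (a w) (b w)) U := by
  have key : ∀ {a b : ℂ → ℂ}, AnalyticAt ℂ a z → AnalyticAt ℂ b z → wronskian a b z ≠ 0 →
      b z ≠ 0 → ∃ U ∈ 𝓝 z, InjOn (fun w => ratio (a w) (b w)) U := by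
    intro a b ha hb h hbz
    have hd := hasDerivAt_div_wronskian ha hb hbz
    obtain ⟨U, hU, hinj⟩ := exists_injOn_of_deriv_ne_zero (ha.fun_div hb hbz)
      (by rw [hd.deriv]; exact div_ne_zero h (pow_ne_zero 2 hbz))
    refine ⟨U ∩ {w | b w ≠ 0}, inter_mem hU (hb.continuousAt.eventually_ne hbz), ?_⟩
    rintro x ⟨hx, hbx⟩ y ⟨hy, hby⟩ hxy
    simp only [ratio_of_ne hbx, ratio_of_ne hby, OnePoint.coe_eq_coe] at hxy
    exact hinj hx hy hxy
  by_cases hbz : b z = 0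
  · have haz : a z ≠ 0 := by simpa [hbz] using ne_zero_of_wronskian h
    obtain ⟨U, hU, hinj⟩ := key hb ha
      (by rw [show wronskian b a z = - wronskian a b z by simp only [wronskian]; ring]
          exact neg_ne_zero.mpr h) haz
    -- The inversion `[a : b] ↦ [b : a]` carries injectivity of `b / a` over to `a / b`.
    obtain ⟨ψ, hψ⟩ := exists_smul_ratio_of_det_ne_zero (p := 0) (q := 1) (r := 1) (s := 0)
      (by norm_num)
    refine ⟨U ∩ {w | a w ≠ 0}, inter_mem hU (ha.continuousAt.eventually_ne haz), ?_⟩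
    rintro x ⟨hx, hax⟩ y ⟨hy, hay⟩ hxy
    apply hinj hx hy
    have hx' := hψ (a x) (b x) (Or.inl hax)
    have hy' := hψ (a y) (b y) (Or.inl hay)
    simp only [zero_mul, one_mul, zero_add, add_zero] at hx' hy' hxy ⊢
    rw [← hx', ← hy', hxy]
  · exact key ha hb h hbz

theorem univalent_ratio {g : ℂ → OnePoint ℂ} {S : Set ℂ} {a b : ℂ → ℂ} {z : ℂ}
    (ha : AnalyticAt ℂ a z) (hb : AnalyticAt ℂ b z) (h : wronskian a b z ≠ 0)
    (hg : g =ᶠ[𝓝[S] z] fun w => ratio (a w) (b w)) :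
    ∃ G : ℂ → OnePoint ℂ, SphereMeromorphicAt G z ∧ (∃ U ∈ 𝓝 z, InjOn G U) ∧
      G =ᶠ[𝓝[S] z] g :=
  ⟨_, sphereMeromorphicAt_ratio ha hb (ne_zero_of_wronskian h) (eventually_ne_of_wronskian hb h),
    exists_injOn_ratio ha hb h, hg.symm⟩

/-- A meromorphic function that is continuous at the point, with its actual value there, is
analytic. Hence the coordinate `G`, or `1 / G` at a pole, is analytic, and injectivity makes its
derivative nonzero; paired with the constant `1` it gives the quotient. -/
theorem exists_analytic_ratio {G : ℂ → OnePoint ℂ} {z : ℂ} (hG : SphereMeromorphicAt G z)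
    {U : Set ℂ} (hU : U ∈ 𝓝 z) (hinj : InjOn G U) :
    ∃ a b : ℂ → ℂ, AnalyticAt ℂ a z ∧ AnalyticAt ℂ b z ∧ wronskian a b z ≠ 0 ∧
      G =ᶠ[𝓝 z] fun w => ratio (a w) (b w) := by
  obtain ⟨hc, φ, hφ, hGφ⟩ := hG
  by_cases hz : G z = OnePoint.infty
  · have hbig : ∀ R : ℝ, ∀ᶠ w in 𝓝 z, G w = OnePoint.infty ∨ R < ‖coord (G w)‖ := by
      intro R
      have h1 : Tendsto G (𝓝 z) (𝓝 OnePoint.infty) := hz ▸ hc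
      rw [Tendsto, OnePoint.le_nhds_infty] at h1
      have h2 := h1 (Metric.closedBall 0 R) Metric.isClosed_closedBall (isCompact_closedBall 0 R)
      filter_upwards [h2] with w hw
      rcases hw with ⟨x, hx, hxw⟩ | hw
      · right
        rw [← hxw, coord_coe]
        simpa using hx
      · exact Or.inl hw
    set u : ℂ → ℂ := fun w => (coord (G w))⁻¹ with hu
    have huz : u z = 0 := by simp [hu, hz, coord_infty]
    have hmer : MeromorphicAt u z := by
      refine hφ.inv.congr ?_
      filter_upwards [hGφ] with w hw
      simp [hu, hw, coord_coe]
    have hcont : ContinuousAt u z := by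
      rw [ContinuousAt, huz, Metric.tendsto_nhds]
      intro δ hδ
      filter_upwards [hbig δ⁻¹] with w hw
      rcases hw with hw | hw
      · simpa [hu, hw, coord_infty] using hδ
      · rw [hu, dist_zero_right, norm_inv]
        exact inv_lt_of_inv_lt₀ hδ hw
    have hua : AnalyticAt ℂ u z := hmer.analyticAt hcont
    have hGu : G =ᶠ[𝓝 z] fun w => ratio 1 (u w) := by
      filter_upwards [hbig 0] with w hw
      by_cases hw' : G w = OnePoint.infty
      · simp [hu, hw', coord_infty]
      · have hne : coord (G w) ≠ 0 := by
          simpa using hw.resolve_left hw'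
        rw [hu, ratio_of_ne (inv_ne_zero hne), one_div, inv_inv, coe_coord hw']
    refine ⟨fun _ => 1, u, analyticAt_const, hua, ?_, hGu⟩
    have huinj : InjOn u (U ∩ {w | G w = ratio 1 (u w)}) := by
      rintro x ⟨hx, hx'⟩ y ⟨hy, hy'⟩ hxy
      apply hinj hx hy
      rw [hx', hy', hxy]
    have := deriv_ne_zero_of_injOn hua (inter_mem hU hGu) huinj
    simpa [wronskian] using this
  · have hfin : ∀ᶠ w in 𝓝 z, G w ≠ OnePoint.infty := hc.eventually_ne hz
    set q : ℂ → ℂ := fun w => coord (G w) with hq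
    have hGq : G =ᶠ[𝓝 z] fun w => (q w : OnePoint ℂ) := by
      filter_upwards [hfin] with w hw
      rw [hq, coe_coord hw]
    have hmer : MeromorphicAt q z := by
      refine hφ.congr ?_
      filter_upwards [hGφ] with w hw
      simp [hq, hw, coord_coe]
    have hcont : ContinuousAt q z := by
      have h1 : ContinuousAt (fun w => (q w : OnePoint ℂ)) z := hc.congr hGq
      exact (OnePoint.isOpenEmbedding_coe.isInducing.continuousAt_iff).mpr h1
    have hqa : AnalyticAt ℂ q z := hmer.analyticAt hcont
    refine ⟨q, fun _ => 1, hqa, analyticAt_const, ?_, by simpa using hGq⟩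
    have hqinj : InjOn q (U ∩ {w | G w = (q w : OnePoint ℂ)}) := by
      rintro x ⟨hx, hx'⟩ y ⟨hy, hy'⟩ hxy
      apply hinj hx hy
      rw [hx', hy', hxy]
    have := deriv_ne_zero_of_injOn hqa (inter_mem hU hGq) hqinj
    simpa [wronskian] using this

/-- The homogeneous form of (1) covers finite points and poles at once, so no later argument has to
choose a chart of the sphere. -/
theorem conformalFactor_ratio {K : ℝ} {g : ℂ → OnePoint ℂ} {S : Set ℂ} {a b : ℂ → ℂ} {z : ℂ}
    (hz : z ∈ S) (hS : UniqueDiffWithinAt ℂ S z) (ha : AnalyticAt ℂ a z) (hb : AnalyticAt ℂ b z)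
    (h0 : a z ≠ 0 ∨ b z ≠ 0) (hg : g =ᶠ[𝓝[S] z] fun w => ratio (a w) (b w)) :
    conformalFactor K g S z =
      4 * ‖wronskian a b z‖ ^ 2 / (‖b z‖ ^ 2 + K * ‖a z‖ ^ 2) ^ 2 := by
  have hgz : g z = ratio (a z) (b z) := hg.self_of_nhdsWithin hz
  by_cases hbz : b z = 0
  · have haz : a z ≠ 0 := by simpa [hbz] using h0
    have hgz' : g z = OnePoint.infty := by rw [hgz, hbz, ratio_zero]
    have heq : (fun w => (coord (g w))⁻¹) =ᶠ[𝓝[S] z] fun w => b w / a w := by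
      filter_upwards [hg] with w hw
      rw [hw]
      by_cases hbw : b w = 0
      · simp [hbw, coord_infty]
      · rw [ratio_of_ne hbw, coord_coe, inv_div]
    have hd : derivWithin (fun w => (coord (g w))⁻¹) S z = wronskian b a z / a z ^ 2 := by
      rw [heq.derivWithin_eq (by simp [hgz', coord_infty, hbz])]
      exact (hasDerivAt_div_wronskian hb ha haz).hasDerivWithinAt.derivWithin hS
    rw [conformalFactor, if_pos hgz', hd, hgz', coord_infty,
      show wronskian b a z = - wronskian a b z by simp only [wronskian]; ring]
    have : ‖a z‖ ≠ 0 := norm_ne_zero_iff.mpr haz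
    -- For `K = 0` both denominators vanish at a pole, and both sides are `0` by the convention for
    -- division by zero.
    by_cases hK : K = 0
    · simp [hK, hbz]
    · simp only [norm_div, norm_neg, norm_pow, hbz, inv_zero, norm_zero, ne_eq, OfNat.ofNat_ne_zero,
        not_false_eq_true, zero_pow, zero_add]
      field_simp
  · have hgz' : g z = ((a z / b z : ℂ) : OnePoint ℂ) := by rw [hgz, ratio_of_ne hbz]
    have heq : (fun w => coord (g w)) =ᶠ[𝓝[S] z] fun w => a w / b w := by
      filter_upwards [hg, (hb.continuousAt.eventually_ne hbz).filter_mono nhdsWithin_le_nhds]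
        with w hw hbw
      rw [hw, ratio_of_ne hbw, coord_coe]
    have hd : derivWithin (fun w => coord (g w)) S z = wronskian a b z / b z ^ 2 := by
      rw [heq.derivWithin_eq (by rw [hgz', coord_coe])]
      exact (hasDerivAt_div_wronskian ha hb hbz).hasDerivWithinAt.derivWithin hS
    have hb' : ‖b z‖ ≠ 0 := norm_ne_zero_iff.mpr hbz
    rw [conformalFactor, if_neg (by rw [hgz']; exact OnePoint.coe_ne_infty _), hd, hgz', coord_coe]
    simp only [norm_div, norm_pow]
    have h1 : 1 + K * (‖a z‖ / ‖b z‖) ^ 2 = (‖b z‖ ^ 2 + K * ‖a z‖ ^ 2) / ‖b z‖ ^ 2 := by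
      field_simp
    rw [h1, div_pow, div_pow, div_div_eq_mul_div]
    congr 1
    field_simp

/-! ### Wirtinger calculus, valid up to the boundary. -/

/-- The real-linear map `ζ ↦ A ζ + B ζ̄`. A function with this differential has Wirtinger
derivatives `∂f/∂z = A` and `∂f/∂z̄ = B`. -/
def wirt (A B : ℂ) : ℂ →L[ℝ] ℂ :=
  A • (ContinuousLinearMap.id ℝ ℂ) + B • (Complex.conjCLE : ℂ →L[ℝ] ℂ)

@[simp] theorem wirt_apply (A B ζ : ℂ) : wirt A B ζ = A * ζ + B * conj ζ := by
  simp [wirt]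

/-- `f` has Wirtinger derivatives `A`, `B` at `z` within `S`. -/
abbrev HasWirtWithinAt (f : ℂ → ℂ) (A B : ℂ) (S : Set ℂ) (z : ℂ) : Prop :=
  HasFDerivWithinAt f (wirt A B) S z

section Wirtinger

variable {f g : ℂ → ℂ} {A B A' B' : ℂ} {S : Set ℂ} {z : ℂ}

theorem wirt_ext (h1 : A = A') (h2 : B = B') : wirt A B = wirt A' B' := by rw [h1, h2]

theorem HasWirtWithinAt.congr_wirt (hf : HasWirtWithinAt f A B S z) (h1 : A = A') (h2 : B = B') :
    HasWirtWithinAt f A' B' S z := h1 ▸ h2 ▸ hf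

theorem hasWirtWithinAt_const (c : ℂ) : HasWirtWithinAt (fun _ => c) 0 0 S z :=
  (hasFDerivWithinAt_const c z S).congr_fderiv (by ext; simp)

theorem HasWirtWithinAt.comp_deriv {φ : ℂ → ℂ} {φ' : ℂ} (hφ : HasDerivAt φ φ' (f z))
    (hf : HasWirtWithinAt f A B S z) :
    HasWirtWithinAt (fun w => φ (f w)) (φ' * A) (φ' * B) S z :=
  ((hφ.hasFDerivAt.restrictScalars ℝ).comp_hasFDerivWithinAt z hf).congr_fderiv
    (by ext; simp; ring)

theorem hasWirtWithinAt_of_hasDerivWithinAt (hf : HasDerivWithinAt f A S z) :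
    HasWirtWithinAt f A 0 S z :=
  (hf.hasFDerivWithinAt.restrictScalars ℝ).congr_fderiv (by ext; simp; ring)

/-- These are the Cauchy–Riemann equations: without a `ζ̄` part the real differential is complex
linear. Being relative to `S`, this also applies at boundary points. -/
theorem hasDerivWithinAt_of_hasWirtWithinAt (hf : HasWirtWithinAt f A 0 S z) :
    HasDerivWithinAt f A S z := by
  have h : HasFDerivWithinAt f ((ContinuousLinearMap.toSpanSingleton ℂ A).restrictScalars ℝ) S z :=
    hf.congr_fderiv (by ext; simp; ring)
  have h2 : HasFDerivWithinAt f (ContinuousLinearMap.toSpanSingleton ℂ A) S z :=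
    HasFDerivWithinAt.of_restrictScalars ℝ h rfl
  exact h2.hasDerivWithinAt.congr_deriv (by simp)

theorem HasWirtWithinAt.add (hf : HasWirtWithinAt f A B S z) (hg : HasWirtWithinAt g A' B' S z) :
    HasWirtWithinAt (fun w => f w + g w) (A + A') (B + B') S z :=
  (HasFDerivWithinAt.fun_add hf hg).congr_fderiv (by ext; simp; ring)

theorem HasWirtWithinAt.sub (hf : HasWirtWithinAt f A B S z) (hg : HasWirtWithinAt g A' B' S z) :
    HasWirtWithinAt (fun w => f w - g w) (A - A') (B - B') S z :=
  (HasFDerivWithinAt.fun_sub hf hg).congr_fderiv (by ext; simp; ring)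

theorem HasWirtWithinAt.mul (hf : HasWirtWithinAt f A B S z) (hg : HasWirtWithinAt g A' B' S z) :
    HasWirtWithinAt (fun w => f w * g w) (A * g z + f z * A') (B * g z + f z * B') S z :=
  (HasFDerivWithinAt.fun_mul hf hg).congr_fderiv (by ext; simp; ring)

theorem HasWirtWithinAt.conj (hf : HasWirtWithinAt f A B S z) :
    HasWirtWithinAt (fun w => conj (f w)) (conj B) (conj A) S z :=
  ((Complex.conjCLE : ℂ →L[ℝ] ℂ).hasFDerivAt.comp_hasFDerivWithinAt z hf).congr_fderiv
    (by ext; simp; ring)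

theorem HasWirtWithinAt.const_mul (c : ℂ) (hf : HasWirtWithinAt f A B S z) :
    HasWirtWithinAt (fun w => c * f w) (c * A) (c * B) S z :=
  ((hasWirtWithinAt_const c).mul hf).congr_wirt (by ring) (by ring)

theorem HasWirtWithinAt.inv (hf : HasWirtWithinAt f A B S z) (h : f z ≠ 0) :
    HasWirtWithinAt (fun w => (f w)⁻¹) (-A / f z ^ 2) (-B / f z ^ 2) S z :=
  (HasWirtWithinAt.comp_deriv (hasDerivAt_inv h) hf).congr_wirt (by ring) (by ring)

theorem HasWirtWithinAt.div (hf : HasWirtWithinAt f A B S z) (hg : HasWirtWithinAt g A' B' S z)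
    (h : g z ≠ 0) :
    HasWirtWithinAt (fun w => f w / g w) ((A * g z - f z * A') / g z ^ 2)
      ((B * g z - f z * B') / g z ^ 2) S z := by
  refine ((hf.mul (hg.inv h)).congr_wirt ?_ ?_).congr_of_eventuallyEq
    (Filter.Eventually.of_forall fun w => div_eq_mul_inv _ _) (div_eq_mul_inv _ _)
  · field_simp
    ring
  · field_simp
    ring

theorem HasWirtWithinAt.log_ofReal {u : ℂ → ℝ} (hf : HasWirtWithinAt (fun w => (u w : ℂ)) A B S z)
    (h : 0 < u z) :
    HasWirtWithinAt (fun w => (Real.log (u w) : ℂ)) (A / u z) (B / u z) S z := by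
  have h1 := HasWirtWithinAt.comp_deriv
    (Complex.hasDerivAt_log (Complex.ofReal_mem_slitPlane.mpr h)) hf
  have h2 : ∀ᶠ w in 𝓝[S] z, 0 < u w := by
    have hc : ContinuousWithinAt u S z := by
      have := Complex.continuous_re.continuousAt.comp_continuousWithinAt hf.continuousWithinAt
      exact this
    exact hc.eventually (lt_mem_nhds h)
  refine HasWirtWithinAt.congr_wirt (f := fun w => (Real.log (u w) : ℂ))
    (h1.congr_of_eventuallyEq ?_ (Complex.ofReal_log h.le)) (by ring) (by ring)
  filter_upwards [h2] with w hw
  exact Complex.ofReal_log hw.le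

/-- A real function whose gradient is given by `P` has Laplacian `4 ∂P/∂z̄`. -/
theorem laplacian_of_wirt {f : ℂ → ℝ} {P : ℂ → ℂ}
    (h : ∀ᶠ w in 𝓝 z, HasFDerivAt (fun w => (f w : ℂ)) (wirt (P w) (conj (P w))) w)
    (hP : HasFDerivAt P (wirt A B) z) : Laplacian.laplacian f z = 4 * B.re := by
  -- `T P` is the functional `ζ ↦ 2 Re (P ζ)`, the differential of a real function with `∂f/∂z = P`.
  set T : ℂ →L[ℝ] ℂ →L[ℝ] ℝ :=
    (ContinuousLinearMap.compL ℝ ℂ ℂ ℝ ((2 : ℝ) • Complex.reCLM)) ∘L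
      (ContinuousLinearMap.mul ℝ ℂ) with hT
  have h1 : fderiv ℝ f =ᶠ[𝓝 z] fun w => T (P w) := by
    filter_upwards [h] with w hw
    have h2 : HasFDerivAt f (Complex.reCLM ∘L wirt (P w) (conj (P w))) w :=
      Complex.reCLM.hasFDerivAt.comp w hw
    rw [h2.fderiv]
    ext; simp [hT] ; ring
  have h3 : HasFDerivAt (fderiv ℝ f) (T ∘L wirt A B) z :=
    (T.hasFDerivAt.comp z hP).congr_of_eventuallyEq h1
  rw [InnerProductSpace.laplacian_eq_iteratedFDeriv_complexPlane]
  simp only [iteratedFDeriv_two_apply, h3.fderiv]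
  simp [hT]
  ring

end Wirtinger

/-! ### The Liouville equation for a quotient of holomorphic functions. -/

theorem analyticAt_wronskian {a b : ℂ → ℂ} {z : ℂ} (ha : AnalyticAt ℂ a z)
    (hb : AnalyticAt ℂ b z) : AnalyticAt ℂ (wronskian a b) z :=
  (ha.deriv.mul hb).sub (ha.mul hb.deriv)

theorem AnalyticAt.hasWirtWithinAt {a : ℂ → ℂ} {S : Set ℂ} {z : ℂ} (ha : AnalyticAt ℂ a z) :
    HasWirtWithinAt a (deriv a z) 0 S z :=
  hasWirtWithinAt_of_hasDerivWithinAt ha.differentiableAt.hasDerivAt.hasDerivWithinAt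

/-- The Hermitian form `|b|² + K |a|²`. -/
def hermForm (K : ℝ) (a b : ℂ → ℂ) (z : ℂ) : ℝ := ‖b z‖ ^ 2 + K * ‖a z‖ ^ 2

/-- The logarithm of the conformal factor of `a / b`. -/
def logFactor (K : ℝ) (a b : ℂ → ℂ) (z : ℂ) : ℝ :=
  Real.log (4 * ‖wronskian a b z‖ ^ 2 / hermForm K a b z ^ 2)

/-- The holomorphic derivative of `hermForm`. -/
def hermFormDeriv (K : ℝ) (a b : ℂ → ℂ) (z : ℂ) : ℂ :=
  deriv b z * conj (b z) + K * (deriv a z * conj (a z))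

/-- The holomorphic derivative of `logFactor`. -/
def logFactorDeriv (K : ℝ) (a b : ℂ → ℂ) (z : ℂ) : ℂ :=
  deriv (wronskian a b) z / wronskian a b z - 2 * (hermFormDeriv K a b z / hermForm K a b z)

section LogFactor

variable {K : ℝ} {a b : ℂ → ℂ} {z : ℂ}

theorem ofReal_hermForm (K : ℝ) (a b : ℂ → ℂ) (z : ℂ) :
    (hermForm K a b z : ℂ) = b z * conj (b z) + K * (a z * conj (a z)) := by
  simp [hermForm, Complex.mul_conj']

theorem hasWirt_hermForm {S : Set ℂ} (ha : AnalyticAt ℂ a z) (hb : AnalyticAt ℂ b z) :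
    HasWirtWithinAt (fun w => (hermForm K a b w : ℂ)) (hermFormDeriv K a b z)
      (conj (hermFormDeriv K a b z)) S z := by
  have ha' := AnalyticAt.hasWirtWithinAt (S := S) ha
  have hb' := AnalyticAt.hasWirtWithinAt (S := S) hb
  simp only [ofReal_hermForm]
  refine ((hb'.mul hb'.conj).add ((ha'.mul ha'.conj).const_mul (K : ℂ))).congr_wirt ?_ ?_
  · simp [hermFormDeriv]
  · simp [hermFormDeriv]
    ring

theorem hasWirt_hermFormDeriv {S : Set ℂ} (ha : AnalyticAt ℂ a z) (hb : AnalyticAt ℂ b z) :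
    HasWirtWithinAt (hermFormDeriv K a b)
      (deriv (deriv b) z * conj (b z) + K * (deriv (deriv a) z * conj (a z)))
      (deriv b z * conj (deriv b z) + K * (deriv a z * conj (deriv a z))) S z := by
  have ha' := AnalyticAt.hasWirtWithinAt (S := S) ha
  have hb' := AnalyticAt.hasWirtWithinAt (S := S) hb
  have ha'' := AnalyticAt.hasWirtWithinAt (S := S) ha.deriv
  have hb'' := AnalyticAt.hasWirtWithinAt (S := S) hb.deriv
  refine ((hb''.mul hb'.conj).add ((ha''.mul ha'.conj).const_mul (K : ℂ))).congr_wirt ?_ ?_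
  · simp
  · simp

theorem hasWirt_logFactor {S : Set ℂ} (ha : AnalyticAt ℂ a z) (hb : AnalyticAt ℂ b z)
    (hW : wronskian a b z ≠ 0) (hN : 0 < hermForm K a b z) :
    HasWirtWithinAt (fun w => (logFactor K a b w : ℂ)) (logFactorDeriv K a b z)
      (conj (logFactorDeriv K a b z)) S z := by
  have hWa := analyticAt_wronskian ha hb
  have hW' := AnalyticAt.hasWirtWithinAt (S := S) hWa
  have hNw := hasWirt_hermForm (K := K) (S := S) ha hb
  have h1 : HasWirtWithinAt (fun w => ((‖wronskian a b w‖ ^ 2 : ℝ) : ℂ))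
      (deriv (wronskian a b) z * conj (wronskian a b z))
      (wronskian a b z * conj (deriv (wronskian a b) z)) S z := by
    have := (hW'.mul hW'.conj).congr_wirt (A' := deriv (wronskian a b) z * conj (wronskian a b z))
      (B' := wronskian a b z * conj (deriv (wronskian a b) z)) (by simp) (by simp)
    simpa only [Complex.mul_conj', Complex.ofReal_pow] using this
  have hWpos : 0 < ‖wronskian a b z‖ ^ 2 := by positivity
  have h2 := ((hasWirtWithinAt_const (S := S) (z := z) (Real.log 4 : ℂ)).add
    (h1.log_ofReal hWpos)).sub ((hNw.log_ofReal hN).const_mul 2)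
  have hne : conj (wronskian a b z) ≠ 0 := by simpa using hW
  have hWsq : ((‖wronskian a b z‖ ^ 2 : ℝ) : ℂ) = wronskian a b z * conj (wronskian a b z) := by
    rw [Complex.mul_conj', Complex.ofReal_pow]
  have hNC : (hermForm K a b z : ℂ) ≠ 0 := by exact_mod_cast hN.ne'
  -- The logarithm splits into `log 4`, `log |W|²` and `-2 log H`, which are differentiated
  -- separately; the splitting needs `W ≠ 0` and `H > 0`.
  have hlog : ∀ w, wronskian a b w ≠ 0 → 0 < hermForm K a b w →
      (logFactor K a b w : ℂ) = (Real.log 4 : ℂ) + (Real.log (‖wronskian a b w‖ ^ 2) : ℂ)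
        - 2 * (Real.log (hermForm K a b w) : ℂ) := by
    intro w hw hn
    rw [logFactor, Real.log_div (by positivity) (by positivity),
      Real.log_mul (by norm_num) (by positivity), Real.log_pow (n := 2) (x := hermForm K a b w)]
    push_cast
    ring
  have hev : ∀ᶠ w in 𝓝[S] z, wronskian a b w ≠ 0 ∧ 0 < hermForm K a b w := by
    have hc : ContinuousWithinAt (hermForm K a b) S z := by
      have := Complex.continuous_re.continuousAt.comp_continuousWithinAt hNw.continuousWithinAt
      exact this
    exact ((hWa.continuousAt.eventually_ne hW).filter_mono nhdsWithin_le_nhds).and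
      (hc.eventually (lt_mem_nhds hN))
  refine HasWirtWithinAt.congr_wirt (h2.congr_of_eventuallyEq
    (hev.mono fun w hw => hlog w hw.1 hw.2) (hlog z hW hN)) ?_ ?_
  · rw [logFactorDeriv, hWsq]
    field_simp
    ring
  · rw [logFactorDeriv, hWsq]
    simp only [map_sub, map_div₀, map_mul, Complex.conj_ofReal, Complex.conj_ofNat]
    field_simp
    ring

theorem eventually_logFactor_conditions (ha : AnalyticAt ℂ a z) (hb : AnalyticAt ℂ b z)
    (hW : wronskian a b z ≠ 0) (hN : 0 < hermForm K a b z) :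
    ∀ᶠ w in 𝓝 z, AnalyticAt ℂ a w ∧ AnalyticAt ℂ b w ∧ wronskian a b w ≠ 0 ∧
      0 < hermForm K a b w := by
  have hc : ContinuousAt (hermForm K a b) z :=
    (hb.continuousAt.norm.pow 2).add (continuousAt_const.mul (ha.continuousAt.norm.pow 2))
  filter_upwards [ha.eventually_analyticAt, hb.eventually_analyticAt,
    (analyticAt_wronskian ha hb).continuousAt.eventually_ne hW,
    hc.eventually (lt_mem_nhds hN)] with w h1 h2 h3 h4
  exact ⟨h1, h2, h3, h4⟩

theorem contDiffAt_logFactor (ha : AnalyticAt ℂ a z) (hb : AnalyticAt ℂ b z)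
    (hW : wronskian a b z ≠ 0) (hN : 0 < hermForm K a b z) :
    ContDiffAt ℝ 2 (logFactor K a b) z := by
  have h : ∀ {f : ℂ → ℂ}, AnalyticAt ℂ f z → ContDiffAt ℝ 2 (fun w => ‖f w‖ ^ 2) z :=
    fun hf => (hf.contDiffAt.restrict_scalars ℝ).norm_sq ℝ
  have hN2 : ContDiffAt ℝ 2 (hermForm K a b) z := (h hb).add (contDiffAt_const.mul (h ha))
  refine ContDiffAt.log ?_ (by positivity)
  exact (contDiffAt_const.mul (h (analyticAt_wronskian ha hb))).div (hN2.pow 2) (by positivity)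

theorem exp_logFactor (hW : wronskian a b z ≠ 0) (hN : 0 < hermForm K a b z) :
    Real.exp (logFactor K a b z) = 4 * ‖wronskian a b z‖ ^ 2 / hermForm K a b z ^ 2 :=
  Real.exp_log (by positivity)

theorem exp_half_logFactor (hW : wronskian a b z ≠ 0) (hN : 0 < hermForm K a b z) :
    Real.exp (logFactor K a b z / 2) = 2 * ‖wronskian a b z‖ / hermForm K a b z := by
  have h1 : Real.exp (logFactor K a b z / 2) ^ 2 = (2 * ‖wronskian a b z‖ / hermForm K a b z) ^ 2 := by
    rw [← Real.exp_nat_mul, Nat.cast_ofNat, mul_div_cancel₀ _ two_ne_zero, exp_logFactor hW hN]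
    ring
  exact (pow_left_inj₀ (Real.exp_pos _).le (by positivity) two_ne_zero).mp h1

/-- In `∂v/∂z = W'/W - 2 H_z/H` the first term is holomorphic, so only the second contributes to
`∂²v/∂z∂z̄`. Lagrange's identity `H H_{z z̄} - |H_z|² = K |W|²` then gives `-2 K |W|² / H² = -(K/2)
e^v`. -/
theorem liouville_logFactor (ha : AnalyticAt ℂ a z) (hb : AnalyticAt ℂ b z)
    (hW : wronskian a b z ≠ 0) (hN : 0 < hermForm K a b z) :
    Laplacian.laplacian (logFactor K a b) z + 2 * K * Real.exp (logFactor K a b z) = 0 := by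
  have h1 : ∀ᶠ w in 𝓝 z, HasFDerivAt (fun w => (logFactor K a b w : ℂ))
      (wirt (logFactorDeriv K a b w) (conj (logFactorDeriv K a b w))) w := by
    filter_upwards [eventually_logFactor_conditions ha hb hW hN] with w hw
    exact hasFDerivWithinAt_univ.mp (hasWirt_logFactor hw.1 hw.2.1 hw.2.2.1 hw.2.2.2)
  have hWa := analyticAt_wronskian ha hb
  have hNC : (hermForm K a b z : ℂ) ≠ 0 := by exact_mod_cast hN.ne'
  have h2 := ((AnalyticAt.hasWirtWithinAt (S := univ) hWa.deriv).div
    (AnalyticAt.hasWirtWithinAt (S := univ) hWa) hW).sub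
    (((hasWirt_hermFormDeriv (K := K) (S := univ) ha hb).div
      (hasWirt_hermForm (K := K) ha hb) hNC).const_mul 2)
  rw [laplacian_of_wirt h1 (hasFDerivWithinAt_univ.mp h2), exp_logFactor hW hN]
  have key : ((0 * wronskian a b z - deriv (wronskian a b) z * 0) / wronskian a b z ^ 2 -
      2 * (((deriv b z * conj (deriv b z) + K * (deriv a z * conj (deriv a z))) * hermForm K a b z
        - hermFormDeriv K a b z * conj (hermFormDeriv K a b z)) / hermForm K a b z ^ 2) : ℂ) =
      ((-2 * K * ‖wronskian a b z‖ ^ 2 / hermForm K a b z ^ 2 : ℝ) : ℂ) := by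
    have hWsq : ((‖wronskian a b z‖ : ℂ)) ^ 2 = wronskian a b z * conj (wronskian a b z) := by
      rw [Complex.mul_conj']
    push_cast
    rw [hWsq]
    field_simp
    rw [ofReal_hermForm]
    simp only [hermFormDeriv, wronskian, map_sub, map_add, map_mul, Complex.conj_ofReal,
      Complex.conj_conj]
    ring
  rw [key, Complex.ofReal_re]
  ring

end LogFactor

/-! ### The half-disk and the local data of an admissible map. -/

theorem isOpen_puncturedDisk (ε : ℝ) : IsOpen (puncturedDisk ε) :=
  (isOpen_lt continuous_const continuous_norm).inter (isOpen_lt continuous_norm continuous_const)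

theorem isOpen_halfDisk (ε : ℝ) : IsOpen (halfDisk ε) :=
  (isOpen_lt continuous_norm continuous_const).inter (isOpen_lt continuous_const Complex.continuous_im)

theorem puncturedHalfDisk_eq (ε : ℝ) :
    puncturedHalfDisk ε = {z : ℂ | 0 ≤ z.im} ∩ puncturedDisk ε := by
  ext z
  simp only [puncturedHalfDisk, puncturedDisk, mem_ofPred_eq, mem_inter_iff]
  tauto

theorem halfDisk_subset (ε : ℝ) : halfDisk ε ⊆ puncturedHalfDisk ε := by
  rintro z ⟨h1, h2⟩
  refine ⟨norm_pos_iff.mpr ?_, h1, h2.le⟩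
  rintro rfl
  simp at h2

theorem convex_closedHalfPlane : Convex ℝ {z : ℂ | 0 ≤ z.im} :=
  convex_halfSpace_ge Complex.imLm.isLinear 0

theorem uniqueDiffOn_puncturedHalfDisk (ε : ℝ) : UniqueDiffOn ℝ (puncturedHalfDisk ε) := by
  rw [puncturedHalfDisk_eq]
  refine UniqueDiffOn.inter (uniqueDiffOn_convex convex_closedHalfPlane ?_) (isOpen_puncturedDisk ε)
  refine ⟨Complex.I, mem_interior_iff_mem_nhds.mpr ?_⟩
  have : ∀ᶠ z : ℂ in 𝓝 Complex.I, 0 < z.im :=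
    Complex.continuous_im.continuousAt.eventually (lt_mem_nhds (by simp))
  exact this.mono fun z hz => hz.le

theorem ofReal_mem_puncturedHalfDisk {ε s : ℝ} (h0 : s ≠ 0) (h : |s| < ε) :
    (s : ℂ) ∈ puncturedHalfDisk ε :=
  ⟨by simpa using h0, by simpa using h, by simp⟩

theorem ratio_eq_iff {a b c d : ℂ} (h1 : a ≠ 0 ∨ b ≠ 0) (h2 : c ≠ 0 ∨ d ≠ 0) :
    ratio a b = ratio c d ↔ a * d = b * c := by
  by_cases hb : b = 0
  · have ha : a ≠ 0 := by simpa [hb] using h1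
    by_cases hd : d = 0
    · simp [hb, hd]
    · simp [hb, hd, ratio_of_ne hd, ha, OnePoint.infty_ne_coe]
  · by_cases hd : d = 0
    · have hc : c ≠ 0 := by simpa [hd] using h2
      simp [hb, hd, ratio_of_ne hb, hc]
    · rw [ratio_of_ne hb, ratio_of_ne hd, OnePoint.coe_eq_coe, div_eq_div_iff hb hd, mul_comm b c]

/-- For `K = 1` positivity is automatic. For `K ≤ 0` it comes from admissibility: `g` is finite, so
`b z ≠ 0`, and `H = |b|² (1 + K |g|²)`. -/
theorem hermForm_pos {K ε : ℝ} (hK : K = -1 ∨ K = 0 ∨ K = 1) {F g : ℂ → OnePoint ℂ}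
    (hg : IsAdmissible K ε F g) {z : ℂ} (hz : z ∈ puncturedHalfDisk ε) {a b : ℂ → ℂ}
    (h0 : a z ≠ 0 ∨ b z ≠ 0) (hab : g z = ratio (a z) (b z)) : 0 < hermForm K a b z := by
  rw [hermForm]
  by_cases hK1 : K = 1
  · rw [hK1]
    rcases h0 with h0 | h0 <;> positivity
  · have hK0 : K ≤ 0 := by rcases hK with h | h | h <;> first | linarith | exact absurd h hK1
    obtain ⟨w, hw, hpos⟩ := hg.holomorphic hK0 z hz
    have hb : b z ≠ 0 := by
      intro hb
      rw [hab, hb, ratio_zero] at hw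
      exact OnePoint.infty_ne_coe _ hw
    rw [hab, ratio_of_ne hb, OnePoint.coe_eq_coe] at hw
    have hbn : ‖b z‖ ≠ 0 := norm_ne_zero_iff.mpr hb
    have : ‖b z‖ ^ 2 + K * ‖a z‖ ^ 2 = ‖b z‖ ^ 2 * (1 + K * ‖w‖ ^ 2) := by
      rw [← hw, norm_div]
      field_simp
    rw [this]
    positivity

theorem eventuallyEq_logFactor {K ε : ℝ} {g : ℂ → OnePoint ℂ} {v : ℂ → ℝ}
    (hv : IsRepresentedBy K ε v g) {z : ℂ} {a b : ℂ → ℂ}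
    (ha : AnalyticAt ℂ a z) (hb : AnalyticAt ℂ b z) (hW : wronskian a b z ≠ 0)
    (hab : g =ᶠ[𝓝[puncturedHalfDisk ε] z] fun w => ratio (a w) (b w)) :
    v =ᶠ[𝓝[puncturedHalfDisk ε] z] logFactor K a b := by
  have h1 : ∀ᶠ w in 𝓝[puncturedHalfDisk ε] z, AnalyticAt ℂ a w ∧ AnalyticAt ℂ b w ∧
      wronskian a b w ≠ 0 :=
    (ha.eventually_analyticAt.and (hb.eventually_analyticAt.and
      ((analyticAt_wronskian ha hb).continuousAt.eventually_ne hW))).filter_mono nhdsWithin_le_nhds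
  filter_upwards [h1, eventually_eventually_nhdsWithin.mpr hab, self_mem_nhdsWithin]
    with w hw hgw hwS
  rw [hv w hwS, conformalFactor_ratio hwS ((uniqueDiffOn_puncturedHalfDisk ε).mono_field w hwS)
    hw.1 hw.2.1 (ne_zero_of_wronskian hw.2.2) hgw]
  rfl

theorem exists_local_pair {K ε : ℝ} {F g : ℂ → OnePoint ℂ}
    (hg : IsAdmissible K ε F g) {z : ℂ} (hz : z ∈ puncturedHalfDisk ε) :
    ∃ a b : ℂ → ℂ, AnalyticAt ℂ a z ∧ AnalyticAt ℂ b z ∧ wronskian a b z ≠ 0 ∧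
      g =ᶠ[𝓝[puncturedHalfDisk ε] z] fun w => ratio (a w) (b w) := by
  obtain ⟨G, hG, ⟨U, hU, hinj⟩, hGg⟩ := hg.univalent z hz
  obtain ⟨a, b, ha, hb, hW, hab⟩ := exists_analytic_ratio hG hU hinj
  exact ⟨a, b, ha, hb, hW, hGg.symm.trans (hab.filter_mono nhdsWithin_le_nhds)⟩

/-! ### The Neumann condition on a segment mapped into a circle. -/

theorem im_deriv_eq_zero {f : ℂ → ℂ} {f' : ℂ} {s : ℝ} (hf : HasDerivAt f f' s)
    (h : ∀ᶠ t : ℝ in 𝓝 s, (f t).im = 0) : f'.im = 0 := by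
  have h1 : HasDerivAt (fun t : ℝ => f t) f' s := hf.comp_ofReal
  have h2 : HasDerivAt (fun t : ℝ => (f t).im) f'.im s :=
    (Complex.imCLM.hasFDerivAt.comp_hasDerivAt s h1)
  have h3 : HasDerivAt (fun t : ℝ => (f t).im) 0 s :=
    (hasDerivAt_const s (0 : ℝ)).congr_of_eventuallyEq h
  exact h2.unique h3

/-- If `ψ⁻¹ ∘ g` is real on a segment, it is locally a quotient of holomorphic functions which
are real on the segment. -/
theorem exists_real_pair {g : ℂ → OnePoint ℂ} {S : Set ℂ} {I : Set ℝ} (hI : IsOpen I)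
    (hIS : ∀ s ∈ I, (s : ℂ) ∈ S) (ψ : GL (Fin 2) ℂ)
    (hreal : ∀ s ∈ I, ∃ x y : ℝ, (x ≠ 0 ∨ y ≠ 0) ∧ g s = ψ • ratio x y)
    {s₀ : ℝ} (hs₀ : s₀ ∈ I) {a b : ℂ → ℂ}
    (ha : AnalyticAt ℂ a s₀) (hb : AnalyticAt ℂ b s₀) (hW : wronskian a b s₀ ≠ 0)
    (hab : g =ᶠ[𝓝[S] (s₀ : ℂ)] fun w => ratio (a w) (b w)) :
    ∃ p q : ℂ → ℂ, AnalyticAt ℂ p s₀ ∧ AnalyticAt ℂ q s₀ ∧ wronskian p q s₀ ≠ 0 ∧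
      (∀ᶠ s : ℝ in 𝓝 s₀, (p s).im = 0 ∧ (q s).im = 0) ∧
      g =ᶠ[𝓝[S] (s₀ : ℂ)] fun w => ratio (ψ 0 0 * p w + ψ 0 1 * q w) (ψ 1 0 * p w + ψ 1 1 * q w) := by
  have hdet : ψ 0 0 * ψ 1 1 - ψ 0 1 * ψ 1 0 ≠ 0 := by
    have := ψ.det_ne_zero
    rwa [Matrix.det_fin_two] at this
  set D := ψ 0 0 * ψ 1 1 - ψ 0 1 * ψ 1 0 with hD
  -- The pair `(p, q)` is the adjugate of `ψ` applied to `(a, b)`, hence homogeneous coordinates of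
  -- `ψ⁻¹ ∘ g`.
  set p : ℂ → ℂ := fun w => ψ 1 1 * a w - ψ 0 1 * b w with hp
  set q : ℂ → ℂ := fun w => -ψ 1 0 * a w + ψ 0 0 * b w with hq
  have hpa : AnalyticAt ℂ p s₀ := (analyticAt_const.mul ha).sub (analyticAt_const.mul hb)
  have hqa : AnalyticAt ℂ q s₀ := (analyticAt_const.mul ha).add (analyticAt_const.mul hb)
  have hda := ha.differentiableAt.hasDerivAt
  have hdb := hb.differentiableAt.hasDerivAt
  have hpd : deriv p s₀ = ψ 1 1 * deriv a s₀ - ψ 0 1 * deriv b s₀ :=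
    ((hda.const_mul _).sub (hdb.const_mul _)).deriv
  have hqd : deriv q s₀ = -ψ 1 0 * deriv a s₀ + ψ 0 0 * deriv b s₀ :=
    ((hda.const_mul _).add (hdb.const_mul _)).deriv
  have hWpq : wronskian p q s₀ = D * wronskian a b s₀ := by
    rw [wronskian, hpd, hqd, wronskian]
    simp only [hp, hq, hD]
    ring
  have hW0 : wronskian p q s₀ ≠ 0 := hWpq ▸ mul_ne_zero hdet hW
  have hne : ∀ᶠ w in 𝓝 (s₀ : ℂ), a w ≠ 0 ∨ b w ≠ 0 := by
    rcases ne_zero_of_wronskian hW with h | h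
    · exact (ha.continuousAt.eventually_ne h).mono fun _ => Or.inl
    · exact (hb.continuousAt.eventually_ne h).mono fun _ => Or.inr
  have hform : ∀ w, g w = ratio (a w) (b w) →
      g w = ratio (ψ 0 0 * p w + ψ 0 1 * q w) (ψ 1 0 * p w + ψ 1 1 * q w) := by
    intro w hw
    rw [hw, ← ratio_mul_left hdet (a w) (b w)]
    congr 1 <;> simp only [hp, hq, hD] <;> ring
  have hcross : ∀ᶠ s : ℝ in 𝓝 s₀, ∃ x y : ℝ, (x ≠ 0 ∨ y ≠ 0) ∧ (y : ℂ) * p s = x * q s := by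
    have hcont : Tendsto (fun s : ℝ => (s : ℂ)) (𝓝 s₀) (𝓝 (s₀ : ℂ)) :=
      Complex.continuous_ofReal.tendsto s₀
    have hcontS : Tendsto (fun s : ℝ => (s : ℂ)) (𝓝 s₀) (nhdsWithin (s₀ : ℂ) S) :=
      tendsto_nhdsWithin_iff.mpr ⟨hcont, Filter.Eventually.mono (hI.mem_nhds hs₀) hIS⟩
    filter_upwards [hcontS.eventually hab, hcont.eventually hne, hI.mem_nhds hs₀] with s h1 h2 hs
    obtain ⟨x, y, hxy, hgs⟩ := hreal s hs
    refine ⟨x, y, hxy, ?_⟩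
    have hxyC : (x : ℂ) ≠ 0 ∨ (y : ℂ) ≠ 0 := by exact_mod_cast hxy
    rw [h1, smul_ratio ψ hxyC, ratio_eq_iff h2 (linear_ne_zero hdet hxyC)] at hgs
    simp only [hp, hq]
    linear_combination hgs
  have hcont : Tendsto (fun s : ℝ => (s : ℂ)) (𝓝 s₀) (𝓝 (s₀ : ℂ)) :=
    Complex.continuous_ofReal.tendsto s₀
  -- On the segment `[p : q]` is a real point, but `p` and `q` need not be real themselves. Dividing
  -- by whichever of the two is nonzero at `s₀` makes both entries real.
  by_cases hqz : q s₀ = 0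
  · have hpz : p s₀ ≠ 0 := by simpa [hqz] using ne_zero_of_wronskian hW0
    have hdiv := hasDerivAt_div_wronskian hqa hpa hpz
    refine ⟨fun _ => 1, fun w => q w / p w, analyticAt_const, hqa.fun_div hpa hpz, ?_, ?_, ?_⟩
    · have hsw : wronskian q p s₀ = - wronskian p q s₀ := by simp only [wronskian]; ring
      rw [wronskian, hdiv.deriv, hsw]
      simp [hW0, hpz]
    · filter_upwards [hcross, hcont.eventually (hpa.continuousAt.eventually_ne hpz)]
        with s ⟨x, y, hxy, h1⟩ h2
      have hx : x ≠ 0 := by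
        rintro rfl
        have hy : y ≠ 0 := by simpa using hxy
        simp [hy, h2] at h1
      have hxC : (x : ℂ) ≠ 0 := by exact_mod_cast hx
      have : q s / p s = ((y / x : ℝ) : ℂ) := by
        push_cast
        rw [div_eq_div_iff h2 hxC]
        linear_combination -h1
      exact ⟨by simp, by rw [this, Complex.ofReal_im]⟩
    · filter_upwards [hab, (hpa.continuousAt.eventually_ne hpz).filter_mono nhdsWithin_le_nhds]
        with w h1 h2
      rw [hform w h1]
      symm
      rw [← ratio_mul_left h2]
      congr 1 <;> field_simp
  · have hdiv := hasDerivAt_div_wronskian hpa hqa hqz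
    refine ⟨fun w => p w / q w, fun _ => 1, hpa.fun_div hqa hqz, analyticAt_const, ?_, ?_, ?_⟩
    · rw [wronskian, hdiv.deriv]
      simp [hW0, hqz]
    · filter_upwards [hcross, hcont.eventually (hqa.continuousAt.eventually_ne hqz)]
        with s ⟨x, y, hxy, h1⟩ h2
      have hy : y ≠ 0 := by
        rintro rfl
        have hx : x ≠ 0 := by simpa using hxy
        simp [hx, h2] at h1
      have hyC : (y : ℂ) ≠ 0 := by exact_mod_cast hy
      have : p s / q s = ((x / y : ℝ) : ℂ) := by
        push_cast
        rw [div_eq_div_iff h2 hyC]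
        linear_combination h1
      exact ⟨by rw [this, Complex.ofReal_im], by simp⟩
    · filter_upwards [hab, (hqa.continuousAt.eventually_ne hqz).filter_mono nhdsWithin_le_nhds]
        with w h1 h2
      rw [hform w h1]
      symm
      rw [← ratio_mul_left h2]
      congr 1 <;> field_simp

/-- In the direction `i` the differential takes the value `2 Re (i P) = -2 Im P`, so the Neumann
condition is a statement about `Im ∂v/∂z`. -/
theorem hasDerivWithinAt_normal {ε : ℝ} {v : ℂ → ℝ} {s : ℝ} {P : ℂ}
    (hs : (s : ℂ) ∈ puncturedHalfDisk ε)
    (hv : HasWirtWithinAt (fun w => (v w : ℂ)) P (conj P) (puncturedHalfDisk ε) s) :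
    HasDerivWithinAt (fun t : ℝ => v ⟨s, t⟩) (-2 * P.im) (Ici 0) 0 := by
  set T : Set ℝ := {t | (⟨s, t⟩ : ℂ) ∈ puncturedHalfDisk ε} with hT
  have hcurve : HasDerivAt (fun t : ℝ => (⟨s, t⟩ : ℂ)) Complex.I 0 := by
    have h1 : HasDerivAt (fun t : ℝ => (s : ℂ) + t * Complex.I) Complex.I 0 := by
      simpa using ((Complex.ofRealCLM.hasDerivAt (x := (0 : ℝ))).mul_const Complex.I).const_add
        (s : ℂ)
    refine h1.congr_of_eventuallyEq (Filter.Eventually.of_forall fun t => ?_)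
    exact Complex.mk_eq_add_mul_I s t
  have h0 : (⟨s, 0⟩ : ℂ) = (s : ℂ) := rfl
  have hre : HasFDerivWithinAt v (Complex.reCLM ∘L wirt P (conj P)) (puncturedHalfDisk ε)
      (⟨s, 0⟩ : ℂ) := Complex.reCLM.hasFDerivAt.comp_hasFDerivWithinAt _ hv
  have h1 : HasDerivWithinAt (fun t : ℝ => v ⟨s, t⟩) (-2 * P.im) T 0 := by
    have := hre.comp_hasDerivWithinAt (0 : ℝ) (hcurve.hasDerivWithinAt (s := T)) (fun t ht => ht)
    refine this.congr_deriv ?_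
    simp
    ring
  refine h1.mono_of_mem_nhdsWithin ?_
  have h2 : ∀ᶠ t : ℝ in 𝓝 0, (⟨s, t⟩ : ℂ) ∈ puncturedDisk ε := by
    refine hcurve.continuousAt.eventually ((isOpen_puncturedDisk ε).mem_nhds ?_)
    rw [puncturedHalfDisk_eq] at hs
    exact hs.2
  filter_upwards [h2.filter_mono nhdsWithin_le_nhds, self_mem_nhdsWithin] with t ht ht0
  rw [hT, mem_ofPred_eq, puncturedHalfDisk_eq]
  exact ⟨ht0, ht⟩

theorem wronskian_linear {p q : ℂ → ℂ} {z : ℂ} (hp : AnalyticAt ℂ p z) (hq : AnalyticAt ℂ q z)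
    (α β γ δ : ℂ) :
    wronskian (fun w => α * p w + β * q w) (fun w => γ * p w + δ * q w) z =
      (α * δ - β * γ) * wronskian p q z := by
  have hdp := hp.differentiableAt.hasDerivAt
  have hdq := hq.differentiableAt.hasDerivAt
  rw [wronskian, ((hdp.const_mul α).fun_add (hdq.const_mul β)).deriv,
    ((hdp.const_mul γ).fun_add (hdq.const_mul δ)).deriv, wronskian]
  ring

/-- The normal derivative on a segment where `p` and `q` are real. -/
theorem im_logFactorDeriv {K : ℝ} {p q : ℂ → ℂ} {s : ℝ} (hp : AnalyticAt ℂ p s)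
    (hq : AnalyticAt ℂ q s)
    (hreal : ∀ᶠ t : ℝ in 𝓝 s, (p t).im = 0 ∧ (q t).im = 0) {α β γ δ : ℂ}
    (hdet : α * δ - β * γ ≠ 0) :
    -2 * (logFactorDeriv K (fun w => α * p w + β * q w) (fun w => γ * p w + δ * q w) s).im =
      (2 * ((γ * conj δ).im + K * (α * conj β).im) * (wronskian p q s).re) *
        (2 / hermForm K (fun w => α * p w + β * q w) (fun w => γ * p w + δ * q w) s) ∧
      (wronskian p q s).im = 0 := by
  have hdp := hp.differentiableAt.hasDerivAt
  have hdq := hq.differentiableAt.hasDerivAt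
  have hcont : Tendsto (fun s : ℝ => (s : ℂ)) (𝓝 s) (𝓝 (s : ℂ)) :=
    Complex.continuous_ofReal.tendsto s
  have hp' : ∀ᶠ t : ℝ in 𝓝 s, (deriv p t).im = 0 := by
    filter_upwards [eventually_eventually_nhds.mpr hreal,
      hcont.eventually hp.eventually_analyticAt] with t h1 h2
    exact im_deriv_eq_zero h2.differentiableAt.hasDerivAt (h1.mono fun _ h => h.1)
  have hq' : ∀ᶠ t : ℝ in 𝓝 s, (deriv q t).im = 0 := by
    filter_upwards [eventually_eventually_nhds.mpr hreal,
      hcont.eventually hq.eventually_analyticAt] with t h1 h2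
    exact im_deriv_eq_zero h2.differentiableAt.hasDerivAt (h1.mono fun _ h => h.2)
  have hWim : ∀ᶠ t : ℝ in 𝓝 s, (wronskian p q t).im = 0 := by
    filter_upwards [hreal, hp', hq'] with t h1 h2 h3
    simp [wronskian, h1.1, h1.2, h2, h3]
  have hWa := analyticAt_wronskian hp hq
  have hW' := im_deriv_eq_zero hWa.differentiableAt.hasDerivAt hWim
  have hWs := hWim.self_of_nhds
  refine ⟨?_, hWs⟩
  have hlin : (wronskian (fun w => α * p w + β * q w) (fun w => γ * p w + δ * q w)) =ᶠ[𝓝 (s : ℂ)]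
      fun w => (α * δ - β * γ) * wronskian p q w := by
    filter_upwards [hp.eventually_analyticAt, hq.eventually_analyticAt] with w h1 h2
    exact wronskian_linear h1 h2 α β γ δ
  have hd : deriv (wronskian (fun w => α * p w + β * q w) (fun w => γ * p w + δ * q w)) s =
      (α * δ - β * γ) * deriv (wronskian p q) s := by
    rw [hlin.deriv_eq]
    exact (hWa.differentiableAt.hasDerivAt.const_mul _).deriv
  -- The constant determinant cancels from the logarithmic derivative of the Wronskian, leaving a
  -- quotient of real numbers.
  have hfrac : (deriv (wronskian (fun w => α * p w + β * q w) (fun w => γ * p w + δ * q w)) s /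
      wronskian (fun w => α * p w + β * q w) (fun w => γ * p w + δ * q w) s).im = 0 := by
    rw [hd, wronskian_linear hp hq, mul_div_mul_left _ _ hdet]
    rw [Complex.div_im, hW', hWs]
    simp
  -- Only the mixed terms have an imaginary part; for real `p, q` they combine into `p' q - p q'`.
  have hA : (hermFormDeriv K (fun w => α * p w + β * q w) (fun w => γ * p w + δ * q w) s).im =
      ((γ * conj δ).im + K * (α * conj β).im) * (wronskian p q s).re := by
    have h1 := hreal.self_of_nhds
    have h2 := hp'.self_of_nhds
    have h3 := hq'.self_of_nhds
    rw [hermFormDeriv, ((hdp.const_mul α).fun_add (hdq.const_mul β)).deriv,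
      ((hdp.const_mul γ).fun_add (hdq.const_mul δ)).deriv, wronskian]
    simp [Complex.add_re, Complex.add_im, Complex.mul_re, Complex.mul_im, h1.1, h1.2, h2, h3]
    ring
  rw [logFactorDeriv, Complex.sub_im, hfrac]
  have : ∀ (x : ℂ) (r : ℝ), (2 * (x / r)).im = 2 * x.im / r := by
    intro x r
    rw [show (2 : ℂ) * (x / r) = ((2 : ℝ) : ℂ) * (x / r) by norm_num, Complex.im_ofReal_mul,
      Complex.div_ofReal_im]
    ring
  rw [this, hA]
  ring

/-- A normal derivative which is locally a constant multiple of a positive function is globally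
so on an interval. -/
theorem exists_global_constant {x y : ℝ} {V : ℝ → ℝ → ℝ} {e : ℝ → ℝ}
    (he : ∀ s ∈ Ioo x y, 0 < e s)
    (h : ∀ s₀ ∈ Ioo x y, ∃ c : ℝ, ∀ᶠ s in 𝓝 s₀, HasDerivWithinAt (V s) (c * e s) (Ici 0) 0) :
    ∃ c : ℝ, ∀ s ∈ Ioo x y, HasDerivWithinAt (V s) (c * e s) (Ici 0) 0 := by
  -- The quotient recovers the local constant at every point, so it is a locally constant function
  -- on an interval.
  set C : ℝ → ℝ := fun s => derivWithin (V s) (Ici 0) 0 / e s with hC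
  have huniq : UniqueDiffWithinAt ℝ (Ici (0 : ℝ)) 0 := uniqueDiffOn_Ici 0 0 self_mem_Ici
  have hloc : ∀ s₀ ∈ Ioo x y, ∃ c : ℝ, C =ᶠ[𝓝 s₀] fun _ => c := by
    intro s₀ hs₀
    obtain ⟨c, hc⟩ := h s₀ hs₀
    refine ⟨c, ?_⟩
    filter_upwards [hc, isOpen_Ioo.mem_nhds hs₀] with s h1 h2
    rw [hC]
    simp only
    rw [h1.derivWithin huniq, mul_div_assoc, div_self (he s h2).ne', mul_one]
  have hderiv : ∀ s ∈ Ioo x y, HasDerivAt C 0 s := by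
    intro s hs
    obtain ⟨c, hc⟩ := hloc s hs
    exact (hasDerivAt_const s c).congr_of_eventuallyEq hc
  have hconst : ∀ s ∈ Ioo x y, ∀ t ∈ Ioo x y, C s = C t := by
    intro s hs t ht
    exact (convex_Ioo x y).is_const_of_fderivWithin_eq_zero (𝕜 := ℝ)
      (fun u hu => (hderiv u hu).differentiableAt.differentiableWithinAt)
      (fun u hu => by
        rw [fderivWithin_of_isOpen isOpen_Ioo hu, (hderiv u hu).hasFDerivAt.fderiv]
        ext
        simp) hs ht
  have hval : ∀ s ∈ Ioo x y, HasDerivWithinAt (V s) (C s * e s) (Ici 0) 0 := by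
    intro s hs
    obtain ⟨c, hc⟩ := h s hs
    have h1 := hc.self_of_nhds
    have h2 : C s * e s = c * e s := by
      rw [hC]
      simp only
      rw [h1.derivWithin huniq, div_mul_cancel₀ _ (he s hs).ne']
    rw [h2]
    exact h1
  by_cases hxy : x < y
  · have hm : (x + y) / 2 ∈ Ioo x y := ⟨by linarith, by linarith⟩
    exact ⟨C ((x + y) / 2), fun s hs => hconst _ hs _ hm ▸ hval s hs⟩
  · exact ⟨0, fun s hs => absurd (hs.1.trans hs.2) hxy⟩

/-- The image of the segment lies in the circle `ψ (ℝ ∪ {∞})`, and `c` is, up to sign and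
normalisation, its geodesic curvature. In a local real pair with Wronskian `W` the normal derivative
is `4 κ W / H`, while `e^{v/2} = 2 |D| |W| / H`; their quotient depends only on `ψ`, `K` and the
sign of `W`. -/
theorem exists_neumann_constant {K ε : ℝ} (hK : K = -1 ∨ K = 0 ∨ K = 1) {F g : ℂ → OnePoint ℂ}
    {v : ℂ → ℝ} (hg : IsAdmissible K ε F g) (hv : IsRepresentedBy K ε v g) {x y : ℝ}
    (hI : ∀ s ∈ Ioo x y, (s : ℂ) ∈ puncturedHalfDisk ε) (ψ : GL (Fin 2) ℂ)
    (hreal : ∀ s ∈ Ioo x y, ∃ x y : ℝ, (x ≠ 0 ∨ y ≠ 0) ∧ g s = ψ • ratio x y) :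
    ∃ c : ℝ, ∀ s ∈ Ioo x y, HasDerivWithinAt (fun t : ℝ => v ⟨s, t⟩)
      (c * Real.exp (v ⟨s, 0⟩ / 2)) (Ici 0) 0 := by
  refine exists_global_constant (V := fun s t => v ⟨s, t⟩) (e := fun s => Real.exp (v ⟨s, 0⟩ / 2))
    (fun _ _ => Real.exp_pos _) ?_
  intro s₀ hs₀
  obtain ⟨a, b, ha, hb, hW, hab⟩ := exists_local_pair hg (hI s₀ hs₀)
  obtain ⟨p, q, hp, hq, hWpq, hpq, hgpq⟩ :=
    exists_real_pair isOpen_Ioo hI ψ hreal hs₀ ha hb hW hab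
  have hdet : ψ 0 0 * ψ 1 1 - ψ 0 1 * ψ 1 0 ≠ 0 := by
    have := ψ.det_ne_zero
    rwa [Matrix.det_fin_two] at this
  set D := ψ 0 0 * ψ 1 1 - ψ 0 1 * ψ 1 0 with hD
  set κ := (ψ 1 0 * conj (ψ 1 1)).im + K * (ψ 0 0 * conj (ψ 0 1)).im with hκ
  have hcont : Tendsto (fun s : ℝ => (s : ℂ)) (𝓝 s₀) (𝓝 (s₀ : ℂ)) :=
    Complex.continuous_ofReal.tendsto s₀
  have hcontS : Tendsto (fun s : ℝ => (s : ℂ)) (𝓝 s₀) (𝓝[puncturedHalfDisk ε] (s₀ : ℂ)) :=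
    tendsto_nhdsWithin_iff.mpr
      ⟨hcont, Filter.Eventually.mono (isOpen_Ioo.mem_nhds hs₀) hI⟩
  have hWim : (wronskian p q s₀).im = 0 :=
    (im_logFactorDeriv (K := K) hp hq hpq hdet).2
  have hWre : (wronskian p q s₀).re ≠ 0 := fun h => hWpq (Complex.ext h hWim)
  -- The pair `(p, q)` is only local, so the sign of its Wronskian is controlled only near `s₀`;
  -- `exists_global_constant` does the globalisation.
  have hsign : ∃ σ : ℝ, ∀ᶠ s : ℝ in 𝓝 s₀, (wronskian p q s).re = σ * |(wronskian p q s).re| := by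
    have hc : ContinuousAt (fun s : ℝ => (wronskian p q s).re) s₀ :=
      Complex.continuous_re.continuousAt.comp
        (f := fun s : ℝ => wronskian p q s)
        ((analyticAt_wronskian hp hq).continuousAt.comp_of_eq hcont rfl)
    rcases lt_or_gt_of_ne hWre with h | h
    · refine ⟨-1, (hc.eventually (gt_mem_nhds h)).mono fun s hs => ?_⟩
      rw [abs_of_neg hs]
      ring
    · refine ⟨1, (hc.eventually (lt_mem_nhds h)).mono fun s hs => ?_⟩
      rw [abs_of_pos hs]
      ring
  obtain ⟨σ, hσ⟩ := hsign
  refine ⟨2 * κ * σ / ‖D‖, ?_⟩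
  filter_upwards [hcont.eventually hp.eventually_analyticAt, hcont.eventually hq.eventually_analyticAt,
    hcont.eventually ((analyticAt_wronskian hp hq).continuousAt.eventually_ne hWpq),
    eventually_eventually_nhds.mpr hpq, hσ,
    hcontS.eventually (eventually_eventually_nhdsWithin.mpr hgpq), isOpen_Ioo.mem_nhds hs₀]
    with s h1 h2 h3 h4 h5 h6 hs
  have hsS := hI s hs
  have hN := hermForm_pos hK hg hsS (a := fun w => ψ 0 0 * p w + ψ 0 1 * q w)
      (b := fun w => ψ 1 0 * p w + ψ 1 1 * q w)
      (linear_ne_zero hdet (ne_zero_of_wronskian h3)) (h6.self_of_nhdsWithin hsS)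
  have hA : AnalyticAt ℂ (fun w => ψ 0 0 * p w + ψ 0 1 * q w) s :=
    (analyticAt_const.mul h1).add (analyticAt_const.mul h2)
  have hB : AnalyticAt ℂ (fun w => ψ 1 0 * p w + ψ 1 1 * q w) s :=
    (analyticAt_const.mul h1).add (analyticAt_const.mul h2)
  have hWAB := wronskian_linear h1 h2 (ψ 0 0) (ψ 0 1) (ψ 1 0) (ψ 1 1)
  have hWAB0 : wronskian (fun w => ψ 0 0 * p w + ψ 0 1 * q w)
      (fun w => ψ 1 0 * p w + ψ 1 1 * q w) s ≠ 0 := hWAB ▸ mul_ne_zero hdet h3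
  have hveq := eventuallyEq_logFactor hv hA hB hWAB0 h6
  have hvs := hveq.self_of_nhdsWithin hsS
  obtain ⟨him, hWs⟩ := im_logFactorDeriv (K := K) h1 h2 h4 hdet
  have hw : HasWirtWithinAt (fun w => (v w : ℂ))
      (logFactorDeriv K (fun w => ψ 0 0 * p w + ψ 0 1 * q w)
        (fun w => ψ 1 0 * p w + ψ 1 1 * q w) s)
      (conj (logFactorDeriv K (fun w => ψ 0 0 * p w + ψ 0 1 * q w)
        (fun w => ψ 1 0 * p w + ψ 1 1 * q w) s)) (puncturedHalfDisk ε) s :=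
    (hasWirt_logFactor hA hB hWAB0 hN).congr_of_eventuallyEq
      (hveq.mono fun w hw => congrArg Complex.ofReal hw) (congrArg Complex.ofReal hvs)
  refine (hasDerivWithinAt_normal hsS hw).congr_deriv ?_
  have hnorm : ‖wronskian p q s‖ = |(wronskian p q s).re| := by
    rw [show wronskian p q s = ((wronskian p q s).re : ℂ) from Complex.ext rfl (by simp [hWs]),
      Complex.norm_real]
    simp
  rw [him, show (⟨s, 0⟩ : ℂ) = (s : ℂ) from rfl, hvs, exp_half_logFactor hWAB0 hN, hWAB, norm_mul,
    hnorm, h5, ← hκ, ← hD]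
  have hD0 : ‖D‖ ≠ 0 := norm_ne_zero_iff.mpr hdet
  have habs : abs (σ * |(wronskian p q s).re|) = |(wronskian p q s).re| := by rw [← h5]
  rw [habs]
  field_simp

theorem exists_ratio_of_real {P : OnePoint ℂ}
    (h : P = OnePoint.infty ∨ ∃ x : ℝ, P = ((x : ℂ) : OnePoint ℂ)) :
    ∃ x y : ℝ, (x ≠ 0 ∨ y ≠ 0) ∧ P = ratio x y := by
  rcases h with h | ⟨x, h⟩
  · exact ⟨1, 0, by simp, by simp [h]⟩
  · exact ⟨x, 1, by simp, by simp [h]⟩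

/-- On each boundary segment the three normal forms are Möbius images of a real function. -/
theorem exists_real_coordinates {ε : ℝ} {F g : ℂ → OnePoint ℂ} (h : HasCanonicalForm ε F g)
    {I : Set ℝ} {θ : ℝ} (hI : ∀ s ∈ I, s ≠ 0 ∧ |s| < ε)
    (hlog : ∀ s ∈ I, Complex.log s = (Real.log |s| : ℂ) + θ * Complex.I) :
    ∃ ψ : GL (Fin 2) ℂ, ∀ s ∈ I, ∃ x y : ℝ, (x ≠ 0 ∨ y ≠ 0) ∧ g s = ψ • ratio x y := by
  have hmem : ∀ s ∈ I, (s : ℂ) ∈ puncturedHalfDisk ε := fun s hs =>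
    ofReal_mem_puncturedHalfDisk (hI s hs).1 (hI s hs).2
  have hmem' : ∀ s ∈ I, (s : ℂ) ∈ puncturedDisk ε := fun s hs => by
    have := hmem s hs
    rw [puncturedHalfDisk_eq] at this
    exact this.2
  have hpow : ∀ s ∈ I, ∀ γ : ℂ, (s : ℂ) ^ γ =
      Complex.exp (θ * Complex.I * γ) * Complex.exp (Real.log |s| * γ) := by
    intro s hs γ
    rw [Complex.cpow_def_of_ne_zero (by exact_mod_cast (hI s hs).1), hlog s hs, ← Complex.exp_add]
    congr 1
    ring
  obtain ⟨ψ, ⟨γ, -, -, hF, hg⟩ | ⟨hF, hg⟩ | ⟨γ, -, hF, hg⟩⟩ := h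
  -- On the segment `s^γ = e^{iθγ} |s|^γ`: the constant phase goes into the Möbius map, the positive
  -- factor stays with the real function.
  · have hu : Complex.exp (θ * Complex.I * γ) * 1 - 0 * 0 ≠ 0 := by
      simp [Complex.exp_ne_zero]
    obtain ⟨χ, hχ⟩ := exists_smul_ratio_of_det_ne_zero hu
    refine ⟨ψ * χ, fun s hs => ?_⟩
    obtain ⟨x, y, hxy, hFs⟩ := exists_ratio_of_real (hF s (hmem' s hs))
    have hρ : Complex.exp (Real.log |s| * γ) = ((Real.exp (Real.log |s| * γ) : ℝ) : ℂ) := by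
      push_cast
      rfl
    have hxy' : Real.exp (Real.log |s| * γ) * x ≠ 0 ∨ y ≠ 0 := by
      simpa [Real.exp_ne_zero] using hxy
    refine ⟨Real.exp (Real.log |s| * γ) * x, y, hxy', ?_⟩
    rw [mul_smul, hχ _ _ (by exact_mod_cast hxy'), hg _ (hmem s hs), hFs, map_mul_ratio,
      hpow s hs, hρ]
    congr 2
    · push_cast
      ring
    · ring
  -- Here `log s = log |s| + iθ`, so the Möbius map absorbs a translation by `iθ`.
  · have hu : (1 : ℂ) * 1 - (θ * Complex.I) * 0 ≠ 0 := by simp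
    obtain ⟨χ, hχ⟩ := exists_smul_ratio_of_det_ne_zero hu
    refine ⟨ψ * χ, fun s hs => ?_⟩
    obtain ⟨x, y, hxy, hFs⟩ := exists_ratio_of_real (hF s (hmem' s hs))
    have hxy' : x + Real.log |s| * y ≠ 0 ∨ y ≠ 0 := by
      by_cases hy : y = 0
      · simpa [hy] using hxy
      · exact Or.inr hy
    refine ⟨x + Real.log |s| * y, y, hxy', ?_⟩
    rw [mul_smul, hχ _ _ (by exact_mod_cast hxy'), hg _ (hmem s hs), hFs, map_add_ratio,
      hlog s hs]
    congr 2
    · push_cast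
      ring
    · ring
  · set u : ℂ := Complex.exp (θ * Complex.I * (Complex.I * γ)) with hu
    have hu0 : u ≠ 0 := Complex.exp_ne_zero _
    -- A Cayley transform, `[x : y] ↦ u (x + iy) / (x - iy)`, carries the real line to the circle of
    -- radius `|u|`.
    have hdet : u * (-Complex.I) - (u * Complex.I) * 1 ≠ 0 := by
      have : u * (-Complex.I) - (u * Complex.I) * 1 = -2 * u * Complex.I := by ring
      rw [this]
      simp [hu0]
    obtain ⟨χ, hχ⟩ := exists_smul_ratio_of_det_ne_zero hdet
    refine ⟨ψ * χ, fun s hs => ?_⟩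
    obtain ⟨w, hw, hFs⟩ := hF s (hmem' s hs)
    set w' : ℂ := Complex.exp (Real.log |s| * (Complex.I * γ)) * w with hw'
    have hnorm : ‖w'‖ = 1 := by
      rw [hw', norm_mul, hw, Complex.norm_exp]
      simp
    -- A unimodular number is `c² = c / c̄` with `|c| = 1`; hence its real homogeneous coordinates
    -- are `Re c` and `Im c`.
    obtain ⟨c, hc⟩ := IsAlgClosed.exists_pow_nat_eq w' (n := 2) (by norm_num)
    have hcn : ‖c‖ = 1 := by
      have : ‖c‖ ^ 2 = 1 := by rw [← norm_pow, hc, hnorm]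
      exact (pow_eq_one_iff_of_nonneg (norm_nonneg _) two_ne_zero).mp this
    have hc0 : c ≠ 0 := by
      rintro rfl
      simp at hcn
    have hcc : c * conj c = 1 := by rw [Complex.mul_conj', hcn]; simp
    have hxy : c.re ≠ 0 ∨ c.im ≠ 0 := by
      by_contra! hcon
      exact hc0 (Complex.ext hcon.1 hcon.2)
    refine ⟨c.re, c.im, hxy, ?_⟩
    have hconj : conj c ≠ 0 := by simpa using hc0
    have e1 : u * (c.re : ℂ) + u * Complex.I * (c.im : ℂ) = conj c * (u * w') := by
      rw [← hc]
      conv_lhs => rw [show u * (c.re : ℂ) + u * Complex.I * (c.im : ℂ) =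
        u * ((c.re : ℂ) + (c.im : ℂ) * Complex.I) by ring, Complex.re_add_im]
      linear_combination (-u * c) * hcc
    have e2 : (1 : ℂ) * (c.re : ℂ) + -Complex.I * (c.im : ℂ) = conj c * 1 := by
        apply Complex.ext <;> simp
    rw [mul_smul, hχ _ _ (by exact_mod_cast hxy), hg _ (hmem s hs), hFs, OnePoint.map_some,
      hpow s hs, e1, e2, ratio_mul_left hconj, ratio_one, hw', hu, mul_assoc]

theorem isSolution_of_isAdmissible {K ε : ℝ} (hK : K = -1 ∨ K = 0 ∨ K = 1)
    {F g : ℂ → OnePoint ℂ} {v : ℂ → ℝ} (hg : IsAdmissible K ε F g)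
    (hv : IsRepresentedBy K ε v g) : ∃ c₁ c₂ : ℝ, IsSolution K c₁ c₂ ε v := by
  have hpos : ∀ s ∈ Ioo 0 ε, s ≠ 0 ∧ |s| < ε := fun s hs =>
    ⟨hs.1.ne', by rw [abs_of_pos hs.1]; exact hs.2⟩
  have hneg : ∀ s ∈ Ioo (-ε) 0, s ≠ 0 ∧ |s| < ε := fun s hs =>
    ⟨hs.2.ne, by rw [abs_of_neg hs.2]; linarith [hs.1]⟩
  obtain ⟨ψ₁, h₁⟩ := exists_real_coordinates hg.form hpos (θ := 0) (fun s hs => by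
    rw [abs_of_pos hs.1, Complex.ofReal_log hs.1.le]
    simp)
  obtain ⟨ψ₂, h₂⟩ := exists_real_coordinates hg.form hneg (θ := Real.pi) (fun s hs => by
    rw [Complex.log, Complex.norm_real, Complex.arg_ofReal_of_neg hs.2, Real.norm_eq_abs])
  obtain ⟨c₁, hc₁⟩ := exists_neumann_constant hK hg hv
    (fun s hs => ofReal_mem_puncturedHalfDisk (hpos s hs).1 (hpos s hs).2) ψ₁ h₁
  obtain ⟨c₂, hc₂⟩ := exists_neumann_constant hK hg hv
    (fun s hs => ofReal_mem_puncturedHalfDisk (hneg s hs).1 (hneg s hs).2) ψ₂ h₂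
  refine ⟨c₁, c₂, ?_, ?_, fun s h0 h1 => hc₁ s ⟨h0, h1⟩, fun s h0 h1 => hc₂ s ⟨h0, h1⟩⟩
  · intro z hz
    obtain ⟨a, b, ha, hb, hW, hab⟩ := exists_local_pair hg hz
    have hN := hermForm_pos hK hg hz (ne_zero_of_wronskian hW) (hab.self_of_nhdsWithin hz)
    have hveq := eventuallyEq_logFactor hv ha hb hW hab
    exact (contDiffAt_logFactor ha hb hW hN).contDiffWithinAt.congr_of_eventuallyEq hveq
      (hveq.self_of_nhdsWithin hz)
  · intro z hz'
    have hz := halfDisk_subset ε hz'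
    obtain ⟨a, b, ha, hb, hW, hab⟩ := exists_local_pair hg hz
    have hN := hermForm_pos hK hg hz (ne_zero_of_wronskian hW) (hab.self_of_nhdsWithin hz)
    have hveq : v =ᶠ[𝓝 z] logFactor K a b := by
      have h1 := eventuallyEq_logFactor hv ha hb hW hab
      rwa [nhdsWithin_eq_nhds.mpr (mem_of_superset ((isOpen_halfDisk ε).mem_nhds hz')
        (halfDisk_subset ε))] at h1
    rw [(InnerProductSpace.laplacian_congr_nhds hveq).self_of_nhds, hveq.self_of_nhds]
    exact liouville_logFactor ha hb hW hN

/-! ### Holomorphic linear differential equations. -/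

/-- A holomorphic function on an open convex set has a primitive vanishing at a given point. -/
theorem exists_primitive {E : Type*} [NormedAddCommGroup E] [NormedSpace ℂ E] [CompleteSpace E]
    {U : Set ℂ} (hU : IsOpen U) (hc : Convex ℝ U) (z₀ : ℂ) {u : ℂ → E}
    (hu : DifferentiableOn ℂ u U) :
    ∃ G : ℂ → E, DifferentiableOn ℂ G U ∧ G z₀ = 0 ∧ ∀ z ∈ U, HasDerivAt G (u z) z := by
  obtain ⟨G, hG⟩ := hc.exists_forall_hasDerivWithinAt hu
  have h : ∀ z ∈ U, HasDerivAt (fun z => G z - G z₀) (u z) z := fun z hz =>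
    ((hG z hz).hasDerivAt (hU.mem_nhds hz)).sub_const _
  exact ⟨fun z => G z - G z₀, fun z hz => (h z hz).differentiableAt.differentiableWithinAt,
    sub_self _, h⟩

/-- A linear holomorphic differential equation on an open convex set is solvable. -/
theorem exists_linear_ode {E : Type*} [NormedAddCommGroup E] [NormedSpace ℂ E] [CompleteSpace E]
    {U : Set ℂ} (hU : IsOpen U) (hc : Convex ℝ U) {A : ℂ → E →L[ℂ] E}
    (hA : DifferentiableOn ℂ A U) {z₀ : ℂ} (hz₀ : z₀ ∈ U) (y₀ : E) :
    ∃ Y : ℂ → E, Y z₀ = y₀ ∧ ∀ z ∈ U, HasDerivAt Y (A z (Y z)) z := by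
  have hprim : ∀ u : {u : ℂ → E // DifferentiableOn ℂ u U}, ∃ G : {u : ℂ → E // DifferentiableOn ℂ u U},
      G.1 z₀ = 0 ∧ ∀ z ∈ U, HasDerivAt G.1 (A z (u.1 z)) z := by
    intro u
    obtain ⟨G, h1, h2, h3⟩ := exists_primitive hU hc z₀ (hA.clm_apply u.2)
    exact ⟨⟨G, h1⟩, h2, h3⟩
  choose prim hprim0 hprimd using hprim
  -- The terms of the Picard series: `T (n+1)` is the primitive of `A (T n)` vanishing at `z₀`, and
  -- the solution is their sum.
  set T' : ℕ → {u : ℂ → E // DifferentiableOn ℂ u U} := fun n =>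
    Nat.rec ⟨fun _ => y₀, differentiableOn_const _⟩ (fun _ u => prim u) n with hT'
  set T : ℕ → ℂ → E := fun n => (T' n).1 with hT
  have hT0 : ∀ z, T 0 z = y₀ := fun z => rfl
  have hTs0 : ∀ n, T (n + 1) z₀ = 0 := fun n => hprim0 _
  have hTd : ∀ n, ∀ z ∈ U, HasDerivAt (T (n + 1)) (A z (T n z)) z := fun n => hprimd _
  -- uniform bounds on a compact set which is star-shaped about the base point
  have hbound : ∀ (M : ℝ) (C : Set ℂ), 0 ≤ M → C ⊆ U →
      (∀ w ∈ C, ∀ s ∈ Icc (0 : ℝ) 1, z₀ + s * (w - z₀) ∈ C) →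
      (∀ w ∈ C, ‖A w‖ ≤ M) → ∀ n, ∀ w ∈ C, ‖T n w‖ ≤ ‖y₀‖ * (M * ‖w - z₀‖) ^ n / n.factorial := by
    intro M C hM hCU hstar hAM n
    induction n with
    | zero =>
      intro w _
      simp [hT0]
    | succ n ih =>
      intro w hw
      set φ : ℝ → E := fun s => T (n + 1) (z₀ + s * (w - z₀)) with hφ
      have hline : ∀ s : ℝ, HasDerivAt (fun s : ℝ => z₀ + (s : ℂ) * (w - z₀)) (w - z₀) s := by
        intro s
        simpa using ((Complex.ofRealCLM.hasDerivAt (x := s)).mul_const (w - z₀)).const_add z₀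
      have hφd : ∀ s ∈ Icc (0 : ℝ) 1, HasDerivAt φ
          ((w - z₀) • A (z₀ + s * (w - z₀)) (T n (z₀ + s * (w - z₀)))) s := by
        intro s hs
        exact (hTd n _ (hCU (hstar w hw s hs))).scomp s (hline s)
      set R := ‖w - z₀‖ with hR
      have hB : ∀ s : ℝ, HasDerivAt (fun s : ℝ => ‖y₀‖ * (M * (s * R)) ^ (n + 1) / (n + 1).factorial)
          (‖y₀‖ * (M * R) * (M * (s * R)) ^ n / n.factorial) s := by
        intro s
        have h1 : HasDerivAt (fun s : ℝ => M * (s * R)) (M * R) s := by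
          simpa using ((hasDerivAt_id s).mul_const R).const_mul M
        have h2 := ((h1.pow (n + 1)).const_mul ‖y₀‖).div_const ((n + 1).factorial : ℝ)
        refine h2.congr_deriv ?_
        rw [Nat.factorial_succ]
        push_cast
        have : ((n : ℝ) + 1) ≠ 0 := by positivity
        have : (n.factorial : ℝ) ≠ 0 := by positivity
        field_simp
      have key := image_norm_le_of_norm_deriv_right_le_deriv_boundary (f := φ)
        (f' := fun s => (w - z₀) • A (z₀ + s * (w - z₀)) (T n (z₀ + s * (w - z₀)))) (a := 0) (b := 1)
        (fun s hs => (hφd s hs).continuousAt.continuousWithinAt)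
        (fun s hs => (hφd s ⟨hs.1, hs.2.le⟩).hasDerivWithinAt)
        (B := fun s : ℝ => ‖y₀‖ * (M * (s * R)) ^ (n + 1) / (n + 1).factorial)
        (B' := fun s : ℝ => ‖y₀‖ * (M * R) * (M * (s * R)) ^ n / n.factorial)
        (by simp [hφ, hTs0]) hB ?_ (right_mem_Icc.mpr zero_le_one)
      · simpa [hφ] using key
      · intro s hs
        have hmem := hstar w hw s ⟨hs.1, hs.2.le⟩
        have h1 := ih _ hmem
        have hn : ‖z₀ + s * (w - z₀) - z₀‖ = s * R := by
          rw [add_sub_cancel_left, norm_mul, Complex.norm_real, Real.norm_of_nonneg hs.1]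
        rw [hn] at h1
        rw [norm_smul]
        have h2 : ‖A (z₀ + s * (w - z₀)) (T n (z₀ + s * (w - z₀)))‖ ≤
            M * (‖y₀‖ * (M * (s * R)) ^ n / n.factorial) :=
          ((A _).le_opNorm _).trans (mul_le_mul (hAM _ hmem) h1 (norm_nonneg _) hM)
        calc ‖w - z₀‖ * ‖A (z₀ + s * (w - z₀)) (T n (z₀ + s * (w - z₀)))‖
            ≤ R * (M * (‖y₀‖ * (M * (s * R)) ^ n / n.factorial)) :=
              mul_le_mul_of_nonneg_left h2 (norm_nonneg _)
          _ = ‖y₀‖ * (M * R) * (M * (s * R)) ^ n / n.factorial := by ring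
  refine ⟨fun z => ∑' n, T n z, ?_, ?_⟩
  · refine (tsum_eq_single 0 fun n hn => ?_).trans (hT0 z₀)
    obtain ⟨k, rfl⟩ := Nat.exists_eq_succ_of_ne_zero hn
    exact hTs0 k
  · intro z₁ hz₁
    obtain ⟨δ, hδ, hball⟩ := Metric.isOpen_iff.mp hU z₁ hz₁
    -- The cone with apex `z₀` over a closed ball around `z₁` is compact, star-shaped about `z₀`,
    -- and inside `U` by convexity.
    set C : Set ℂ := (fun p : ℝ × ℂ => z₀ + p.1 * (p.2 - z₀)) ''
      (Icc (0 : ℝ) 1 ×ˢ Metric.closedBall z₁ (δ / 2)) with hC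
    have hCc : IsCompact C := (isCompact_Icc.prod (isCompact_closedBall _ _)).image (by fun_prop)
    have hCU : C ⊆ U := by
      rintro _ ⟨⟨s, w⟩, ⟨hs, hw⟩, rfl⟩
      have hwU : w ∈ U := hball (Metric.closedBall_subset_ball (by linarith) hw)
      have := hc hz₀ hwU (sub_nonneg.mpr hs.2) hs.1 (by ring)
      convert this using 1
      simp
      ring
    have hstar : ∀ w ∈ C, ∀ s ∈ Icc (0 : ℝ) 1, z₀ + s * (w - z₀) ∈ C := by
      rintro _ ⟨⟨t, w⟩, ⟨ht, hw⟩, rfl⟩ s hs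
      refine ⟨⟨s * t, w⟩, ⟨⟨mul_nonneg hs.1 ht.1, mul_le_one₀ hs.2 ht.1 ht.2⟩, hw⟩, ?_⟩
      simp
      ring
    have hAc : ContinuousOn A C := hA.continuousOn.mono hCU
    obtain ⟨M, hM⟩ := hCc.exists_bound_of_continuousOn hAc
    have hz₀C : z₀ ∈ C := ⟨⟨0, z₁⟩, ⟨⟨le_rfl, zero_le_one⟩, Metric.mem_closedBall_self (by linarith)⟩,
      by simp⟩
    have hM0 : 0 ≤ M := (norm_nonneg _).trans (hM z₀ hz₀C)
    have hb := hbound M C hM0 hCU hstar hM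
    obtain ⟨R, hR⟩ := hCc.isBounded.exists_norm_le
    have hballC : ∀ w ∈ Metric.ball z₁ (δ / 2), w ∈ C := fun w hw =>
      ⟨⟨1, w⟩, ⟨⟨zero_le_one, le_rfl⟩, Metric.ball_subset_closedBall hw⟩, by simp⟩
    have hR0 : 0 ≤ R := (norm_nonneg _).trans (hR z₀ hz₀C)
    have hb' : ∀ n, ∀ w ∈ C, ‖T n w‖ ≤ ‖y₀‖ * ((M * (2 * R)) ^ n / n.factorial) := by
      intro n w hw
      refine (hb n w hw).trans ?_
      rw [mul_div_assoc]
      have h1 : ‖w - z₀‖ ≤ 2 * R := by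
        have := norm_sub_le w z₀
        linarith [hR w hw, hR z₀ hz₀C]
      gcongr
    have hsum : Summable fun n : ℕ => ‖y₀‖ * ((M * (2 * R)) ^ n / n.factorial) :=
      (Real.summable_pow_div_factorial _).mul_left _
    have hTsum : ∀ w ∈ C, Summable fun n => T n w := fun w hw =>
      Summable.of_norm_bounded hsum fun n => hb' n w hw
    -- Termwise differentiation shifts the index: the derivative of the sum of the `T (n+1)` is the
    -- sum of the `A (T n)`, that is, `A` applied to the whole series.
    have htail : ∀ z ∈ Metric.ball z₁ (δ / 2),
        HasDerivAt (fun z => ∑' n, T (n + 1) z) (∑' n, A z (T n z)) z := by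
      intro z hz
      refine hasDerivAt_tsum_of_isPreconnected (t := Metric.ball z₁ (δ / 2))
        (u := fun n : ℕ => M * (‖y₀‖ * ((M * (2 * R)) ^ n / n.factorial)))
        (g := fun n => T (n + 1)) (g' := fun n z => A z (T n z)) (hsum.mul_left M)
        Metric.isOpen_ball (convex_ball _ _).isPreconnected ?_ ?_ hz
        ((summable_nat_add_iff 1).mpr (hTsum z (hballC z hz))) hz
      · intro n y hy
        exact hTd n y (hCU (hballC y hy))
      · intro n y hy
        exact ((A y).le_opNorm _).trans
          (mul_le_mul (hM y (hballC y hy)) (hb' n y (hballC y hy)) (norm_nonneg _) hM0)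
    have hz₁b : z₁ ∈ Metric.ball z₁ (δ / 2) := Metric.mem_ball_self (by linarith)
    have h1 := (htail z₁ hz₁b).const_add y₀
    rw [← (A z₁).map_tsum (hTsum z₁ (hballC z₁ hz₁b))] at h1
    refine h1.congr_of_eventuallyEq ?_
    filter_upwards [Metric.isOpen_ball.mem_nhds hz₁b] with w hw
    rw [(hTsum w (hballC w hw)).tsum_eq_zero_add, hT0]

/-! ### The Schwarzian of a solution. -/

theorem eq_wirt (L : ℂ →L[ℝ] ℂ) :
    L = wirt ((L 1 - Complex.I * L Complex.I) / 2) ((L 1 + Complex.I * L Complex.I) / 2) := by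
  refine ContinuousLinearMap.ext fun ζ => ?_
  have h : L ζ = ζ.re * L 1 + ζ.im * L Complex.I := by
    conv_lhs => rw [show ζ = ζ.re • (1 : ℂ) + ζ.im • Complex.I by simp]
    rw [map_add, map_smul, map_smul]
    simp
  have e1 : ζ = ζ.re + ζ.im * Complex.I := (Complex.re_add_im ζ).symm
  have e2 : conj ζ = ζ.re - ζ.im * Complex.I := by
    apply Complex.ext <;> simp
  rw [wirt_apply, h]
  linear_combination (-((L 1 - Complex.I * L Complex.I) / 2)) * e1 +
    (-((L 1 + Complex.I * L Complex.I) / 2)) * e2 + ζ.im * L Complex.I * Complex.I_sq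

/-- The holomorphic derivative `∂v/∂z`. -/
def dz (ε : ℝ) (v : ℂ → ℝ) (z : ℂ) : ℂ :=
  ((fderivWithin ℝ v (puncturedHalfDisk ε) z 1 : ℂ) -
    Complex.I * (fderivWithin ℝ v (puncturedHalfDisk ε) z Complex.I : ℂ)) / 2

/-- The second holomorphic derivative `∂²v/∂z²`. -/
def dzz (ε : ℝ) (v : ℂ → ℝ) (z : ℂ) : ℂ :=
  (fderivWithin ℝ (dz ε v) (puncturedHalfDisk ε) z 1 -
    Complex.I * fderivWithin ℝ (dz ε v) (puncturedHalfDisk ε) z Complex.I) / 2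

/-- The mixed second derivative `∂²v/∂z∂z̄`. -/
def dzbar (ε : ℝ) (v : ℂ → ℝ) (z : ℂ) : ℂ :=
  (fderivWithin ℝ (dz ε v) (puncturedHalfDisk ε) z 1 +
    Complex.I * fderivWithin ℝ (dz ε v) (puncturedHalfDisk ε) z Complex.I) / 2

/-- The Schwarzian `v_zz - v_z² / 2`. -/
def schwarzian (ε : ℝ) (v : ℂ → ℝ) (z : ℂ) : ℂ := dzz ε v z - dz ε v z ^ 2 / 2

section Regularity

variable {ε : ℝ} {v : ℂ → ℝ} {z : ℂ}

theorem hasWirt_self (hv : ContDiffOn ℝ 2 v (puncturedHalfDisk ε)) (hz : z ∈ puncturedHalfDisk ε) :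
    HasWirtWithinAt (fun w => (v w : ℂ)) (dz ε v z) (conj (dz ε v z)) (puncturedHalfDisk ε) z := by
  have h1 := (hv.differentiableOn two_ne_zero z hz).hasFDerivWithinAt
  have h2 : HasFDerivWithinAt (fun w => (v w : ℂ))
      (Complex.ofRealCLM ∘L fderivWithin ℝ v (puncturedHalfDisk ε) z) (puncturedHalfDisk ε) z :=
    Complex.ofRealCLM.hasFDerivAt.comp_hasFDerivWithinAt z h1
  refine h2.congr_fderiv ?_
  rw [eq_wirt (Complex.ofRealCLM ∘L fderivWithin ℝ v (puncturedHalfDisk ε) z)]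
  refine wirt_ext rfl ?_
  simp [dz, Complex.conj_ofNat]

theorem contDiffOn_dz (hv : ContDiffOn ℝ 2 v (puncturedHalfDisk ε)) :
    ContDiffOn ℝ 1 (dz ε v) (puncturedHalfDisk ε) := by
  have h1 : ContDiffOn ℝ 1 (fderivWithin ℝ v (puncturedHalfDisk ε)) (puncturedHalfDisk ε) :=
    hv.fderivWithin (uniqueDiffOn_puncturedHalfDisk ε) (by norm_num)
  have h2 : ∀ ζ : ℂ, ContDiffOn ℝ 1
      (fun z => (fderivWithin ℝ v (puncturedHalfDisk ε) z ζ : ℂ)) (puncturedHalfDisk ε) := fun ζ =>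
    Complex.ofRealCLM.contDiff.comp_contDiffOn (h1.clm_apply contDiffOn_const)
  exact ((h2 1).sub (contDiffOn_const.mul (h2 Complex.I))).div_const 2

theorem hasWirt_dz (hv : ContDiffOn ℝ 2 v (puncturedHalfDisk ε)) (hz : z ∈ puncturedHalfDisk ε) :
    HasWirtWithinAt (dz ε v) (dzz ε v z) (dzbar ε v z) (puncturedHalfDisk ε) z :=
  ((contDiffOn_dz hv).differentiableOn one_ne_zero z hz).hasFDerivWithinAt.congr_fderiv
    (eq_wirt _)

theorem continuousOn_fderivWithin_dz (hv : ContDiffOn ℝ 2 v (puncturedHalfDisk ε)) (ζ : ℂ) :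
    ContinuousOn (fun z => fderivWithin ℝ (dz ε v) (puncturedHalfDisk ε) z ζ)
      (puncturedHalfDisk ε) :=
  ((contDiffOn_dz hv).continuousOn_fderivWithin (uniqueDiffOn_puncturedHalfDisk ε) le_rfl).clm_apply
    continuousOn_const

theorem puncturedHalfDisk_subset_closure (ε : ℝ) :
    puncturedHalfDisk ε ⊆ closure (halfDisk ε) := by
  rintro z ⟨-, h2, h3⟩
  have hc : Continuous (fun t : ℝ => z + t * Complex.I) := by fun_prop
  have h : Tendsto (fun t : ℝ => z + t * Complex.I) (𝓝[>] 0) (𝓝 z) := by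
    have := hc.tendsto 0
    simp only [Complex.ofReal_zero, zero_mul, add_zero] at this
    exact this.mono_left nhdsWithin_le_nhds
  refine mem_closure_of_tendsto h ?_
  have h4 : ∀ᶠ t : ℝ in 𝓝[>] 0, ‖z + t * Complex.I‖ < ε :=
    h.eventually (continuous_norm.continuousAt.eventually (gt_mem_nhds h2))
  filter_upwards [h4, self_mem_nhdsWithin] with t ht ht0
  refine ⟨ht, ?_⟩
  have : 0 < t := ht0
  simp
  linarith

/-- Inside, symmetry of the second derivative gives `4 v_{z z̄} = Δv`, so this is the Liouville
equation. Both sides are continuous up to the segments because `v` is `C²` there, and the identity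
passes to the closure. -/
theorem dzbar_eq {K c₁ c₂ : ℝ} (hs : IsSolution K c₁ c₂ ε v) (hz : z ∈ puncturedHalfDisk ε) :
    dzbar ε v z = ((-(K / 2) * Real.exp (v z) : ℝ) : ℂ) := by
  have hv := hs.contDiffOn
  have hEq : EqOn (dzbar ε v) (fun z => ((-(K / 2) * Real.exp (v z) : ℝ) : ℂ)) (halfDisk ε) := by
    intro z hz
    have hzΩ := halfDisk_subset ε hz
    have hnhds : ∀ w ∈ halfDisk ε, puncturedHalfDisk ε ∈ 𝓝 w := fun w hw =>
      mem_of_superset ((isOpen_halfDisk ε).mem_nhds hw) (halfDisk_subset ε)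
    have hvz : ContDiffAt ℝ 2 v z := hv.contDiffAt (hnhds z hz)
    have hD : DifferentiableAt ℝ (fderiv ℝ v) z :=
      (hvz.fderiv_right (m := 1) (by norm_num)).differentiableAt one_ne_zero
    set L := fderiv ℝ (fderiv ℝ v) z with hL
    have hsymm : L 1 Complex.I = L Complex.I 1 :=
      (hvz.isSymmSndFDerivAt (by simp)) 1 Complex.I
    have hdz : dz ε v =ᶠ[𝓝 z] fun w => ((fderiv ℝ v w 1 : ℂ) -
        Complex.I * (fderiv ℝ v w Complex.I : ℂ)) / 2 := by
      filter_upwards [(isOpen_halfDisk ε).mem_nhds hz] with w hw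
      rw [dz, fderivWithin_of_mem_nhds (hnhds w hw)]
    have happ : ∀ ζ : ℂ, HasFDerivAt (fun w => (fderiv ℝ v w ζ : ℂ))
        (Complex.ofRealCLM ∘L (ContinuousLinearMap.apply ℝ ℝ ζ) ∘L L) z := fun ζ =>
      Complex.ofRealCLM.hasFDerivAt.comp z
        ((ContinuousLinearMap.apply ℝ ℝ ζ).hasFDerivAt.comp z hD.hasFDerivAt)
    have hder : HasFDerivAt (dz ε v) _ z :=
      ((((happ 1).sub ((happ Complex.I).const_mul Complex.I))).mul_const ((2 : ℂ)⁻¹)).congr_of_eventuallyEq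
        (hdz.trans (Filter.Eventually.of_forall fun w => by simp [div_eq_mul_inv]))
    have hlap := hs.liouville z hz
    rw [InnerProductSpace.laplacian_eq_iteratedFDeriv_complexPlane] at hlap
    simp only [iteratedFDeriv_two_apply] at hlap
    have hlap' : L 1 1 + L Complex.I Complex.I + 2 * K * Real.exp (v z) = 0 := by simpa using hlap
    rw [dzbar, fderivWithin_of_mem_nhds (hnhds z hz), hder.fderiv]
    have e1 : (L Complex.I Complex.I : ℝ) = - L 1 1 - 2 * K * Real.exp (v z) := by linarith
    have e2 : ((L Complex.I Complex.I : ℝ) : ℂ) = - (L 1 1 : ℂ) - 2 * K * (Real.exp (v z) : ℂ) := by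
      rw [e1]
      push_cast
      ring
    simp only [smul_apply, sub_apply,
      ContinuousLinearMap.comp_apply, ContinuousLinearMap.apply_apply, Complex.ofRealCLM_apply,
      smul_eq_mul, hsymm]
    rw [Complex.ofReal_mul, Complex.ofReal_neg, Complex.ofReal_div]
    have hI := Complex.I_sq
    push_cast at e2 ⊢
    linear_combination (-(1 : ℂ) / 4 * (L Complex.I Complex.I : ℂ)) * hI + e2 / 4
  refine hEq.of_subset_closure ?_ ?_ (halfDisk_subset ε) (puncturedHalfDisk_subset_closure ε) hz
  · exact ((continuousOn_fderivWithin_dz hv 1).add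
      (continuousOn_const.mul (continuousOn_fderivWithin_dz hv Complex.I))).div_const 2
  · exact Complex.continuous_ofReal.comp_continuousOn
      (continuousOn_const.mul (Real.continuous_exp.comp_continuousOn hv.continuousOn))

/-- On convex sets the Schwarzian has a primitive, although it is only known to be continuous. -/
theorem exists_primitive_schwarzian {K c₁ c₂ : ℝ} (hs : IsSolution K c₁ c₂ ε v) {C : Set ℂ}
    (hC : Convex ℝ C) (hCS : C ⊆ puncturedHalfDisk ε) :
    ∃ Φ : ℂ → ℂ, ∀ z ∈ C, HasDerivWithinAt Φ (schwarzian ε v z) C z := by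
  have hv := hs.contDiffOn
  -- Only first derivatives of `v_z` exist, so the Schwarzian is never differentiated. The form `a
  -- dz + b dz̄` with `a = -v_z² / 2` and `b = (K/2) e^v = -v_{z z̄}` is differentiable, and it is
  -- closed because `∂a/∂z̄ = -v_z v_{z z̄} = ∂b/∂z`.
  set a : ℂ → ℂ := fun w => -(1 / 2) * (dz ε v w * dz ε v w) with ha
  set b : ℂ → ℂ := fun w => (K / 2) * Complex.exp (v w) with hb
  have haw : ∀ z ∈ C, HasWirtWithinAt a (-(dz ε v z * dzz ε v z)) (-(dz ε v z * dzbar ε v z)) C z :=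
    fun z hz => HasWirtWithinAt.congr_wirt ((((hasWirt_dz hv (hCS hz)).mul
      (hasWirt_dz hv (hCS hz))).const_mul _).mono hCS) (by ring) (by ring)
  have hbw : ∀ z ∈ C, HasWirtWithinAt b (b z * dz ε v z) (b z * conj (dz ε v z)) C z :=
    fun z hz => HasWirtWithinAt.congr_wirt (((HasWirtWithinAt.comp_deriv (Complex.hasDerivAt_exp _)
      (hasWirt_self hv (hCS hz))).const_mul _).mono hCS) (by simp only [hb]; ring)
      (by simp only [hb]; ring)
  set ω : ℂ → ℂ →L[ℝ] ℂ := fun w => wirt (a w) (b w) with hω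
  have hωd : ∀ z ∈ C, HasFDerivWithinAt ω
      ((wirt (-(dz ε v z * dzz ε v z)) (-(dz ε v z * dzbar ε v z))).smulRight
          (ContinuousLinearMap.id ℝ ℂ) +
        (wirt (b z * dz ε v z) (b z * conj (dz ε v z))).smulRight
          (Complex.conjCLE : ℂ →L[ℝ] ℂ)) C z := fun z hz =>
    (HasFDerivWithinAt.smul_const (haw z hz) (ContinuousLinearMap.id ℝ ℂ)).add
      (HasFDerivWithinAt.smul_const (hbw z hz) (Complex.conjCLE : ℂ →L[ℝ] ℂ))
  obtain ⟨φ, hφ⟩ := hC.exists_forall_hasFDerivWithinAt_of_hasFDerivWithinAt_symmetric hωd (by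
    intro z hz ζ _ η _
    have hβ : dzbar ε v z = - b z := by
      rw [dzbar_eq hs (hCS hz)]
      simp only [hb]
      push_cast
      ring
    simp [hβ]
    ring)
  -- Adding `v_z` cancels the `dz̄` part and turns the `dz` part into `v_zz - v_z² / 2`.
  refine ⟨fun w => φ w + dz ε v w, fun z hz => ?_⟩
  have hφ' : HasWirtWithinAt φ (a z) (b z) C z := hφ z hz
  refine hasDerivWithinAt_of_hasWirtWithinAt
    ((hφ'.add ((hasWirt_dz hv (hCS hz)).mono hCS)).congr_wirt ?_ ?_)
  · simp only [ha, schwarzian]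
    ring
  · rw [dzbar_eq hs (hCS hz)]
    simp only [hb]
    push_cast
    ring

/-- By the Neumann condition the Schwarzian is real on a boundary segment. -/
theorem schwarzian_im_eq_zero_of_neumann (hv : ContDiffOn ℝ 2 v (puncturedHalfDisk ε)) {I : Set ℝ}
    (hI : IsOpen I) (hIS : ∀ s ∈ I, (s : ℂ) ∈ puncturedHalfDisk ε) {c : ℝ}
    (hN : ∀ s ∈ I, HasDerivWithinAt (fun t : ℝ => v ⟨s, t⟩) (c * Real.exp (v ⟨s, 0⟩ / 2)) (Ici 0) 0)
    (hβ : ∀ s ∈ I, (dzbar ε v s).im = 0) {s : ℝ} (hs : s ∈ I) : (schwarzian ε v s).im = 0 := by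
  have hline : ∀ s : ℝ, HasDerivWithinAt (fun t : ℝ => (t : ℂ)) 1 I s := fun s =>
    (Complex.ofRealCLM.hasDerivAt (x := s)).hasDerivWithinAt
  have h1 : ∀ s ∈ I, (dz ε v s).im = -(c / 2) * Real.exp (v s / 2) := by
    intro s hs
    have h2 := hasDerivWithinAt_normal (hIS s hs) (hasWirt_self hv (hIS s hs))
    have h3 := (uniqueDiffOn_Ici (0 : ℝ) 0 self_mem_Ici).eq_deriv _ h2 (hN s hs)
    have h4 : v ⟨s, 0⟩ = v (s : ℂ) := rfl
    rw [h4] at h3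
    linarith
  -- Differentiating `Im v_z = -(c/2) e^{v/2}` along the axis gives `Im v_zz = Im v_z · Re v_z`,
  -- which is `Im (v_z² / 2)`; `v_{z z̄}` is real and drops out.
  have h2 : HasDerivAt (fun t : ℝ => dz ε v t) (dzz ε v s + dzbar ε v s) s :=
    (((hasWirt_dz hv (hIS s hs)).comp_hasDerivWithinAt s (hline s)
      (fun t ht => hIS t ht)).hasDerivAt (hI.mem_nhds hs)).congr_deriv (by simp)
  have h3 : HasDerivAt (fun t : ℝ => (v t : ℂ)) (dz ε v s + conj (dz ε v s)) s :=
    (((hasWirt_self hv (hIS s hs)).comp_hasDerivWithinAt s (hline s)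
      (fun t ht => hIS t ht)).hasDerivAt (hI.mem_nhds hs)).congr_deriv (by simp)
  have h3' : HasDerivAt (fun t : ℝ => v t) (2 * (dz ε v s).re) s :=
    (Complex.reCLM.hasFDerivAt.comp_hasDerivAt s h3).congr_deriv (by simp; ring)
  have h4 : HasDerivAt (fun t : ℝ => (dz ε v t).im) (dzz ε v s + dzbar ε v s).im s :=
    Complex.imCLM.hasFDerivAt.comp_hasDerivAt s h2
  have h5 : HasDerivAt (fun t : ℝ => -(c / 2) * Real.exp (v t / 2))
      (-(c / 2) * (Real.exp (v s / 2) * (2 * (dz ε v s).re / 2))) s :=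
    ((h3'.div_const 2).exp).const_mul _
  have h6 := (h4.congr_of_eventuallyEq (f₁ := fun t : ℝ => -(c / 2) * Real.exp (v t / 2))
    (Filter.Eventually.mono (hI.mem_nhds hs) fun t ht => (h1 t ht).symm)).unique h5
  rw [Complex.add_im, hβ s hs] at h6
  have h7 : (dzz ε v s).im = (dz ε v s).im * (dz ε v s).re := by
    rw [h1 s hs]
    linarith
  rw [schwarzian, Complex.sub_im, h7]
  have h8 : (dz ε v s ^ 2 / 2).im = (dz ε v s).im * (dz ε v s).re := by
    rw [show dz ε v s ^ 2 / 2 = dz ε v s ^ 2 / ((2 : ℝ) : ℂ) by norm_num, Complex.div_ofReal_im, sq,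
      Complex.mul_im]
    ring
  rw [h8, sub_self]

theorem schwarzian_im_eq_zero {K c₁ c₂ : ℝ} (hs : IsSolution K c₁ c₂ ε v) {s : ℝ}
    (h : (s : ℂ) ∈ puncturedHalfDisk ε) : (schwarzian ε v s).im = 0 := by
  have hβ : ∀ s : ℝ, (s : ℂ) ∈ puncturedHalfDisk ε → (dzbar ε v s).im = 0 := fun s hs' => by
    rw [dzbar_eq hs hs', Complex.ofReal_im]
  obtain ⟨h1, h2, -⟩ := h
  rw [Complex.norm_real, Real.norm_eq_abs] at h1 h2
  have h1' : s ≠ 0 := abs_pos.mp h1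
  rcases lt_or_gt_of_ne h1' with hneg | hpos
  · have hI : ∀ s ∈ Ioo (-ε) 0, (s : ℂ) ∈ puncturedHalfDisk ε := fun s hs =>
      ofReal_mem_puncturedHalfDisk hs.2.ne (by rw [abs_of_neg hs.2]; linarith [hs.1])
    exact schwarzian_im_eq_zero_of_neumann hs.contDiffOn isOpen_Ioo hI
      (fun s h => hs.neumann_neg s h.1 h.2) (fun s h => hβ s (hI s h))
      ⟨by rw [abs_of_neg hneg] at h2; linarith, hneg⟩
  · have hI : ∀ s ∈ Ioo 0 ε, (s : ℂ) ∈ puncturedHalfDisk ε := fun s hs =>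
      ofReal_mem_puncturedHalfDisk hs.1.ne' (by rw [abs_of_pos hs.1]; exact hs.2)
    exact schwarzian_im_eq_zero_of_neumann hs.contDiffOn isOpen_Ioo hI
      (fun s h => hs.neumann_pos s h.1 h.2) (fun s h => hβ s (hI s h))
      ⟨hpos, by rwa [abs_of_pos hpos] at h2⟩

end Regularity

/-! ### Schwarz reflection. -/

/-- Extension of a function from the closed upper half plane by `f(z̄) = conj (f z)`. -/
def reflect (f : ℂ → ℂ) (z : ℂ) : ℂ := if 0 ≤ z.im then f z else conj (f (conj z))

theorem reflect_of_nonneg {f : ℂ → ℂ} {z : ℂ} (h : 0 ≤ z.im) : reflect f z = f z := if_pos h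

theorem reflect_of_neg {f : ℂ → ℂ} {z : ℂ} (h : z.im < 0) : reflect f z = conj (f (conj z)) :=
  if_neg (not_le.mpr h)

theorem reflect_of_nonpos {f : ℂ → ℂ} {z : ℂ} (h : z.im ≤ 0) (hf : z.im = 0 → (f z).im = 0) :
    reflect f z = conj (f (conj z)) := by
  rcases h.lt_or_eq with h | h
  · exact reflect_of_neg h
  · rw [reflect_of_nonneg h.ge, Complex.conj_eq_iff_im.mpr h, Complex.conj_eq_iff_im.mpr (hf h)]

theorem reflect_conj {f : ℂ → ℂ} {z : ℂ} (hf : z.im = 0 → (f z).im = 0) :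
    reflect f (conj z) = conj (reflect f z) := by
  rcases lt_trichotomy z.im 0 with h | h | h
  · rw [reflect_of_neg h, reflect_of_nonneg (by simpa using h.le), Complex.conj_conj]
  · rw [Complex.conj_eq_iff_im.mpr h, reflect_of_nonneg h.ge, Complex.conj_eq_iff_im.mpr (hf h)]
  · rw [reflect_of_nonneg h.le, reflect_of_neg (by simpa using h), Complex.conj_conj]

theorem HasDerivWithinAt.conj_conj' {f : ℂ → ℂ} {f' z : ℂ} {S : Set ℂ}
    (hf : HasDerivWithinAt f f' S (conj z)) :
    HasDerivWithinAt (fun w => conj (f (conj w))) (conj f') (conj ⁻¹' S) z := by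
  have h1 : HasFDerivWithinAt f (wirt f' 0) S (conj z) := hasWirtWithinAt_of_hasDerivWithinAt hf
  have h2 : HasFDerivWithinAt (fun w => f (conj w)) (wirt f' 0 ∘L (Complex.conjCLE : ℂ →L[ℝ] ℂ))
      (conj ⁻¹' S) z :=
    h1.comp z (Complex.conjCLE : ℂ →L[ℝ] ℂ).hasFDerivAt.hasFDerivWithinAt (fun w hw => hw)
  have h3 : HasWirtWithinAt (fun w => f (conj w)) 0 f' (conj ⁻¹' S) z :=
    h2.congr_fderiv (by ext; simp)
  exact hasDerivWithinAt_of_hasWirtWithinAt (h3.conj.congr_wirt rfl (by simp))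

/-- Schwarz reflection for a function which has primitives up to the boundary. -/
theorem differentiableAt_reflect {f : ℂ → ℂ} {s r : ℝ} (hr : 0 < r)
    (hprim : ∃ Φ : ℂ → ℂ, ∀ z ∈ Metric.ball (s : ℂ) r ∩ {z | 0 ≤ z.im},
      HasDerivWithinAt Φ (f z) (Metric.ball (s : ℂ) r ∩ {z | 0 ≤ z.im}) z)
    (hreal : ∀ t : ℝ, (t : ℂ) ∈ Metric.ball (s : ℂ) r → (f t).im = 0) :
    DifferentiableAt ℂ (reflect f) s := by
  obtain ⟨Φ₀, hΦ₀⟩ := hprim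
  set B := Metric.ball (s : ℂ) r with hB
  set C := B ∩ {z : ℂ | 0 ≤ z.im} with hC
  have hballR : ∀ t : ℝ, (t : ℂ) ∈ B ↔ t ∈ Metric.ball s r := fun t => by
    rw [hB, Metric.mem_ball, Metric.mem_ball, Complex.dist_of_im_eq (by simp), Complex.ofReal_re,
      Complex.ofReal_re]
  have hmemC : ∀ t : ℝ, t ∈ Metric.ball s r → (t : ℂ) ∈ C := fun t ht =>
    ⟨(hballR t).mpr ht, by simp⟩
  have hIm : ∀ t ∈ Metric.ball s r, (Φ₀ t).im = (Φ₀ s).im := by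
    have hd : ∀ t ∈ Metric.ball s r, HasDerivAt (fun t : ℝ => (Φ₀ t).im) 0 t := by
      intro t ht
      have h1 : HasDerivWithinAt (fun t : ℝ => Φ₀ t) (f t) (Metric.ball s r) t := by
        have := (hΦ₀ t (hmemC t ht)).scomp t
          (Complex.ofRealCLM.hasDerivAt (x := t)).hasDerivWithinAt (fun u hu => hmemC u hu)
        simpa [Function.comp_def] using this
      have h2 := Complex.imCLM.hasFDerivAt.comp_hasDerivAt t
        (h1.hasDerivAt (Metric.isOpen_ball.mem_nhds ht))
      refine h2.congr_deriv ?_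
      simpa using hreal t ((hballR t).mpr ht)
    intro t ht
    exact (convex_ball s r).is_const_of_fderivWithin_eq_zero (𝕜 := ℝ)
      (f := fun t : ℝ => (Φ₀ t).im)
      (fun u hu => (hd u hu).differentiableAt.differentiableWithinAt)
      (fun u hu => by
        rw [fderivWithin_of_isOpen Metric.isOpen_ball hu, (hd u hu).hasFDerivAt.fderiv]
        ext
        simp) ht (Metric.mem_ball_self hr)
  -- The derivative `f` is real on the diameter, so `Im Φ₀` is constant there; subtracting it makes
  -- the primitive real and fit to be reflected.
  set Φ : ℂ → ℂ := fun z => Φ₀ z - (Φ₀ s).im * Complex.I with hΦ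
  have hΦd : ∀ z ∈ C, HasDerivWithinAt Φ (f z) C z := fun z hz => (hΦ₀ z hz).sub_const _
  have hreal_of : ∀ z ∈ B, z.im = 0 → (Φ z).im = 0 ∧ (f z).im = 0 := by
    intro z hz h0
    have hz' : z = ((z.re : ℝ) : ℂ) := Complex.ext rfl (by simp [h0])
    rw [hz'] at hz ⊢
    refine ⟨?_, hreal _ hz⟩
    simp [hΦ, hIm _ ((hballR _).mp hz)]
  have hBconj : ∀ z ∈ B, conj z ∈ B := by
    intro z hz
    rw [hB, Metric.mem_ball] at hz ⊢
    rwa [← Complex.conj_ofReal, Complex.dist_conj_conj]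
  have hd : ∀ z ∈ B, HasDerivAt (reflect Φ) (reflect f z) z := by
    have hup : ∀ z ∈ B, 0 ≤ z.im → HasDerivWithinAt (reflect Φ) (reflect f z) C z := by
      intro z hz h
      rw [reflect_of_nonneg h]
      exact (hΦd z ⟨hz, h⟩).congr (fun w hw => reflect_of_nonneg hw.2) (reflect_of_nonneg h)
    have hlow : ∀ z ∈ B, z.im ≤ 0 →
        HasDerivWithinAt (reflect Φ) (reflect f z) (B ∩ {z | z.im ≤ 0}) z := by
      intro z hz h
      rw [reflect_of_nonpos h fun h0 => (hreal_of z hz h0).2]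
      have h1 := HasDerivWithinAt.conj_conj' (hΦd (conj z) ⟨hBconj z hz, by simpa using h⟩)
      have h2 := h1.mono (t := conj ⁻¹' C) (s := B ∩ {z | z.im ≤ 0})
        (fun w hw => ⟨hBconj w hw.1, by simpa using hw.2⟩)
      exact h2.congr (fun w hw => reflect_of_nonpos hw.2 fun h0 => (hreal_of w hw.1 h0).1)
        (reflect_of_nonpos h fun h0 => (hreal_of z hz h0).1)
    intro z hz
    have hBn : B ∈ 𝓝 z := Metric.isOpen_ball.mem_nhds hz
    rcases lt_trichotomy z.im 0 with h | h | h
    · refine (hlow z hz h.le).hasDerivAt (inter_mem hBn ?_)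
      exact Filter.Eventually.mono (Complex.continuous_im.continuousAt.eventually (gt_mem_nhds h))
        fun w hw => le_of_lt hw
    -- At a real point the one-sided complex derivatives from the two closed halves agree, and the
    -- halves together fill the ball.
    · have := (hup z hz h.ge).union (hlow z hz h.le)
      refine this.hasDerivAt (mem_of_superset hBn fun w hw => ?_)
      rcases le_total 0 w.im with h' | h'
      · exact Or.inl ⟨hw, h'⟩
      · exact Or.inr ⟨hw, h'⟩
    · refine (hup z hz h.le).hasDerivAt (inter_mem hBn ?_)
      exact Filter.Eventually.mono (Complex.continuous_im.continuousAt.eventually (lt_mem_nhds h))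
        fun w hw => le_of_lt hw
  have hdiff : DifferentiableOn ℂ (reflect Φ) B := fun z hz =>
    (hd z hz).differentiableAt.differentiableWithinAt
  have hsB : (s : ℂ) ∈ B := Metric.mem_ball_self hr
  -- The reflected primitive is holomorphic, hence so is its derivative, which is the reflection of
  -- `f`.
  have h2 := (hdiff.deriv Metric.isOpen_ball).differentiableAt (Metric.isOpen_ball.mem_nhds hsB)
  refine h2.congr_of_eventuallyEq ?_
  filter_upwards [Metric.isOpen_ball.mem_nhds hsB] with w hw
  exact (hd w hw).deriv.symm

theorem convex_halfDisk (ε : ℝ) : Convex ℝ (halfDisk ε) := by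
  have h1 : halfDisk ε = Metric.ball 0 ε ∩ {z : ℂ | 0 < z.im} := by
    ext z
    simp [halfDisk]
  rw [h1]
  exact (convex_ball 0 ε).inter (convex_halfSpace_gt Complex.imLm.isLinear 0)

theorem differentiableOn_reflect_schwarzian {ε : ℝ} {v : ℂ → ℝ} {K c₁ c₂ : ℝ}
    (hs : IsSolution K c₁ c₂ ε v) :
    DifferentiableOn ℂ (reflect (schwarzian ε v)) (puncturedDisk ε) := by
  have hup : DifferentiableOn ℂ (schwarzian ε v) (halfDisk ε) := by
    obtain ⟨Φ, hΦ⟩ := exists_primitive_schwarzian hs (convex_halfDisk ε) (halfDisk_subset ε)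
    have hd : ∀ z ∈ halfDisk ε, HasDerivAt Φ (schwarzian ε v z) z := fun z hz =>
      (hΦ z hz).hasDerivAt ((isOpen_halfDisk ε).mem_nhds hz)
    have h1 : DifferentiableOn ℂ Φ (halfDisk ε) := fun z hz =>
      (hd z hz).differentiableAt.differentiableWithinAt
    exact (h1.deriv (isOpen_halfDisk ε)).congr fun z hz => (hd z hz).deriv.symm
  have hupAt : ∀ z ∈ halfDisk ε, DifferentiableAt ℂ (schwarzian ε v) z := fun z hz =>
    hup.differentiableAt ((isOpen_halfDisk ε).mem_nhds hz)
  intro z hz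
  refine DifferentiableAt.differentiableWithinAt ?_
  rcases lt_trichotomy z.im 0 with h | h | h
  · have h1 : DifferentiableAt ℂ (schwarzian ε v) (conj z) :=
      hupAt _ ⟨by simpa using hz.2, by simpa using h⟩
    have h2 := h1.conj_conj
    rw [Complex.conj_conj] at h2
    refine h2.congr_of_eventuallyEq ?_
    filter_upwards [Complex.continuous_im.continuousAt.eventually (gt_mem_nhds h)] with w hw
    exact reflect_of_neg hw
  · have hz' : z = ((z.re : ℝ) : ℂ) := Complex.ext rfl (by simp [h])
    obtain ⟨r, hr, hball⟩ := Metric.isOpen_iff.mp (isOpen_puncturedDisk ε) z hz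
    rw [hz'] at hball ⊢
    have hsub : Metric.ball ((z.re : ℝ) : ℂ) r ∩ {z | 0 ≤ z.im} ⊆ puncturedHalfDisk ε := by
      rw [puncturedHalfDisk_eq, inter_comm]
      exact inter_subset_inter_right _ hball
    exact differentiableAt_reflect hr (exists_primitive_schwarzian hs
      ((convex_ball _ _).inter convex_closedHalfPlane) hsub)
      (fun t ht => schwarzian_im_eq_zero hs (hsub ⟨ht, by simp⟩))
  · refine (hupAt z ⟨hz.2, h⟩).congr_of_eventuallyEq ?_
    filter_upwards [Complex.continuous_im.continuousAt.eventually (lt_mem_nhds h)] with w hw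
    exact reflect_of_nonneg (le_of_lt hw)

theorem reflect_schwarzian_conj {ε : ℝ} {v : ℂ → ℝ} {K c₁ c₂ : ℝ}
    (hs : IsSolution K c₁ c₂ ε v) {z : ℂ} (hz : z ∈ puncturedDisk ε) :
    reflect (schwarzian ε v) (conj z) = conj (reflect (schwarzian ε v) z) := by
  refine reflect_conj fun h => ?_
  have hz' : z = ((z.re : ℝ) : ℂ) := Complex.ext rfl (by simp [h])
  rw [hz'] at hz ⊢
  exact schwarzian_im_eq_zero hs (by rw [puncturedHalfDisk_eq]; exact ⟨by simp, hz⟩)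

/-! ### The closed first-order system of `e^{-v/2}`. -/

/-- The triple `(d, r, m)` solves the total system `d_z = r`, `r_z = -f d / 2`, `r_z̄ = m`,
`m_z = -f r̄ / 2`, with `d` and `m` real. -/
structure IsTotalSolution (f d r m : ℂ → ℂ) (U : Set ℂ) : Prop where
  hasWirt_fst : ∀ z ∈ U, HasFDerivAt d (wirt (r z) (conj (r z))) z
  hasWirt_snd : ∀ z ∈ U, HasFDerivAt r (wirt (-(f z * d z) / 2) (m z)) z
  hasWirt_trd : ∀ z ∈ U, HasFDerivAt m
    (wirt (-(f z * conj (r z)) / 2) (conj (-(f z * conj (r z)) / 2))) z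

theorem IsTotalSolution.sub {f d r m d' r' m' : ℂ → ℂ} {U : Set ℂ}
    (h : IsTotalSolution f d r m U) (h' : IsTotalSolution f d' r' m' U) :
    IsTotalSolution f (fun z => d z - d' z) (fun z => r z - r' z) (fun z => m z - m' z) U := by
  refine ⟨fun z hz => ?_, fun z hz => ?_, fun z hz => ?_⟩
  · have := (hasFDerivWithinAt_univ.mpr (h.hasWirt_fst z hz)).sub
      (hasFDerivWithinAt_univ.mpr (h'.hasWirt_fst z hz))
    exact (hasFDerivWithinAt_univ.mp this).congr_fderiv (by ext; simp; ring)
  · have := (hasFDerivWithinAt_univ.mpr (h.hasWirt_snd z hz)).sub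
      (hasFDerivWithinAt_univ.mpr (h'.hasWirt_snd z hz))
    exact (hasFDerivWithinAt_univ.mp this).congr_fderiv (by ext; simp; ring)
  · have := (hasFDerivWithinAt_univ.mpr (h.hasWirt_trd z hz)).sub
      (hasFDerivWithinAt_univ.mpr (h'.hasWirt_trd z hz))
    exact (hasFDerivWithinAt_univ.mp this).congr_fderiv (by ext; simp; ring)

/-- A solution of the total system which vanishes at a point of a convex set vanishes. -/
theorem IsTotalSolution.eq_zero {f d r m : ℂ → ℂ} {U : Set ℂ} (h : IsTotalSolution f d r m U)
    (hU : Convex ℝ U) (hf : ContinuousOn f U) {z₀ : ℂ} (hz₀ : z₀ ∈ U) (hd0 : d z₀ = 0)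
    (hr0 : r z₀ = 0) (hm0 : m z₀ = 0) {z₁ : ℂ} (hz₁ : z₁ ∈ U) : d z₁ = 0 := by
  set ζ := z₁ - z₀ with hζ
  set γ : ℝ → ℂ := fun t => z₀ + t * ζ with hγ
  have hγU : ∀ t ∈ Icc (0 : ℝ) 1, γ t ∈ U := by
    intro t ht
    have := hU hz₀ hz₁ (sub_nonneg.mpr ht.2) ht.1 (by ring)
    convert this using 1
    simp [hγ, hζ]
    ring
  have hγd : ∀ t, HasDerivAt γ ζ t := fun t =>
    (((Complex.ofRealCLM.hasDerivAt (x := t)).mul_const ζ).const_add z₀).congr_deriv (by simp)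
  have hγc : Continuous γ := by fun_prop
  obtain ⟨M, hM⟩ := isCompact_Icc.exists_bound_of_continuousOn
    (hf.comp hγc.continuousOn (fun t ht => hγU t ht) : ContinuousOn (f ∘ γ) (Icc (0 : ℝ) 1))
  set X : ℝ → ℂ × ℂ × ℂ := fun t => (d (γ t), r (γ t), m (γ t)) with hX
  set X' : ℝ → ℂ × ℂ × ℂ := fun t =>
    (wirt (r (γ t)) (conj (r (γ t))) ζ, wirt (-(f (γ t) * d (γ t)) / 2) (m (γ t)) ζ,
      wirt (-(f (γ t) * conj (r (γ t))) / 2) (conj (-(f (γ t) * conj (r (γ t))) / 2)) ζ) with hX'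
  have hXd : ∀ t ∈ Icc (0 : ℝ) 1, HasDerivAt X (X' t) t := by
    intro t ht
    exact ((h.hasWirt_fst _ (hγU t ht)).comp_hasDerivAt t (hγd t)).prodMk
      (((h.hasWirt_snd _ (hγU t ht)).comp_hasDerivAt t (hγd t)).prodMk
        ((h.hasWirt_trd _ (hγU t ht)).comp_hasDerivAt t (hγd t)))
  have hwirt : ∀ A B : ℂ, ‖wirt A B ζ‖ ≤ (‖A‖ + ‖B‖) * ‖ζ‖ := by
    intro A B
    rw [wirt_apply]
    refine (norm_add_le _ _).trans ?_
    rw [norm_mul, norm_mul, RCLike.norm_conj]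
    linarith
  -- On the segment from `z₀` to `z₁` the system is a linear ordinary differential equation with
  -- bounded coefficients, so Grönwall's inequality applies.
  have hzero := eq_zero_of_abs_deriv_le_mul_abs_self_of_eq_zero_right (f := X) (f' := X')
    (K := (M + 2) * ‖ζ‖) (a := 0) (b := 1)
    (fun t ht => (hXd t ht).continuousAt.continuousWithinAt)
    (fun t ht => (hXd t ⟨ht.1, ht.2.le⟩).hasDerivWithinAt)
    (by simp [hX, hγ, hd0, hr0, hm0]) ?_ 1 (right_mem_Icc.mpr zero_le_one)
  · have : d (γ 1) = 0 := congrArg Prod.fst hzero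
    simpa [hγ, hζ] using this
  · intro t ht
    have hM' : ‖f (γ t)‖ ≤ M := hM t ⟨ht.1, ht.2.le⟩
    have hM0 : 0 ≤ M := (norm_nonneg _).trans hM'
    have h1 : ‖d (γ t)‖ ≤ ‖X t‖ := norm_fst_le (X t)
    have h2 : ‖r (γ t)‖ ≤ ‖X t‖ := (norm_fst_le (X t).2).trans (norm_snd_le (X t))
    have h3 : ‖m (γ t)‖ ≤ ‖X t‖ := (norm_snd_le (X t).2).trans (norm_snd_le (X t))
    have hle : ∀ A B : ℂ, ‖A‖ + ‖B‖ ≤ (M + 2) * ‖X t‖ →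
        ‖wirt A B ζ‖ ≤ (M + 2) * ‖ζ‖ * ‖X t‖ := by
      intro A B hAB
      refine (hwirt A B).trans ?_
      calc (‖A‖ + ‖B‖) * ‖ζ‖ ≤ (M + 2) * ‖X t‖ * ‖ζ‖ :=
            mul_le_mul_of_nonneg_right hAB (norm_nonneg _)
        _ = (M + 2) * ‖ζ‖ * ‖X t‖ := by ring
    have hfd : ‖-(f (γ t) * d (γ t)) / 2‖ ≤ M * ‖X t‖ / 2 := by
      rw [norm_div, norm_neg, norm_mul, RCLike.norm_ofNat]
      have := mul_le_mul hM' h1 (norm_nonneg _) hM0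
      linarith
    have hfr : ‖-(f (γ t) * conj (r (γ t))) / 2‖ ≤ M * ‖X t‖ / 2 := by
      rw [norm_div, norm_neg, norm_mul, RCLike.norm_conj, RCLike.norm_ofNat]
      have := mul_le_mul hM' h2 (norm_nonneg _) hM0
      linarith
    have hMX : 0 ≤ M * ‖X t‖ := mul_nonneg hM0 (norm_nonneg _)
    refine max_le (hle _ _ ?_) (max_le (hle _ _ ?_) (hle _ _ ?_))
    · rw [RCLike.norm_conj]
      nlinarith
    · nlinarith [norm_nonneg (X t)]
    · rw [RCLike.norm_conj]
      nlinarith [norm_nonneg (X t)]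

/-- The total system for `e^{-v/2}`. -/
theorem isTotalSolution_of_isSolution {ε : ℝ} {v : ℂ → ℝ} {K c₁ c₂ : ℝ}
    (hs : IsSolution K c₁ c₂ ε v) :
    IsTotalSolution (schwarzian ε v) (fun z => Complex.exp (-(v z) / 2))
      (fun z => -(dz ε v z * Complex.exp (-(v z) / 2)) / 2)
      (fun z => K / 4 * Complex.exp (v z / 2) +
        dz ε v z * conj (dz ε v z) * Complex.exp (-(v z) / 2) / 4) (halfDisk ε) := by
  have hv := hs.contDiffOn
  have key : ∀ z ∈ halfDisk ε,
      HasFDerivAt (fun w => (v w : ℂ)) (wirt (dz ε v z) (conj (dz ε v z))) z ∧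
      HasFDerivAt (dz ε v) (wirt (dzz ε v z) (dzbar ε v z)) z := fun z hz => by
    have hn : puncturedHalfDisk ε ∈ 𝓝 z :=
      mem_of_superset ((isOpen_halfDisk ε).mem_nhds hz) (halfDisk_subset ε)
    exact ⟨(hasWirt_self hv (halfDisk_subset ε hz)).hasFDerivAt hn,
      (hasWirt_dz hv (halfDisk_subset ε hz)).hasFDerivAt hn⟩
  have hexp : ∀ z ∈ halfDisk ε, HasWirtWithinAt (fun w => Complex.exp (-(v w) / 2))
      (-(dz ε v z * Complex.exp (-(v z) / 2)) / 2)
      (conj (-(dz ε v z * Complex.exp (-(v z) / 2)) / 2)) univ z := fun z hz => by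
    have h1 : HasWirtWithinAt (fun w => (v w : ℂ)) (dz ε v z) (conj (dz ε v z)) univ z :=
      hasFDerivWithinAt_univ.mpr (key z hz).1
    have h2 : HasDerivAt (fun x : ℂ => Complex.exp (-x / 2))
        (Complex.exp (-(v z : ℂ) / 2) * (-1 / 2)) (v z : ℂ) :=
      (((hasDerivAt_id (v z : ℂ)).neg).div_const 2).cexp
    refine HasWirtWithinAt.congr_wirt (HasWirtWithinAt.comp_deriv (f := fun w => (v w : ℂ))
      (φ := fun x => Complex.exp (-x / 2)) h2 h1) (by ring) ?_
    have : conj (Complex.exp (-(v z : ℂ) / 2)) = Complex.exp (-(v z : ℂ) / 2) := by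
      rw [← Complex.exp_conj]
      simp [Complex.conj_ofNat]
    simp only [map_div₀, map_neg, map_mul, this, Complex.conj_ofNat]
    ring
  have hexp' : ∀ z ∈ halfDisk ε, HasWirtWithinAt (fun w => Complex.exp (v w / 2))
      (dz ε v z * Complex.exp (v z / 2) / 2) (conj (dz ε v z) * Complex.exp (v z / 2) / 2)
      univ z := fun z hz => by
    have h1 : HasWirtWithinAt (fun w => (v w : ℂ)) (dz ε v z) (conj (dz ε v z)) univ z :=
      hasFDerivWithinAt_univ.mpr (key z hz).1
    have h2 : HasDerivAt (fun x : ℂ => Complex.exp (x / 2))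
        (Complex.exp ((v z : ℂ) / 2) * (1 / 2)) (v z : ℂ) :=
      ((hasDerivAt_id (v z : ℂ)).div_const 2).cexp
    exact HasWirtWithinAt.congr_wirt (HasWirtWithinAt.comp_deriv (f := fun w => (v w : ℂ))
      (φ := fun x => Complex.exp (x / 2)) h2 h1) (by ring) (by ring)
  have hβ : ∀ z ∈ halfDisk ε, dzbar ε v z =
      -(K / 2) * (Complex.exp (v z / 2) * Complex.exp (v z / 2)) := fun z hz => by
    rw [dzbar_eq hs (halfDisk_subset ε hz), ← Complex.exp_add, add_halves]
    push_cast
    ring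
  have hprod : ∀ z, Complex.exp ((v z : ℂ) / 2) * Complex.exp (-(v z : ℂ) / 2) = 1 := fun z => by
    rw [← Complex.exp_add, show (v z : ℂ) / 2 + -(v z : ℂ) / 2 = 0 by ring, Complex.exp_zero]
  refine ⟨fun z hz => hasFDerivWithinAt_univ.mp (hexp z hz), fun z hz => ?_, fun z hz => ?_⟩
  · have h1 : HasWirtWithinAt (dz ε v) (dzz ε v z) (dzbar ε v z) univ z :=
      hasFDerivWithinAt_univ.mpr (key z hz).2
    -- The second `z`-derivative of `e^{-v/2}` is `-(v_zz - v_z² / 2) / 2` times `e^{-v/2}`; this is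
    -- where the Schwarzian enters.
    have h2 := ((h1.mul (hexp z hz)).const_mul (-1 / 2)).congr_wirt
      (A' := -(schwarzian ε v z * Complex.exp (-(v z) / 2)) / 2)
      (B' := K / 4 * Complex.exp (v z / 2) +
        dz ε v z * conj (dz ε v z) * Complex.exp (-(v z) / 2) / 4) ?_ ?_
    · refine (hasFDerivWithinAt_univ.mp h2).congr_of_eventuallyEq
        (Filter.Eventually.of_forall fun w => by simp; ring)
    · rw [schwarzian]
      ring
    · have : conj (Complex.exp (-(v z : ℂ) / 2)) = Complex.exp (-(v z : ℂ) / 2) := by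
        rw [← Complex.exp_conj]
        simp [Complex.conj_ofNat]
      simp only [map_div₀, map_neg, map_mul, this, Complex.conj_ofNat, hβ z hz]
      linear_combination (K / 4 * Complex.exp (v z / 2)) * hprod z
  · have h1 : HasWirtWithinAt (dz ε v) (dzz ε v z) (dzbar ε v z) univ z :=
      hasFDerivWithinAt_univ.mpr (key z hz).2
    have hc : conj (Complex.exp (-(v z : ℂ) / 2)) = Complex.exp (-(v z : ℂ) / 2) := by
      rw [← Complex.exp_conj]
      simp [Complex.conj_ofNat]
    have hβc : conj (dzbar ε v z) = dzbar ε v z := by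
      rw [dzbar_eq hs (halfDisk_subset ε hz), Complex.conj_ofReal]
    have h2 := (((hexp' z hz).const_mul (K / 4 : ℂ)).add
      (((h1.mul h1.conj).mul (hexp z hz)).const_mul (1 / 4))).congr_wirt
      (A' := -(schwarzian ε v z * conj (-(dz ε v z * Complex.exp (-(v z) / 2)) / 2)) / 2)
      (B' := conj (-(schwarzian ε v z *
        conj (-(dz ε v z * Complex.exp (-(v z) / 2)) / 2)) / 2)) ?_ ?_
    · refine (hasFDerivWithinAt_univ.mp h2).congr_of_eventuallyEq
        (Filter.Eventually.of_forall fun w => by simp; ring)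
    · simp only [map_div₀, map_neg, map_mul, hc, hβc, Complex.conj_ofNat]
      rw [schwarzian, hβ z hz]
      linear_combination (-(K / 8) * dz ε v z * Complex.exp (v z / 2)) * hprod z
    · simp only [map_div₀, map_neg, map_mul, hc, Complex.conj_ofNat, Complex.conj_conj]
      rw [schwarzian, hβ z hz]
      simp only [map_sub, map_div₀, map_pow, Complex.conj_ofNat]
      linear_combination (-(K / 8) * conj (dz ε v z) * Complex.exp (v z / 2)) * hprod z

/-- The total system for a Hermitian form in solutions of `y'' + f y / 2 = 0`. -/
theorem isTotalSolution_hermitian {f y₁ s₁ y₂ s₂ : ℂ → ℂ} {U : Set ℂ} (K : ℝ)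
    (h₁ : ∀ z ∈ U, HasDerivAt y₁ (s₁ z) z) (h₁' : ∀ z ∈ U, HasDerivAt s₁ (-(f z / 2) * y₁ z) z)
    (h₂ : ∀ z ∈ U, HasDerivAt y₂ (s₂ z) z) (h₂' : ∀ z ∈ U, HasDerivAt s₂ (-(f z / 2) * y₂ z) z) :
    IsTotalSolution f (fun z => (y₁ z * conj (y₁ z) + K * (y₂ z * conj (y₂ z))) / 2)
      (fun z => (s₁ z * conj (y₁ z) + K * (s₂ z * conj (y₂ z))) / 2)
      (fun z => (s₁ z * conj (s₁ z) + K * (s₂ z * conj (s₂ z))) / 2) U := by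
  have hw : ∀ {g : ℂ → ℂ} {g' z : ℂ}, HasDerivAt g g' z → HasWirtWithinAt g g' 0 univ z :=
    fun hg => hasWirtWithinAt_of_hasDerivWithinAt hg.hasDerivWithinAt
  have hfin : ∀ {g₁ g₂ g₃ g₄ : ℂ → ℂ} {g₁' g₂' g₃' g₄' z A B : ℂ}, HasDerivAt g₁ g₁' z →
      HasDerivAt g₂ g₂' z → HasDerivAt g₃ g₃' z → HasDerivAt g₄ g₄' z →
      (g₁' * conj (g₂ z) + K * (g₃' * conj (g₄ z))) / 2 = A →
      (g₁ z * conj g₂' + K * (g₃ z * conj g₄')) / 2 = B →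
      HasFDerivAt (fun z => (g₁ z * conj (g₂ z) + K * (g₃ z * conj (g₄ z))) / 2) (wirt A B) z := by
    intro g₁ g₂ g₃ g₄ g₁' g₂' g₃' g₄' z A B e₁ e₂ e₃ e₄ hA hB
    have h2 := ((((hw e₁).mul (hw e₂).conj).add
      (((hw e₃).mul (hw e₄).conj).const_mul (K : ℂ))).const_mul (1 / 2)).congr_wirt
      (A' := A) (B' := B) (by rw [← hA]; simp; ring) (by rw [← hB]; simp; ring)
    exact (hasFDerivWithinAt_univ.mp h2).congr_of_eventuallyEq
        (Filter.Eventually.of_forall fun w => by simp; ring)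
  refine ⟨fun z hz => ?_, fun z hz => ?_, fun z hz => ?_⟩
  · refine hfin (h₁ z hz) (h₁ z hz) (h₂ z hz) (h₂ z hz) rfl ?_
    simp [Complex.conj_ofNat]
    ring
  · refine hfin (h₁' z hz) (h₁ z hz) (h₂' z hz) (h₂ z hz) (by ring) rfl
  · refine hfin (h₁' z hz) (h₁' z hz) (h₂' z hz) (h₂' z hz) ?_ ?_
    · simp [Complex.conj_ofNat]
      ring
    · simp [Complex.conj_ofNat]
      ring

/-! ### The linear equation on the logarithmic cover. -/

/-- The domain of the logarithm of the punctured disk. -/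
def logDomain (ε : ℝ) : Set ℂ := {w | w.re < Real.log ε}

theorem isOpen_logDomain (ε : ℝ) : IsOpen (logDomain ε) :=
  isOpen_lt Complex.continuous_re continuous_const

theorem convex_logDomain (ε : ℝ) : Convex ℝ (logDomain ε) :=
  convex_halfSpace_lt Complex.reLm.isLinear _

theorem exp_mem_puncturedDisk {ε : ℝ} (hε : 0 < ε) {w : ℂ} :
    Complex.exp w ∈ puncturedDisk ε ↔ w ∈ logDomain ε := by
  simp only [puncturedDisk, mem_ofPred_eq, Complex.norm_exp, Real.exp_pos, true_and, logDomain]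
  exact (Real.lt_log_iff_exp_lt hε).symm

/-- Solutions `(Y, P)` of `Y' = e^w P`, `P' = -(e^w f(e^w) / 2) Y`: in the coordinate `z = e^w`
this is `y'' + (f / 2) y = 0` with `P = dy/dz`. -/
def IsSol (f : ℂ → ℂ) (ε : ℝ) (X : ℂ → ℂ × ℂ) : Prop :=
  ∀ w ∈ logDomain ε,
    HasDerivAt X (Complex.exp w * (X w).2, -(Complex.exp w * f (Complex.exp w) / 2) * (X w).1) w

theorem exists_isSol {f : ℂ → ℂ} {ε : ℝ} (hε : 0 < ε) (hf : DifferentiableOn ℂ f (puncturedDisk ε))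
    {w₀ : ℂ} (hw₀ : w₀ ∈ logDomain ε) (x₀ : ℂ × ℂ) : ∃ X, X w₀ = x₀ ∧ IsSol f ε X := by
  set L₁ : ℂ × ℂ →L[ℂ] ℂ × ℂ :=
    (ContinuousLinearMap.inl ℂ ℂ ℂ) ∘L (ContinuousLinearMap.snd ℂ ℂ ℂ) with hL₁
  set L₂ : ℂ × ℂ →L[ℂ] ℂ × ℂ :=
    (ContinuousLinearMap.inr ℂ ℂ ℂ) ∘L (ContinuousLinearMap.fst ℂ ℂ ℂ) with hL₂
  set A : ℂ → ℂ × ℂ →L[ℂ] ℂ × ℂ := fun w =>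
    Complex.exp w • L₁ + (-(Complex.exp w * f (Complex.exp w) / 2)) • L₂ with hA
  have hAd : DifferentiableOn ℂ A (logDomain ε) := by
    have h1 : DifferentiableOn ℂ (fun w => f (Complex.exp w)) (logDomain ε) :=
      hf.comp Complex.differentiable_exp.differentiableOn
        (fun w hw => (exp_mem_puncturedDisk hε).mpr hw)
    have h2 : DifferentiableOn ℂ Complex.exp (logDomain ε) :=
      Complex.differentiable_exp.differentiableOn
    exact (h2.smul_const L₁).add ((((h2.mul h1).div_const 2).neg).smul_const L₂)
  obtain ⟨X, h0, hX⟩ := exists_linear_ode (isOpen_logDomain ε) (convex_logDomain ε) hAd hw₀ x₀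
  refine ⟨X, h0, fun w hw => (hX w hw).congr_deriv ?_⟩
  simp [hA, hL₁, hL₂]

theorem IsSol.linear {f : ℂ → ℂ} {ε : ℝ} {X Y : ℂ → ℂ × ℂ} (hX : IsSol f ε X) (hY : IsSol f ε Y)
    (a b : ℂ) : IsSol f ε (fun w => a • X w + b • Y w) := by
  intro w hw
  refine (((hX w hw).const_smul a).add ((hY w hw).const_smul b)).congr_deriv ?_
  ext <;> simp <;> ring

theorem add_mem_logDomain {ε : ℝ} {w : ℂ} (n : ℝ) :
    w + n * Complex.I ∈ logDomain ε ↔ w ∈ logDomain ε := by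
  simp [logDomain]

theorem IsSol.shift {f : ℂ → ℂ} {ε : ℝ} {X : ℂ → ℂ × ℂ} (hX : IsSol f ε X) :
    IsSol f ε (fun w => X (w + (2 * Real.pi : ℝ) * Complex.I)) := by
  intro w hw
  have h1 := (hX _ ((add_mem_logDomain (2 * Real.pi)).mpr hw)).comp_add_const w
    ((2 * Real.pi : ℝ) * Complex.I)
  have : Complex.exp (w + (2 * Real.pi : ℝ) * Complex.I) = Complex.exp w := by
    push_cast
    exact Complex.exp_periodic w
  rwa [this] at h1

theorem IsSol.conj {f : ℂ → ℂ} {ε : ℝ} (hε : 0 < ε)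
    (hf : ∀ z ∈ puncturedDisk ε, f (conj z) = conj (f z))
    {X : ℂ → ℂ × ℂ} (hX : IsSol f ε X) :
    IsSol f ε (fun w => (conj (X (conj w)).1, conj (X (conj w)).2)) := by
  intro w hw
  have hw' : conj w ∈ logDomain ε := by simpa [logDomain] using hw
  have h := hX _ hw'
  have h1 : HasDerivAt (fun u => (X u).1) _ (conj w) :=
    (ContinuousLinearMap.fst ℂ ℂ ℂ).hasFDerivAt.comp_hasDerivAt (conj w) h
  have h2 : HasDerivAt (fun u => (X u).2) _ (conj w) :=
    (ContinuousLinearMap.snd ℂ ℂ ℂ).hasFDerivAt.comp_hasDerivAt (conj w) h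
  have h1' := h1.conj_conj
  have h2' := h2.conj_conj
  rw [Complex.conj_conj] at h1' h2'
  refine (h1'.prodMk h2').congr_deriv ?_
  have hfw : f (conj (Complex.exp w)) = conj (f (Complex.exp w)) :=
    hf _ ((exp_mem_puncturedDisk hε).mpr hw)
  simp [Complex.exp_conj, hfw, Complex.conj_ofNat]

/-- The Wronskian of two pairs. -/
def det₂ (x y : ℂ × ℂ) : ℂ := x.1 * y.2 - y.1 * x.2

/-- The coefficient matrix has trace zero, and the domain is convex. -/
theorem IsSol.det_const {f : ℂ → ℂ} {ε : ℝ} {X Y : ℂ → ℂ × ℂ} (hX : IsSol f ε X)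
    (hY : IsSol f ε Y) {w w' : ℂ} (hw : w ∈ logDomain ε) (hw' : w' ∈ logDomain ε) :
    det₂ (X w) (Y w) = det₂ (X w') (Y w') := by
  have hfst : ∀ {Z : ℂ → ℂ × ℂ} {Z' u}, HasDerivAt Z Z' u → HasDerivAt (fun u => (Z u).1) Z'.1 u :=
    fun h => (ContinuousLinearMap.fst ℂ ℂ ℂ).hasFDerivAt.comp_hasDerivAt _ h
  have hsnd : ∀ {Z : ℂ → ℂ × ℂ} {Z' u}, HasDerivAt Z Z' u → HasDerivAt (fun u => (Z u).2) Z'.2 u :=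
    fun h => (ContinuousLinearMap.snd ℂ ℂ ℂ).hasFDerivAt.comp_hasDerivAt _ h
  have hd : ∀ u ∈ logDomain ε, HasDerivAt (fun u => det₂ (X u) (Y u)) 0 u := by
    intro u hu
    have h := ((hfst (hX u hu)).fun_mul (hsnd (hY u hu))).fun_sub
      ((hfst (hY u hu)).fun_mul (hsnd (hX u hu)))
    exact h.congr_deriv (by ring)
  exact (convex_logDomain ε).is_const_of_fderivWithin_eq_zero (𝕜 := ℂ)
    (f := fun u => det₂ (X u) (Y u))
    (fun u hu => (hd u hu).differentiableAt.differentiableWithinAt)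
    (fun u hu => by
      rw [fderivWithin_of_isOpen (isOpen_logDomain ε) hu, (hd u hu).hasFDerivAt.fderiv]
      ext
      simp) hw hw'

theorem det₂_cramer (x u v : ℂ × ℂ) : det₂ u v • x = det₂ x v • u + det₂ u x • v := by
  ext <;> simp [det₂] <;> ring

/-- Two solutions with Wronskian one span all solutions. -/
theorem IsSol.eq_linear {f : ℂ → ℂ} {ε : ℝ} {X U V : ℂ → ℂ × ℂ} (hX : IsSol f ε X)
    (hU : IsSol f ε U) (hV : IsSol f ε V) {w₀ : ℂ} (hw₀ : w₀ ∈ logDomain ε)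
    (h1 : det₂ (U w₀) (V w₀) = 1) {w : ℂ} (hw : w ∈ logDomain ε) :
    X w = det₂ (X w₀) (V w₀) • U w + det₂ (U w₀) (X w₀) • V w := by
  rw [hX.det_const hV hw₀ hw, hU.det_const hX hw₀ hw, ← det₂_cramer, hU.det_const hV hw hw₀, h1,
    one_smul]

/-! ### Normal forms of the monodromy. -/

/-- Real eigenvectors, acting on as row vectors, of `N = [[α, β], [κ, -α]]`. Since `N² = (α² + β κ)
I`, the eigenvalues are `±μ`; they are real and distinct, or `N = 0`. -/
theorem exists_eigenvectors_of_pos (α β κ : ℝ)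
    (h : 0 < α ^ 2 + β * κ ∨ (α = 0 ∧ β = 0 ∧ κ = 0)) :
    ∃ μ x₁ y₁ x₂ y₂ : ℝ, μ ^ 2 = α ^ 2 + β * κ ∧ x₁ * α + y₁ * κ = μ * x₁ ∧
      x₁ * β - y₁ * α = μ * y₁ ∧ x₂ * α + y₂ * κ = -μ * x₂ ∧ x₂ * β - y₂ * α = -μ * y₂ ∧
      x₁ * y₂ - y₁ * x₂ ≠ 0 := by
  rcases h with h | ⟨rfl, rfl, rfl⟩
  · have hμ := Real.sq_sqrt h.le
    have hμ0 : 0 < √(α ^ 2 + β * κ) := Real.sqrt_pos.mpr h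
    set μ := √(α ^ 2 + β * κ)
    by_cases hβ : β = 0
    · by_cases hκ : κ = 0
      · subst hβ hκ
        exact ⟨α, 1, 0, 0, 1, by ring, by ring, by ring, by ring, by ring, by norm_num⟩
      · refine ⟨μ, κ, μ - α, κ, -μ - α, hμ, by ring, ?_, by ring, ?_, ?_⟩
        · linear_combination -hμ
        · linear_combination -hμ
        · rw [show κ * (-μ - α) - (μ - α) * κ = -(2 * κ * μ) by ring]
          exact neg_ne_zero.mpr (mul_ne_zero (mul_ne_zero two_ne_zero hκ) hμ0.ne')
    · refine ⟨μ, α + μ, β, α - μ, β, hμ, ?_, by ring, ?_, by ring, ?_⟩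
      · linear_combination -hμ
      · linear_combination -hμ
      · rw [show (α + μ) * β - β * (α - μ) = 2 * β * μ by ring]
        exact mul_ne_zero (mul_ne_zero two_ne_zero hβ) hμ0.ne'
  · exact ⟨0, 1, 0, 0, 1, by ring, by ring, by ring, by ring, by ring, by norm_num⟩

/-- Here `N` is nilpotent and nonzero, and `(x, y)` is chosen independent of its image under `N`. -/
theorem exists_cyclic_of_eq_zero {α β κ : ℝ} (h : α ^ 2 + β * κ = 0)
    (h0 : ¬(α = 0 ∧ β = 0 ∧ κ = 0)) :
    ∃ x y : ℝ, x * (x * β - y * α) - y * (x * α + y * κ) ≠ 0 := by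
  by_cases hβ : β = 0
  · refine ⟨0, 1, ?_⟩
    subst hβ
    have hα : α = 0 := by simpa using h
    subst hα
    simpa using h0
  · exact ⟨1, 0, by simpa using hβ⟩

/-- Taking `μ` of sign opposite to `τ` gives `(τ - μ)² ≥ τ² + μ² = 1 + 2 μ² > 1`. This choice is
what later makes the exponent `γ` negative. -/
theorem exists_sqrt_of_neg {τ α β κ : ℝ} (h1 : τ ^ 2 + (α ^ 2 + β * κ) = 1)
    (h : α ^ 2 + β * κ < 0) : ∃ μ : ℝ, μ ≠ 0 ∧ μ ^ 2 = -(α ^ 2 + β * κ) ∧ 1 < (τ - μ) ^ 2 := by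
  have hs := Real.sq_sqrt (neg_nonneg.mpr h.le)
  have hs0 : 0 < √(-(α ^ 2 + β * κ)) := Real.sqrt_pos.mpr (neg_pos.mpr h)
  set s := √(-(α ^ 2 + β * κ))
  rcases le_total 0 τ with hτ | hτ
  · refine ⟨-s, neg_ne_zero.mpr hs0.ne', by rw [neg_sq, hs], ?_⟩
    nlinarith [mul_nonneg hτ hs0.le]
  · refine ⟨s, hs0.ne', hs, ?_⟩
    nlinarith [mul_nonneg (neg_nonneg.mpr hτ) hs0.le]

/-- Componentwise conjugation. -/
def conjPair (x : ℂ × ℂ) : ℂ × ℂ := (conj x.1, conj x.2)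

theorem det₂_conjPair (x y : ℂ × ℂ) : det₂ (conjPair x) (conjPair y) = conj (det₂ x y) := by
  simp [det₂, conjPair]

theorem conjPair_linear (a b : ℂ) (x y : ℂ × ℂ) :
    conjPair (a • x + b • y) = conj a • conjPair x + conj b • conjPair y := by
  simp [conjPair]

/-- The pair of functions `X` is real on the real axis. -/
def IsRealSol (ε : ℝ) (X : ℂ → ℂ × ℂ) : Prop := ∀ w ∈ logDomain ε, X (conj w) = conjPair (X w)

theorem IsRealSol.linear {ε : ℝ} {X Y : ℂ → ℂ × ℂ} (hX : IsRealSol ε X) (hY : IsRealSol ε Y)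
    (a b : ℝ) : IsRealSol ε (fun w => (a : ℂ) • X w + (b : ℂ) • Y w) := by
  intro w hw
  simp only [hX w hw, hY w hw, conjPair_linear, Complex.conj_ofReal]

/-- The deck transformation of the logarithm of the punctured disk. -/
def deck (w : ℂ) : ℂ := w + (2 * Real.pi : ℝ) * Complex.I

theorem deck_mem {ε : ℝ} {w : ℂ} : deck w ∈ logDomain ε ↔ w ∈ logDomain ε :=
  add_mem_logDomain _

theorem conj_mem_logDomain {ε : ℝ} {w : ℂ} : conj w ∈ logDomain ε ↔ w ∈ logDomain ε := by
  simp [logDomain]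

/-- Conjugation inverts the deck transformation. Hence a monodromy matrix `M` in a real basis
satisfies `M̄ = M⁻¹`. -/
theorem deck_conj_deck (w : ℂ) : deck (conj (deck w)) = conj w := by
  simp [deck, Complex.conj_ofNat]

theorem det₂_linear (a b c d : ℂ) (x y : ℂ × ℂ) :
    det₂ (a • x + b • y) (c • x + d • y) = (a * d - b * c) * det₂ x y := by
  simp [det₂]
  ring

/-- A real basis of solutions, in which the monodromy is `τ + i N` with `τ` real and `N` real of
trace zero. -/
theorem exists_real_basis {f : ℂ → ℂ} {ε : ℝ} (hε : 0 < ε)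
    (hf : DifferentiableOn ℂ f (puncturedDisk ε))
    (hc : ∀ z ∈ puncturedDisk ε, f (conj z) = conj (f z)) :
    ∃ U V : ℂ → ℂ × ℂ, IsSol f ε U ∧ IsSol f ε V ∧ IsRealSol ε U ∧ IsRealSol ε V ∧
      (∀ w ∈ logDomain ε, det₂ (U w) (V w) = 1) ∧
      ∃ τ α β κ : ℝ, τ ^ 2 + (α ^ 2 + β * κ) = 1 ∧
        (∀ w ∈ logDomain ε, U (deck w) =
          (τ + α * Complex.I : ℂ) • U w + (β * Complex.I : ℂ) • V w) ∧
        ∀ w ∈ logDomain ε, V (deck w) =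
          (κ * Complex.I : ℂ) • U w + (τ - α * Complex.I : ℂ) • V w := by
  set w₁ : ℂ := ((Real.log ε - 1 : ℝ) : ℂ) with hw₁
  have hw₁m : w₁ ∈ logDomain ε := by simp [hw₁, logDomain]
  have hw₁c : conj w₁ = w₁ := Complex.conj_ofReal _
  obtain ⟨U, hU0, hU⟩ := exists_isSol hε hf hw₁m (1, 0)
  obtain ⟨V, hV0, hV⟩ := exists_isSol hε hf hw₁m (0, 1)
  have hdet₁ : det₂ (U w₁) (V w₁) = 1 := by simp [hU0, hV0, det₂]
  have hdet : ∀ w ∈ logDomain ε, det₂ (U w) (V w) = 1 := fun w hw =>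
    (hU.det_const hV hw hw₁m).trans hdet₁
  -- The conjugated solution solves the same equation and has the same value at the real base point,
  -- so the two coincide.
  have hreal : ∀ X, IsSol f ε X → conjPair (X w₁) = X w₁ → IsRealSol ε X := by
    intro X hX h0 w hw
    have hX' : IsSol f ε (fun w => conjPair (X (conj w))) := hX.conj hε hc
    have h1 := hX'.eq_linear hU hV hw₁m hdet₁ (conj_mem_logDomain.mpr hw)
    simp only [hw₁c, h0, Complex.conj_conj] at h1
    rw [h1]
    exact hX.eq_linear hU hV hw₁m hdet₁ (conj_mem_logDomain.mpr hw)
  have hUr : IsRealSol ε U := hreal U hU (by simp [hU0, conjPair])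
  have hVr : IsRealSol ε V := hreal V hV (by simp [hV0, conjPair])
  have hUT : IsSol f ε (fun w => U (deck w)) := hU.shift
  have hVT : IsSol f ε (fun w => V (deck w)) := hV.shift
  have hd₁ : deck w₁ ∈ logDomain ε := deck_mem.mpr hw₁m
  have hcd₁ : conj (deck w₁) ∈ logDomain ε := conj_mem_logDomain.mpr hd₁
  -- Obtained by comparing the constant Wronskian of `X` and `Y ∘ deck` at `conj (deck w₁)` and at
  -- `w₁`. Applied to `U` and `V` it makes the off-diagonal monodromy entries imaginary and the
  -- diagonal ones conjugate.
  have key : ∀ X Y, IsSol f ε X → IsSol f ε Y → IsRealSol ε X → IsRealSol ε Y →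
      conj (det₂ (X (deck w₁)) (Y w₁)) = det₂ (X w₁) (Y (deck w₁)) := by
    intro X Y hX hY hXr hYr
    have hYT : IsSol f ε (fun w => Y (deck w)) := hY.shift
    have h1 := hX.det_const hYT hcd₁ hw₁m
    simp only [deck_conj_deck, hXr _ hd₁, hw₁c] at h1
    rw [← h1, ← det₂_conjPair, ← hYr _ hw₁m, hw₁c]
  have hkU := key U U hU hU hUr hUr
  have hkV := key V V hV hV hVr hVr
  have hkUV := key U V hU hV hUr hVr
  have hanti : ∀ x y : ℂ × ℂ, det₂ x y = -det₂ y x := fun x y => by simp [det₂]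
  have hTU := fun w (hw : w ∈ logDomain ε) => hUT.eq_linear hU hV hw₁m hdet₁ hw
  have hTV := fun w (hw : w ∈ logDomain ε) => hVT.eq_linear hU hV hw₁m hdet₁ hw
  set a := det₂ (U (deck w₁)) (V w₁)
  set b := det₂ (U w₁) (U (deck w₁))
  set c := det₂ (V (deck w₁)) (V w₁)
  set d := det₂ (U w₁) (V (deck w₁))
  rw [hanti (U (deck w₁))] at hkU
  rw [hanti (V w₁)] at hkV
  have hdet' : a * d - b * c = 1 := by
    have h1 := hdet _ hd₁
    rwa [hTU _ hw₁m, hTV _ hw₁m, det₂_linear, hdet₁, mul_one] at h1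
  have ha : a = a.re + a.im * Complex.I := (Complex.re_add_im a).symm
  have hd : d = a.re - a.im * Complex.I := by
    rw [← hkUV]
    apply Complex.ext <;> simp
  have hb : b = b.im * Complex.I := by
    have := congrArg Complex.re hkU
    simp at this
    apply Complex.ext <;> simp
    linarith
  have hcc : c = c.im * Complex.I := by
    have := congrArg Complex.re hkV
    simp at this
    apply Complex.ext <;> simp
    linarith
  refine ⟨U, V, hU, hV, hUr, hVr, hdet, a.re, a.im, b.im, c.im, ?_, ?_, ?_⟩
  · rw [ha, hd, hb, hcc] at hdet'
    have := congrArg Complex.re hdet'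
    simp at this
    linarith
  · intro w hw
    rw [hTU w hw, ← ha, ← hb]
  · intro w hw
    rw [hTV w hw, ← hd, ← hcc]

/-- The normal forms of the monodromy of `y'' + (f / 2) y = 0` with `f` real on the axis. -/
theorem exists_monodromy_basis {f : ℂ → ℂ} {ε : ℝ} (hε : 0 < ε)
    (hf : DifferentiableOn ℂ f (puncturedDisk ε))
    (hc : ∀ z ∈ puncturedDisk ε, f (conj z) = conj (f z)) :
    ∃ (e₁ e₂ : ℂ → ℂ × ℂ) (l : ℂ), IsSol f ε e₁ ∧ IsSol f ε e₂ ∧ l ≠ 0 ∧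
      (∀ w ∈ logDomain ε, det₂ (e₁ w) (e₂ w) ≠ 0) ∧
      (∀ w ∈ logDomain ε, e₂ (deck w) = l • e₂ w) ∧
      ((∃ γ : ℝ, 0 ≤ γ ∧ γ < 1 ∧ IsRealSol ε e₁ ∧ IsRealSol ε e₂ ∧
          ∀ w ∈ logDomain ε, e₁ (deck w) =
            (l * Complex.exp (γ * (2 * Real.pi * Complex.I))) • e₁ w) ∨
        (IsRealSol ε e₁ ∧ IsRealSol ε e₂ ∧
          ∀ w ∈ logDomain ε, e₁ (deck w) =
            l • (e₁ w + (2 * Real.pi * Complex.I : ℂ) • e₂ w)) ∨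
        (∃ γ : ℝ, γ < 0 ∧ (∀ w ∈ logDomain ε, e₂ (conj w) = conjPair (e₁ w)) ∧
          ‖l‖ = Real.exp (Real.pi * γ) ∧
          ∀ w ∈ logDomain ε, e₁ (deck w) =
            (l * Complex.exp (Complex.I * γ * (2 * Real.pi * Complex.I))) • e₁ w)) := by
  obtain ⟨U, V, hU, hV, hUr, hVr, hdet, τ, α, β, κ, h1, hTU, hTV⟩ := exists_real_basis hε hf hc
  -- The monodromy `τ + i N` acting on the row vector `(x, y)`.
  have hT : ∀ (x y : ℂ), ∀ w ∈ logDomain ε, x • U (deck w) + y • V (deck w) =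
      (τ * x + (x * α + y * κ) * Complex.I) • U w +
        (τ * y + (x * β - y * α) * Complex.I) • V w := by
    intro x y w hw
    rw [hTU w hw, hTV w hw]
    ext <;> simp <;> ring
  rcases lt_or_ge (α ^ 2 + β * κ) 0 with hneg | hnn
  · obtain ⟨μ, hμ0, hμ, hμ1⟩ := exists_sqrt_of_neg h1 hneg
    have hβ : β ≠ 0 := by
      rintro rfl
      nlinarith [sq_nonneg α]
    have hprod : (τ - μ) * (τ + μ) = 1 := by linear_combination h1 - hμ
    have hl : τ + μ ≠ 0 := right_ne_zero_of_mul_eq_one hprod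
    have hμC : (μ : ℂ) ^ 2 = -((α : ℂ) ^ 2 + β * κ) := by exact_mod_cast hμ
    have hprodC : ((τ : ℂ) - μ) * (τ + μ) = 1 := by exact_mod_cast hprod
    have hlog : 0 < Real.log ((τ - μ) ^ 2) := Real.log_pos hμ1
    have hexp : Real.exp (Real.log ((τ - μ) ^ 2)) = (τ - μ) ^ 2 := Real.exp_log (by linarith)
    -- `N` has eigenvalues `±iμ` with conjugate eigenvectors, so `τ + i N` has the real eigenvalues
    -- `τ ∓ μ`, of product `1`. Their ratio is `(τ - μ)² = e^{-2πγ}`, which determines `γ`.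
    refine ⟨fun w => (α + μ * Complex.I : ℂ) • U w + (β : ℂ) • V w,
      fun w => (α - μ * Complex.I : ℂ) • U w + (β : ℂ) • V w, (τ + μ : ℝ), hU.linear hV _ _,
      hU.linear hV _ _, by exact_mod_cast hl, ?_, ?_,
      .inr (.inr ⟨-(Real.log ((τ - μ) ^ 2) / (2 * Real.pi)), ?_, ?_, ?_, ?_⟩)⟩
    · intro w hw
      rw [det₂_linear, hdet w hw, mul_one,
        show ((α : ℂ) + μ * Complex.I) * β - β * (α - μ * Complex.I) = 2 * μ * β * Complex.I by
          ring]
      simp [hμ0, hβ]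
    · intro w hw
      refine (hT _ _ w hw).trans ?_
      ext <;> simp
      · linear_combination (U w).1 * Complex.I * hμC -
          μ * (α * (U w).1 + β * (V w).1) * Complex.I_sq
      · linear_combination (U w).2 * Complex.I * hμC -
          μ * (α * (U w).2 + β * (V w).2) * Complex.I_sq
    · exact neg_lt_zero.mpr (div_pos hlog (by positivity))
    · intro w hw
      simp only [hUr w hw, hVr w hw, conjPair_linear, map_add, map_mul, Complex.conj_ofReal,
        Complex.conj_I]
      congr 2
      ring
    · rw [Complex.norm_real, Real.norm_eq_abs]
      have h2 : Real.pi * -(Real.log ((τ - μ) ^ 2) / (2 * Real.pi)) = -Real.log |τ - μ| := by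
        rw [← sq_abs (τ - μ), Real.log_pow]
        push_cast
        field_simp
      have h3 : 0 < |τ - μ| := abs_pos.mpr (left_ne_zero_of_mul_eq_one hprod)
      rw [h2, Real.exp_neg, Real.exp_log h3]
      exact eq_inv_of_mul_eq_one_right (by rw [← abs_mul, hprod, abs_one])
    · intro w hw
      have h2 : Complex.I * (-(Real.log ((τ - μ) ^ 2) / (2 * Real.pi)) : ℝ) *
          (2 * Real.pi * Complex.I) = (Real.log ((τ - μ) ^ 2) : ℝ) := by
        have : (Real.pi : ℂ) ≠ 0 := by exact_mod_cast Real.pi_ne_zero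
        push_cast
        field_simp
        rw [Complex.I_sq]
        ring
      have h3 : ((τ + μ : ℝ) : ℂ) * Complex.exp (Complex.I *
          (-(Real.log ((τ - μ) ^ 2) / (2 * Real.pi)) : ℝ) * (2 * Real.pi * Complex.I)) = τ - μ := by
        rw [h2, ← Complex.ofReal_exp, hexp]
        push_cast
        linear_combination ((τ : ℂ) - μ) * hprodC
      rw [h3]
      refine (hT _ _ w hw).trans ?_
      ext <;> simp
      · linear_combination (U w).1 * Complex.I * hμC +
          μ * (α * (U w).1 + β * (V w).1) * Complex.I_sq
      · linear_combination (U w).2 * Complex.I * hμC +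
          μ * (α * (U w).2 + β * (V w).2) * Complex.I_sq
  by_cases h0 : α ^ 2 + β * κ = 0 ∧ ¬(α = 0 ∧ β = 0 ∧ κ = 0)
  · obtain ⟨x, y, hxy⟩ := exists_cyclic_of_eq_zero h0.1 h0.2
    have hτ : τ ^ 2 = 1 := by linear_combination h1 - h0.1
    have hτC : (τ : ℂ) ^ 2 = 1 := by exact_mod_cast hτ
    have hτ0 : τ ≠ 0 := by
      rintro rfl
      norm_num at hτ
    have h0C : (α : ℂ) ^ 2 + β * κ = 0 := by exact_mod_cast h0.1
    have hπ : (Real.pi : ℂ) ≠ 0 := by exact_mod_cast Real.pi_ne_zero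
    -- Now `τ = ±1`. The second vector is `τ/(2π)` times the image of the first under `N`, scaled so
    -- that the monodromy adds exactly `2πi e₂`, as for the logarithm.
    refine ⟨fun w => (x : ℂ) • U w + (y : ℂ) • V w,
      fun w => ((τ / (2 * Real.pi) * (x * α + y * κ) : ℝ) : ℂ) • U w +
        ((τ / (2 * Real.pi) * (x * β - y * α) : ℝ) : ℂ) • V w, τ, hU.linear hV _ _,
      hU.linear hV _ _, by exact_mod_cast hτ0, ?_, ?_,
      .inr (.inl ⟨hUr.linear hVr _ _, hUr.linear hVr _ _, ?_⟩)⟩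
    · intro w hw
      rw [det₂_linear, hdet w hw, mul_one]
      have : x * (τ / (2 * Real.pi) * (x * β - y * α)) -
          y * (τ / (2 * Real.pi) * (x * α + y * κ)) ≠ 0 := by
        rw [show x * (τ / (2 * Real.pi) * (x * β - y * α)) -
          y * (τ / (2 * Real.pi) * (x * α + y * κ)) =
          τ / (2 * Real.pi) * (x * (x * β - y * α) - y * (x * α + y * κ)) by ring]
        exact mul_ne_zero (div_ne_zero hτ0 (by positivity)) hxy
      exact_mod_cast this
    · intro w hw
      refine (hT _ _ w hw).trans ?_
      ext <;> simp
      · linear_combination (τ / (2 * Real.pi) * Complex.I * (x * (U w).1 + y * (V w).1)) * h0C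
      · linear_combination (τ / (2 * Real.pi) * Complex.I * (x * (U w).2 + y * (V w).2)) * h0C
    · intro w hw
      refine (hT _ _ w hw).trans ?_
      ext <;> simp <;> field_simp
      · linear_combination (-Complex.I * ((x * α + y * κ) * (U w).1 +
          (x * β - y * α) * (V w).1)) * hτC
      · linear_combination (-Complex.I * ((x * α + y * κ) * (U w).2 +
          (x * β - y * α) * (V w).2)) * hτC
  · have hpos : 0 < α ^ 2 + β * κ ∨ (α = 0 ∧ β = 0 ∧ κ = 0) := by
      by_cases h00 : α = 0 ∧ β = 0 ∧ κ = 0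
      · exact .inr h00
      · exact .inl (lt_of_le_of_ne hnn fun h => h0 ⟨h.symm, h00⟩)
    obtain ⟨μ, x₁, y₁, x₂, y₂, hμ, hx₁, hy₁, hx₂, hy₂, hne⟩ :=
      exists_eigenvectors_of_pos α β κ hpos
    have hτμ : τ ^ 2 + μ ^ 2 = 1 := by rw [hμ, h1]
    have hτμC : (τ : ℂ) ^ 2 + μ ^ 2 = 1 := by exact_mod_cast hτμ
    have hprod : ((τ : ℂ) - μ * Complex.I) * (τ + μ * Complex.I) = 1 := by
      linear_combination hτμC - μ ^ 2 * Complex.I_sq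
    have hx₁C : (x₁ : ℂ) * α + y₁ * κ = μ * x₁ := by exact_mod_cast hx₁
    have hy₁C : (x₁ : ℂ) * β - y₁ * α = μ * y₁ := by exact_mod_cast hy₁
    have hx₂C : (x₂ : ℂ) * α + y₂ * κ = -μ * x₂ := by exact_mod_cast hx₂
    have hy₂C : (x₂ : ℂ) * β - y₂ * α = -μ * y₂ := by exact_mod_cast hy₂
    -- The eigenvalues `τ ± iμ` are unimodular and inverse to each other, with ratio `(τ + iμ)²`.
    -- The angle `θ` matters only modulo `1`, so its fractional part serves as `γ`.
    obtain ⟨θ, hθ⟩ : ∃ θ : ℝ, Complex.exp (θ * (2 * Real.pi * Complex.I)) =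
        (τ + μ * Complex.I) ^ 2 := by
      have hn : ‖((τ : ℂ) + μ * Complex.I) ^ 2‖ = 1 := by
        rw [norm_pow, Complex.sq_norm, Complex.normSq_add_mul_I, hτμ]
      refine ⟨Complex.arg ((τ + μ * Complex.I) ^ 2) / (2 * Real.pi), ?_⟩
      have hπ : (Real.pi : ℂ) ≠ 0 := by exact_mod_cast Real.pi_ne_zero
      have h2 := Complex.norm_mul_exp_arg_mul_I ((τ + μ * Complex.I) ^ 2)
      rw [hn, Complex.ofReal_one, one_mul] at h2
      rw [← h2]
      congr 1
      rw [h2]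
      push_cast
      field_simp
    refine ⟨fun w => (x₁ : ℂ) • U w + (y₁ : ℂ) • V w, fun w => (x₂ : ℂ) • U w + (y₂ : ℂ) • V w,
      τ - μ * Complex.I, hU.linear hV _ _, hU.linear hV _ _, left_ne_zero_of_mul_eq_one hprod,
      ?_, ?_, .inl ⟨Int.fract θ, Int.fract_nonneg θ, Int.fract_lt_one θ, hUr.linear hVr _ _,
        hUr.linear hVr _ _, ?_⟩⟩
    · intro w hw
      rw [det₂_linear, hdet w hw, mul_one]
      exact_mod_cast hne
    · intro w hw
      refine (hT _ _ w hw).trans ?_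
      rw [hx₂C, hy₂C]
      ext <;> simp <;> ring
    · intro w hw
      have h2 : Complex.exp ((Int.fract θ : ℝ) * (2 * Real.pi * Complex.I)) =
          (τ + μ * Complex.I) ^ 2 := by
        rw [← hθ, Int.fract, Complex.ofReal_sub, Complex.ofReal_intCast, sub_mul, Complex.exp_sub,
          Complex.exp_int_mul_two_pi_mul_I, div_one]
      have h3 : ((τ : ℂ) - μ * Complex.I) * (τ + μ * Complex.I) ^ 2 = τ + μ * Complex.I := by
        linear_combination ((τ : ℂ) + μ * Complex.I) * hprod
      rw [h2, h3]
      refine (hT _ _ w hw).trans ?_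
      rw [hx₁C, hy₁C]
      ext <;> simp <;> ring

/-! ### From the logarithmic cover back to the punctured disk. -/

/-- Near the negative axis `log (-w) + πi` is a holomorphic branch. It continues the principal
logarithm from `Im w ≥ 0`, and below the axis it exceeds it by `2πi`. -/
theorem exists_log_branch {z : ℂ} (hz : z ≠ 0) :
    ∃ ℓ : ℂ → ℂ, (∀ᶠ w in 𝓝 z, HasDerivAt ℓ w⁻¹ w) ∧
      ∀ᶠ w in 𝓝 z, (ℓ w = Complex.log w ∨ ℓ w = deck (Complex.log w)) ∧
        (0 ≤ w.im → ℓ w = Complex.log w) := by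
  by_cases hs : z ∈ Complex.slitPlane
  · refine ⟨Complex.log, ?_, .of_forall fun w => ⟨.inl rfl, fun _ => rfl⟩⟩
    filter_upwards [Complex.isOpen_slitPlane.mem_nhds hs] with w hw
    exact Complex.hasDerivAt_log hw
  · have hre : z.re < 0 := by
      simp only [Complex.mem_slitPlane_iff, not_or, not_lt, not_not] at hs
      exact lt_of_le_of_ne hs.1 fun h => hz (Complex.ext h hs.2)
    have hnhds : ∀ᶠ w : ℂ in 𝓝 z, w.re < 0 :=
      (isOpen_lt Complex.continuous_re continuous_const).mem_nhds hre
    refine ⟨fun w => Complex.log (-w) + Real.pi * Complex.I, ?_, ?_⟩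
    · filter_upwards [hnhds] with w hw
      have hw' : -w ∈ Complex.slitPlane := .inl (by simpa using hw)
      exact (((hasDerivAt_neg w).clog hw').add_const _).congr_deriv (by simp)
    · filter_upwards [hnhds] with w hw
      have h1 : 0 ≤ w.im → Complex.log (-w) + Real.pi * Complex.I = Complex.log w := by
        intro him
        have ha : (-w).arg = w.arg - Real.pi := by
          rw [Complex.arg_neg_eq_arg_sub_pi_iff]
          rcases him.lt_or_eq with h | h
          · exact .inl h
          · exact .inr ⟨h.symm, hw⟩
        simp only [Complex.log, norm_neg, ha]
        push_cast
        ring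
      refine ⟨?_, h1⟩
      rcases le_or_gt 0 w.im with him | him
      · exact .inl (h1 him)
      · right
        simp only [Complex.log, norm_neg, Complex.arg_neg_eq_arg_add_pi_of_im_neg him, deck]
        push_cast
        ring

theorem ne_zero_of_mem_puncturedDisk {ε : ℝ} {z : ℂ} (hz : z ∈ puncturedDisk ε) : z ≠ 0 :=
  norm_pos_iff.mp hz.1

theorem puncturedHalfDisk_subset (ε : ℝ) : puncturedHalfDisk ε ⊆ puncturedDisk ε := by
  rw [puncturedHalfDisk_eq]
  exact inter_subset_right

theorem log_mem_logDomain {ε : ℝ} (hε : 0 < ε) {z : ℂ} (hz : z ∈ puncturedDisk ε) :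
    Complex.log z ∈ logDomain ε := by
  rwa [← exp_mem_puncturedDisk hε, Complex.exp_log (ne_zero_of_mem_puncturedDisk hz)]

theorem exp_deck (w : ℂ) : Complex.exp (deck w) = Complex.exp w := by
  simp only [deck]
  push_cast
  exact Complex.exp_periodic w

/-- A local branch of the logarithm near a point of the punctured disk. -/
structure IsLogBranch (ε : ℝ) (ℓ : ℂ → ℂ) (z : ℂ) : Prop where
  mem : ℓ z ∈ logDomain ε
  exp : Complex.exp (ℓ z) = z
  hasDerivAt : HasDerivAt ℓ z⁻¹ z
  eq_or : ℓ z = Complex.log z ∨ ℓ z = deck (Complex.log z)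
  eq_log : 0 ≤ z.im → ℓ z = Complex.log z

theorem exists_isLogBranch {ε : ℝ} (hε : 0 < ε) {z : ℂ} (hz : z ∈ puncturedDisk ε) :
    ∃ ℓ : ℂ → ℂ, ∀ᶠ w in 𝓝 z, IsLogBranch ε ℓ w := by
  obtain ⟨ℓ, h1, h2⟩ := exists_log_branch (ne_zero_of_mem_puncturedDisk hz)
  refine ⟨ℓ, ?_⟩
  filter_upwards [h1, h2, (isOpen_puncturedDisk ε).mem_nhds hz] with w hw1 hw2 hw
  have hm := log_mem_logDomain hε hw
  have he : Complex.exp (ℓ w) = w := by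
    rcases hw2.1 with h | h
    · rw [h, Complex.exp_log (ne_zero_of_mem_puncturedDisk hw)]
    · rw [h, exp_deck, Complex.exp_log (ne_zero_of_mem_puncturedDisk hw)]
  refine ⟨?_, he, hw1, hw2.1, hw2.2⟩
  rcases hw2.1 with h | h
  · rwa [h]
  · rw [h]
    exact deck_mem.mpr hm

theorem analyticAt_comp_log {ε : ℝ} {ℓ A : ℂ → ℂ} {z : ℂ} (hℓ : ∀ᶠ w in 𝓝 z, IsLogBranch ε ℓ w)
    (hA : DifferentiableOn ℂ A (logDomain ε)) : AnalyticAt ℂ (fun w => A (ℓ w)) z := by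
  rw [Complex.analyticAt_iff_eventually_differentiableAt]
  filter_upwards [hℓ] with w hw
  exact (hA.differentiableAt ((isOpen_logDomain ε).mem_nhds hw.mem)).comp w
    hw.hasDerivAt.differentiableAt

theorem IsSol.hasDerivAt_fst {f : ℂ → ℂ} {ε : ℝ} {X : ℂ → ℂ × ℂ} (hX : IsSol f ε X) {w : ℂ}
    (hw : w ∈ logDomain ε) : HasDerivAt (fun w => (X w).1) (Complex.exp w * (X w).2) w :=
  (ContinuousLinearMap.fst ℂ ℂ ℂ).hasFDerivAt.comp_hasDerivAt w (hX w hw)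

theorem IsSol.hasDerivAt_snd {f : ℂ → ℂ} {ε : ℝ} {X : ℂ → ℂ × ℂ} (hX : IsSol f ε X) {w : ℂ}
    (hw : w ∈ logDomain ε) :
    HasDerivAt (fun w => (X w).2) (-(Complex.exp w * f (Complex.exp w) / 2) * (X w).1) w :=
  (ContinuousLinearMap.snd ℂ ℂ ℂ).hasFDerivAt.comp_hasDerivAt w (hX w hw)

theorem IsSol.differentiableOn_fst {f : ℂ → ℂ} {ε : ℝ} {X : ℂ → ℂ × ℂ} (hX : IsSol f ε X) :
    DifferentiableOn ℂ (fun w => (X w).1) (logDomain ε) :=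
  fun _ hw => (hX.hasDerivAt_fst hw).differentiableAt.differentiableWithinAt

theorem IsSol.hasDerivAt_fst_log {f : ℂ → ℂ} {ε : ℝ} {X : ℂ → ℂ × ℂ} (hX : IsSol f ε X)
    {ℓ : ℂ → ℂ} {z : ℂ} (hℓ : IsLogBranch ε ℓ z) (hz : z ≠ 0) :
    HasDerivAt (fun w => (X (ℓ w)).1) (X (ℓ z)).2 z := by
  refine ((hX.hasDerivAt_fst hℓ.mem).comp z hℓ.hasDerivAt).congr_deriv ?_
  rw [hℓ.exp]
  field_simp

theorem IsSol.hasDerivAt_snd_log {f : ℂ → ℂ} {ε : ℝ} {X : ℂ → ℂ × ℂ} (hX : IsSol f ε X)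
    {ℓ : ℂ → ℂ} {z : ℂ} (hℓ : IsLogBranch ε ℓ z) (hz : z ≠ 0) :
    HasDerivAt (fun w => (X (ℓ w)).2) (-(f z / 2) * (X (ℓ z)).1) z := by
  refine ((hX.hasDerivAt_snd hℓ.mem).comp z hℓ.hasDerivAt).congr_deriv ?_
  rw [hℓ.exp]
  field_simp

theorem det₂_ne_zero {x y : ℂ × ℂ} (h : det₂ x y ≠ 0) : x.1 ≠ 0 ∨ y.1 ≠ 0 := by
  by_contra! hcon
  exact h (by simp [det₂, hcon.1, hcon.2])

/-- A quotient of two functions of `log z` with the same monodromy factor is meromorphic. -/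
theorem sphereMeromorphicAt_ratio_log {ε : ℝ} (hε : 0 < ε) {A B : ℂ → ℂ} {l : ℂ}
    (hA : DifferentiableOn ℂ A (logDomain ε)) (hB : DifferentiableOn ℂ B (logDomain ε))
    (hl : l ≠ 0) (hAl : ∀ w ∈ logDomain ε, A (deck w) = l * A w)
    (hBl : ∀ w ∈ logDomain ε, B (deck w) = l * B w) (h0 : ∀ w ∈ logDomain ε, A w ≠ 0 ∨ B w ≠ 0)
    (hB' : ∀ w ∈ logDomain ε, B w = 0 → deriv B w ≠ 0) {z : ℂ} (hz : z ∈ puncturedDisk ε) :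
    SphereMeromorphicAt (fun z => ratio (A (Complex.log z)) (B (Complex.log z))) z := by
  obtain ⟨ℓ, hℓ⟩ := exists_isLogBranch hε hz
  have hℓz := hℓ.self_of_nhds
  have hBa := analyticAt_comp_log hℓ hB
  refine (sphereMeromorphicAt_ratio (analyticAt_comp_log hℓ hA) hBa (h0 _ hℓz.mem) ?_).congr ?_
  -- A zero of `B` is simple, hence isolated, so the quotient is not constantly `∞`.
  · by_cases hBz : B (ℓ z) = 0
    · have h1 : HasDerivAt B (deriv B (ℓ z)) (ℓ z) :=
        (hB.differentiableAt ((isOpen_logDomain ε).mem_nhds hℓz.mem)).hasDerivAt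
      exact (h1.comp z hℓz.hasDerivAt).eventually_ne (mul_ne_zero (hB' _ hℓz.mem hBz)
        (inv_ne_zero (ne_zero_of_mem_puncturedDisk hz)))
    · exact (hBa.continuousAt.eventually_ne hBz).filter_mono nhdsWithin_le_nhds
  · filter_upwards [hℓ, (isOpen_puncturedDisk ε).mem_nhds hz] with w hw hwd
    have hm := log_mem_logDomain hε hwd
    -- Across the cut numerator and denominator both acquire the factor `l`, which cancels; so the
    -- principal logarithm may be used throughout.
    rcases hw.eq_or with h | h
    · rw [h]
    · rw [h, hAl _ hm, hBl _ hm, ratio_mul_left hl]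

/-- The two halves of the real axis lift to the fixed lines `Im w = 0` and `Im w = π` of the
reflections `conj` and `deck ∘ conj`. -/
theorem conj_log_ofReal {r : ℝ} (hr : r ≠ 0) :
    conj (Complex.log r) = Complex.log r ∧ (Complex.log r).im = 0 ∨
      deck (conj (Complex.log r)) = Complex.log r ∧ (Complex.log r).im = Real.pi := by
  rcases hr.lt_or_gt with h | h
  · right
    have him : (Complex.log r).im = Real.pi := by
      rw [Complex.log_im, Complex.arg_ofReal_of_neg h]
    refine ⟨?_, him⟩
    apply Complex.ext
    · simp [deck]
    · simp [deck, him]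
      ring
  · left
    rw [← Complex.ofReal_log h.le]
    exact ⟨Complex.conj_ofReal _, Complex.ofReal_im _⟩

theorem realOnAxis_ratio_log {ε : ℝ} (hε : 0 < ε) {A B : ℂ → ℂ} {l : ℂ}
    (hl : l ≠ 0) (hAl : ∀ w ∈ logDomain ε, A (deck w) = l * A w)
    (hBl : ∀ w ∈ logDomain ε, B (deck w) = l * B w)
    (hAr : ∀ w ∈ logDomain ε, A (conj w) = conj (A w))
    (hBr : ∀ w ∈ logDomain ε, B (conj w) = conj (B w)) :
    RealOnAxis ε (fun z => ratio (A (Complex.log z)) (B (Complex.log z))) := by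
  intro r hr
  have hr0 : r ≠ 0 := by simpa using ne_zero_of_mem_puncturedDisk hr
  have hm := log_mem_logDomain hε hr
  set w := Complex.log r
  have hmc := conj_mem_logDomain.mpr hm
  by_cases hB : B w = 0
  · left
    change ratio (A w) (B w) = _
    rw [hB, ratio_zero]
  right
  have hcc : conj (A w / B w) = A w / B w := by
    rw [map_div₀, ← hAr w hm, ← hBr w hm]
    rcases conj_log_ofReal hr0 with ⟨h, -⟩ | ⟨h, -⟩
    · rw [h]
    · have h1 := hAl _ hmc
      have h2 := hBl _ hmc
      rw [h] at h1 h2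
      rw [h1, h2, mul_div_mul_left _ _ hl]
  obtain ⟨x, hx⟩ := Complex.conj_eq_iff_real.mp hcc
  exact ⟨x, (ratio_of_ne hB).trans (congrArg _ hx)⟩

theorem unimodularOnAxis_ratio_log {ε : ℝ} (hε : 0 < ε) {A B : ℂ → ℂ}
    (h0 : ∀ w ∈ logDomain ε, A w ≠ 0 ∨ B w ≠ 0)
    (hreal : ∀ w ∈ logDomain ε, conj w = w → ‖A w‖ = ‖B w‖)
    (hdeck : ∀ w ∈ logDomain ε, deck (conj w) = w → w.im = Real.pi → ‖A w‖ = ‖B w‖) :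
    UnimodularOnAxis ε (fun z => ratio (A (Complex.log z)) (B (Complex.log z))) := by
  intro r hr
  have hr0 : r ≠ 0 := by simpa using ne_zero_of_mem_puncturedDisk hr
  have hm := log_mem_logDomain hε hr
  have heq : ‖A (Complex.log r)‖ = ‖B (Complex.log r)‖ := by
    rcases conj_log_ofReal hr0 with ⟨h, -⟩ | ⟨h, h'⟩
    · exact hreal _ hm h
    · exact hdeck _ hm h h'
  have hB : B (Complex.log r) ≠ 0 := by
    intro hB
    rw [hB, norm_zero, norm_eq_zero] at heq
    rcases h0 _ hm with h | h
    · exact h heq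
    · exact h hB
  refine ⟨_, ?_, ratio_of_ne hB⟩
  rw [norm_div, heq, div_self (norm_ne_zero_iff.mpr hB)]

theorem cpow_mul_exp_neg {z : ℂ} (hz : z ≠ 0) (c y : ℂ) :
    z ^ c * (Complex.exp (-(c * Complex.log z)) * y) = y := by
  rw [Complex.cpow_def_of_ne_zero hz, ← mul_assoc, ← Complex.exp_add,
    show Complex.log z * c + -(c * Complex.log z) = 0 by ring, Complex.exp_zero, one_mul]

/-- The quotient of two independent solutions has a canonical form. -/
theorem exists_canonicalForm {f : ℂ → ℂ} {ε : ℝ} (hε : 0 < ε)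
    (hf : DifferentiableOn ℂ f (puncturedDisk ε))
    (hc : ∀ z ∈ puncturedDisk ε, f (conj z) = conj (f z)) {X₁ X₂ : ℂ → ℂ × ℂ}
    (hX₁ : IsSol f ε X₁) (hX₂ : IsSol f ε X₂) (hdet : ∀ w ∈ logDomain ε, det₂ (X₁ w) (X₂ w) ≠ 0) :
    ∃ F : ℂ → OnePoint ℂ, (∀ z ∈ puncturedDisk ε, SphereMeromorphicAt F z) ∧
      HasCanonicalForm ε F
        (fun z => ratio (X₁ (Complex.log z)).1 (X₂ (Complex.log z)).1) := by
  obtain ⟨e₁, e₂, l, he₁, he₂, hl, hdet', hT₂, hcases⟩ := exists_monodromy_basis hε hf hc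
  have h0 : ∀ w ∈ logDomain ε, (e₁ w).1 ≠ 0 ∨ (e₂ w).1 ≠ 0 := fun w hw => det₂_ne_zero (hdet' w hw)
  have hB' : ∀ w ∈ logDomain ε, (e₂ w).1 = 0 → deriv (fun w => (e₂ w).1) w ≠ 0 := by
    intro w hw h
    rw [(he₂.hasDerivAt_fst hw).deriv]
    refine mul_ne_zero (Complex.exp_ne_zero w) fun h' => hdet' w hw ?_
    simp [det₂, h, h']
  have hBl : ∀ w ∈ logDomain ε, (e₂ (deck w)).1 = l * (e₂ w).1 := fun w hw => by
    rw [hT₂ w hw]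
    rfl
  -- Both pairs are bases of the same two-dimensional solution space; the change of basis, given by
  -- Cramer's rule, acts on quotients as a Möbius map.
  obtain ⟨ψ, hψ⟩ : ∃ ψ : GL (Fin 2) ℂ, ∀ w ∈ logDomain ε,
      ratio (X₁ w).1 (X₂ w).1 = ψ • ratio (e₁ w).1 (e₂ w).1 := by
    set w₁ : ℂ := ((Real.log ε - 1 : ℝ) : ℂ) with hw₁
    have hw₁m : w₁ ∈ logDomain ε := by simp [hw₁, logDomain]
    have hspan : ∀ {X : ℂ → ℂ × ℂ}, IsSol f ε X → ∀ w ∈ logDomain ε,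
        det₂ (e₁ w₁) (e₂ w₁) * (X w).1 =
          det₂ (X w₁) (e₂ w₁) * (e₁ w).1 + det₂ (e₁ w₁) (X w₁) * (e₂ w).1 := by
      intro X hX w hw
      rw [he₁.det_const he₂ hw₁m hw, hX.det_const he₂ hw₁m hw, he₁.det_const hX hw₁m hw]
      simp only [det₂]
      ring
    have hne : det₂ (X₁ w₁) (e₂ w₁) * det₂ (e₁ w₁) (X₂ w₁) -
        det₂ (e₁ w₁) (X₁ w₁) * det₂ (X₂ w₁) (e₂ w₁) ≠ 0 := by
      rw [show det₂ (X₁ w₁) (e₂ w₁) * det₂ (e₁ w₁) (X₂ w₁) -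
        det₂ (e₁ w₁) (X₁ w₁) * det₂ (X₂ w₁) (e₂ w₁) =
          det₂ (e₁ w₁) (e₂ w₁) * det₂ (X₁ w₁) (X₂ w₁) by simp only [det₂]; ring]
      exact mul_ne_zero (hdet' _ hw₁m) (hdet _ hw₁m)
    obtain ⟨ψ, hψ⟩ := exists_smul_ratio_of_det_ne_zero hne
    refine ⟨ψ, fun w hw => ?_⟩
    rw [hψ _ _ (h0 w hw), ← hspan hX₁ w hw, ← hspan hX₂ w hw, ratio_mul_left (hdet' _ hw₁m)]
  -- The factor `e^{-cw}` removes the excess multiplier of `e₁`, so numerator and denominator of `F`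
  -- have the same monodromy factor `l`.
  have hpow : ∀ c : ℂ, (∀ w ∈ logDomain ε, e₁ (deck w) =
      (l * Complex.exp (c * (2 * Real.pi * Complex.I))) • e₁ w) →
      ∀ w ∈ logDomain ε, Complex.exp (-(c * deck w)) * (e₁ (deck w)).1 =
        l * (Complex.exp (-(c * w)) * (e₁ w).1) := by
    intro c h w hw
    have h1 : Complex.exp (-(c * deck w)) * Complex.exp (c * (2 * Real.pi * Complex.I)) =
        Complex.exp (-(c * w)) := by
      rw [← Complex.exp_add]
      congr 1
      simp only [deck]
      push_cast
      ring
    rw [h w hw, ← h1, Prod.smul_fst, smul_eq_mul]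
    ring
  have hdiff : ∀ c : ℂ,
      DifferentiableOn ℂ (fun w => Complex.exp (-(c * w)) * (e₁ w).1) (logDomain ε) := fun c =>
    DifferentiableOn.mul (by fun_prop) he₁.differentiableOn_fst
  have hexp0 : ∀ c : ℂ, ∀ w ∈ logDomain ε,
      Complex.exp (-(c * w)) * (e₁ w).1 ≠ 0 ∨ (e₂ w).1 ≠ 0 := fun c w hw =>
    (h0 w hw).imp_left fun h => mul_ne_zero (Complex.exp_ne_zero _) h
  have hform : ∀ c : ℂ, ∀ z ∈ puncturedHalfDisk ε,
      ratio (X₁ (Complex.log z)).1 (X₂ (Complex.log z)).1 =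
        ψ • OnePoint.map (fun w : ℂ => z ^ c * w)
          (ratio (Complex.exp (-(c * Complex.log z)) * (e₁ (Complex.log z)).1)
            (e₂ (Complex.log z)).1) := by
    intro c z hz
    have hz' := puncturedHalfDisk_subset ε hz
    rw [map_mul_ratio, cpow_mul_exp_neg (ne_zero_of_mem_puncturedDisk hz'),
      hψ _ (log_mem_logDomain hε hz')]
  rcases hcases with ⟨γ, hγ0, hγ1, hr₁, hr₂, hT₁⟩ | ⟨hr₁, hr₂, hT₁⟩ | ⟨γ, hγ, hconj, hln, hT₁⟩
  · refine ⟨_, fun z hz => sphereMeromorphicAt_ratio_log hε (hdiff γ) he₂.differentiableOn_fst hl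
      (hpow γ hT₁) hBl (hexp0 γ) hB' hz, ψ, .inl ⟨γ, hγ0, hγ1, ?_, hform γ⟩⟩
    refine realOnAxis_ratio_log (A := fun w => Complex.exp (-(γ * w)) * (e₁ w).1)
      (B := fun w => (e₂ w).1) hε hl (hpow γ hT₁) hBl (fun w hw => ?_) (fun w hw => ?_)
    · rw [hr₁ w hw, map_mul, ← Complex.exp_conj]
      simp [conjPair]
    · rw [hr₂ w hw]
      rfl
  -- The increment `2πi e₂` of `e₁` is cancelled by the increment `2πi` of `w`.
  · have hAl : ∀ w ∈ logDomain ε, (e₁ (deck w)).1 - deck w * (e₂ (deck w)).1 =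
        l * ((e₁ w).1 - w * (e₂ w).1) := by
      intro w hw
      rw [hT₁ w hw, hT₂ w hw]
      simp [deck]
      ring
    have hA0 : ∀ w ∈ logDomain ε, (e₁ w).1 - w * (e₂ w).1 ≠ 0 ∨ (e₂ w).1 ≠ 0 := by
      intro w hw
      by_cases h : (e₂ w).1 = 0
      · simpa [h] using h0 w hw
      · exact .inr h
    refine ⟨_, fun z hz => sphereMeromorphicAt_ratio_log (A := fun w => (e₁ w).1 - w * (e₂ w).1) hε
      (he₁.differentiableOn_fst.sub (differentiableOn_id.mul he₂.differentiableOn_fst))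
      he₂.differentiableOn_fst hl hAl hBl hA0 hB' hz, ψ, .inr (.inl ⟨?_, fun z hz => ?_⟩)⟩
    · refine realOnAxis_ratio_log (A := fun w => (e₁ w).1 - w * (e₂ w).1)
        (B := fun w => (e₂ w).1) hε hl hAl hBl (fun w hw => ?_) (fun w hw => ?_)
      · rw [hr₁ w hw, hr₂ w hw]
        simp [conjPair]
      · rw [hr₂ w hw]
        rfl
    · have hz' := puncturedHalfDisk_subset ε hz
      rw [map_add_ratio, sub_add_cancel]
      exact hψ _ (log_mem_logDomain hε hz')
  · refine ⟨_, fun z hz => sphereMeromorphicAt_ratio_log hε (hdiff (Complex.I * γ))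
      he₂.differentiableOn_fst hl (hpow _ hT₁) hBl (hexp0 _) hB' hz, ψ,
      .inr (.inr ⟨γ, hγ, ?_, hform _⟩)⟩
    refine unimodularOnAxis_ratio_log hε (hexp0 _) (fun w hw hwc => ?_) (fun w hw hwd him => ?_)
    · have h1 : (e₂ w).1 = conj (e₁ w).1 := by
        have := hconj w hw
        rw [hwc] at this
        rw [this]
        rfl
      have him : w.im = 0 := Complex.conj_eq_iff_im.mp hwc
      rw [h1, RCLike.norm_conj, norm_mul, Complex.norm_exp]
      simp [him]
    -- On `Im w = π` the modulus of `e^{-iγw}` is `e^{πγ}`, the same as that of `l`.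
    · have h1 : (e₂ w).1 = l * conj (e₁ w).1 := by
        have := hBl _ (conj_mem_logDomain.mpr hw)
        rw [hwd, hconj w hw] at this
        exact this
      rw [h1, norm_mul, norm_mul, RCLike.norm_conj, Complex.norm_exp, hln]
      simp [him, mul_comm]

/-! ### Representation of a solution of (L). -/

/-- A solution of the Liouville equation is given by a Hermitian form in two solutions of
`y'' + (f / 2) y = 0`. -/
theorem exists_isSol_hermitian {K c₁ c₂ ε : ℝ} {v : ℂ → ℝ} (hε : 0 < ε)
    (hs : IsSolution K c₁ c₂ ε v) :
    ∃ X₁ X₂ : ℂ → ℂ × ℂ, IsSol (reflect (schwarzian ε v)) ε X₁ ∧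
      IsSol (reflect (schwarzian ε v)) ε X₂ ∧ (∀ w ∈ logDomain ε, det₂ (X₁ w) (X₂ w) = 1) ∧
      ∀ z ∈ puncturedHalfDisk ε, 2 * Real.exp (-(v z) / 2) =
        ‖(X₁ (Complex.log z)).1‖ ^ 2 + K * ‖(X₂ (Complex.log z)).1‖ ^ 2 := by
  have hf := differentiableOn_reflect_schwarzian hs
  set f := reflect (schwarzian ε v) with hfdef
  set z₀ : ℂ := (ε / 2 : ℝ) * Complex.I with hz₀
  have hz₀h : z₀ ∈ halfDisk ε := by
    refine ⟨?_, ?_⟩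
    · rw [hz₀, norm_mul, Complex.norm_I, Complex.norm_real, Real.norm_eq_abs,
        abs_of_pos (by positivity)]
      linarith
    · simp [hz₀, hε]
  have hsub : ∀ z ∈ halfDisk ε, z ∈ puncturedDisk ε := fun z hz =>
    puncturedHalfDisk_subset ε (halfDisk_subset ε hz)
  have hw₀ := log_mem_logDomain hε (hsub z₀ hz₀h)
  set h₀ : ℝ := Real.exp (-(v z₀) / 2) with hh₀
  have hh₀p : 0 < h₀ := Real.exp_pos _
  set q : ℝ := √(2 * h₀) with hq
  have hq0 : 0 < q := Real.sqrt_pos.mpr (by positivity)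
  have hq2 : q ^ 2 = 2 * h₀ := Real.sq_sqrt (by positivity)
  set r₀ : ℂ := -(dz ε v z₀ * h₀) / 2 with hr₀
  -- With `q² = 2 e^{-v/2}` at `z₀`, these initial data give Wronskian one and make the Hermitian
  -- form agree with `e^{-v/2}` at `z₀` in all three components of the total system.
  obtain ⟨X₁, hX₁0, hX₁⟩ := exists_isSol hε hf hw₀ ((q : ℂ), 2 * r₀ / q)
  obtain ⟨X₂, hX₂0, hX₂⟩ := exists_isSol hε hf hw₀ (0, (1 / q : ℂ))
  have hqC : (q : ℂ) ≠ 0 := by exact_mod_cast hq0.ne'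
  have hq2C : (q : ℂ) ^ 2 = 2 * h₀ := by exact_mod_cast hq2
  have hh₀C : (h₀ : ℂ) ≠ 0 := by exact_mod_cast hh₀p.ne'
  refine ⟨X₁, X₂, hX₁, hX₂, fun w hw => ?_, ?_⟩
  · rw [hX₁.det_const hX₂ hw hw₀, hX₁0, hX₂0]
    simp [det₂, hqC]
  have hbr : ∀ z ∈ halfDisk ε, IsLogBranch ε Complex.log z := by
    intro z hz
    have hz' := hsub z hz
    exact ⟨log_mem_logDomain hε hz', Complex.exp_log (ne_zero_of_mem_puncturedDisk hz'),
      Complex.hasDerivAt_log (.inr hz.2.ne'), .inl rfl, fun _ => rfl⟩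
  have hfst : ∀ {X : ℂ → ℂ × ℂ}, IsSol f ε X → ∀ z ∈ halfDisk ε,
      HasDerivAt (fun z => (X (Complex.log z)).1) (X (Complex.log z)).2 z := fun hX z hz =>
    hX.hasDerivAt_fst_log (hbr z hz) (ne_zero_of_mem_puncturedDisk (hsub z hz))
  have hsnd : ∀ {X : ℂ → ℂ × ℂ}, IsSol f ε X → ∀ z ∈ halfDisk ε,
      HasDerivAt (fun z => (X (Complex.log z)).2)
        (-(schwarzian ε v z / 2) * (X (Complex.log z)).1) z := fun {X} hX z hz => by
    have := hX.hasDerivAt_snd_log (hbr z hz) (ne_zero_of_mem_puncturedDisk (hsub z hz))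
    rwa [hfdef, reflect_of_nonneg hz.2.le] at this
  have htot := (isTotalSolution_of_isSolution hs).sub
    (isTotalSolution_hermitian K (hfst hX₁) (hsnd hX₁) (hfst hX₂) (hsnd hX₂))
  have hfc : ContinuousOn (schwarzian ε v) (halfDisk ε) :=
    (hf.continuousOn.mono hsub).congr fun z hz => (reflect_of_nonneg hz.2.le).symm
  have hE : Complex.exp (-(v z₀ : ℂ) / 2) = h₀ := by
    rw [hh₀]
    push_cast
    rfl
  have hE' : Complex.exp ((v z₀ : ℂ) / 2) * h₀ = 1 := by
    rw [← hE, ← Complex.exp_add, show (v z₀ : ℂ) / 2 + -(v z₀ : ℂ) / 2 = 0 by ring,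
      Complex.exp_zero]
  have hin : ∀ z ∈ halfDisk ε, Complex.exp (-(v z : ℂ) / 2) =
      ((X₁ (Complex.log z)).1 * conj (X₁ (Complex.log z)).1 +
        K * ((X₂ (Complex.log z)).1 * conj (X₂ (Complex.log z)).1)) / 2 := by
    intro z hz
    refine sub_eq_zero.mp (htot.eq_zero (convex_halfDisk ε) hfc hz₀h ?_ ?_ ?_ hz)
    · simp only [hE, hX₁0, hX₂0, Complex.conj_ofReal, map_zero]
      linear_combination -hq2C / 2
    · simp only [hE, hX₁0, hX₂0, Complex.conj_ofReal, map_zero]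
      rw [hr₀]
      field_simp
      ring
    · have hE'' : Complex.exp ((v z₀ : ℂ) / 2) = 1 / h₀ := by
        field_simp
        exact hE'
      simp only [hE, hE'', hX₁0, hX₂0, map_div₀, map_mul, map_one, Complex.conj_ofReal,
        Complex.conj_ofNat]
      rw [hr₀]
      simp only [map_div₀, map_mul, map_neg, Complex.conj_ofReal, Complex.conj_ofNat]
      field_simp
      rw [hq2C]
      ring
  -- The principal logarithm jumps at the negative axis, but from `Im z ≥ 0` it agrees with a
  -- holomorphic branch; so the identity extends to both segments by continuity.
  have hcont : ∀ {X : ℂ → ℂ × ℂ}, IsSol f ε X →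
      ContinuousOn (fun z => ‖(X (Complex.log z)).1‖ ^ 2) (puncturedHalfDisk ε) := by
    intro X hX z hz
    obtain ⟨ℓ, hℓ⟩ := exists_isLogBranch hε (puncturedHalfDisk_subset ε hz)
    have h1 : ContinuousWithinAt (fun w => (X (ℓ w)).1) (puncturedHalfDisk ε) z :=
      (analyticAt_comp_log hℓ hX.differentiableOn_fst).continuousAt.continuousWithinAt
    refine (h1.norm.pow 2).congr_of_eventuallyEq ?_ ?_
    · filter_upwards [hℓ.filter_mono nhdsWithin_le_nhds, self_mem_nhdsWithin] with w hw hwS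
      simp only [Pi.pow_apply, hw.eq_log hwS.2.2]
    · simp only [Pi.pow_apply, hℓ.self_of_nhds.eq_log hz.2.2]
  have hEq : EqOn (fun z => 2 * Real.exp (-(v z) / 2))
      (fun z => ‖(X₁ (Complex.log z)).1‖ ^ 2 + K * ‖(X₂ (Complex.log z)).1‖ ^ 2)
      (halfDisk ε) := by
    intro z hz
    have h1 := hin z hz
    rw [Complex.mul_conj', Complex.mul_conj'] at h1
    have h2 : Real.exp (-(v z) / 2) =
        (‖(X₁ (Complex.log z)).1‖ ^ 2 + K * ‖(X₂ (Complex.log z)).1‖ ^ 2) / 2 := by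
      exact_mod_cast h1
    simp only [h2]
    ring
  refine hEq.of_subset_closure ?_ ((hcont hX₁).add (continuousOn_const.mul (hcont hX₂)))
    (halfDisk_subset ε) (puncturedHalfDisk_subset_closure ε)
  exact continuousOn_const.mul
    (Real.continuous_exp.comp_continuousOn (hs.contDiffOn.continuousOn.neg.div_const 2))

/-- The map is `g = y₂ / y₁`, with `y₁`, `y₂` the first components of `X₁`, `X₂`. Its Wronskian is
one and `H = 2 e^{-v/2}`, so the conformal factor is `4 / H² = e^v`. For `K ≤ 0`, positivity of `H`
forces `y₁ ≠ 0`, so `g` is finite and `1 + K |g|² > 0`. -/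
theorem exists_isAdmissible_of_isSolution {K c₁ c₂ ε : ℝ} {v : ℂ → ℝ} (hε : 0 < ε)
    (hs : IsSolution K c₁ c₂ ε v) :
    ∃ F g : ℂ → OnePoint ℂ, IsAdmissible K ε F g ∧ IsRepresentedBy K ε v g := by
  obtain ⟨X₁, X₂, hX₁, hX₂, hdet, hv⟩ := exists_isSol_hermitian hε hs
  have hdet' : ∀ w ∈ logDomain ε, det₂ (X₂ w) (X₁ w) = -1 := fun w hw => by
    rw [← hdet w hw]
    simp [det₂]
  obtain ⟨F, hF, hform⟩ := exists_canonicalForm hε (differentiableOn_reflect_schwarzian hs)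
    (fun z hz => reflect_schwarzian_conj hs hz) hX₂ hX₁
    (fun w hw => by rw [hdet' w hw]; norm_num)
  have hlocal : ∀ z ∈ puncturedHalfDisk ε, ∃ a b : ℂ → ℂ, AnalyticAt ℂ a z ∧ AnalyticAt ℂ b z ∧
      a z = (X₂ (Complex.log z)).1 ∧ b z = (X₁ (Complex.log z)).1 ∧ wronskian a b z = 1 ∧
      (fun z => ratio (X₂ (Complex.log z)).1 (X₁ (Complex.log z)).1)
        =ᶠ[𝓝[puncturedHalfDisk ε] z] fun w => ratio (a w) (b w) := by
    intro z hz
    have hz' := puncturedHalfDisk_subset ε hz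
    have hz0 := ne_zero_of_mem_puncturedDisk hz'
    obtain ⟨ℓ, hℓ⟩ := exists_isLogBranch hε hz'
    have hℓz := hℓ.self_of_nhds
    have hlog := hℓz.eq_log hz.2.2
    refine ⟨fun w => (X₂ (ℓ w)).1, fun w => (X₁ (ℓ w)).1,
      analyticAt_comp_log hℓ hX₂.differentiableOn_fst,
      analyticAt_comp_log hℓ hX₁.differentiableOn_fst, by simp only [hlog], by simp only [hlog], ?_, ?_⟩
    · rw [wronskian, (hX₂.hasDerivAt_fst_log hℓz hz0).deriv,
        (hX₁.hasDerivAt_fst_log hℓz hz0).deriv, ← hdet _ hℓz.mem, det₂]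
      ring
    · filter_upwards [hℓ.filter_mono nhdsWithin_le_nhds, self_mem_nhdsWithin] with w hw hwS
      rw [hw.eq_log hwS.2.2]
  refine ⟨F, _, ⟨hF, hform, fun z hz => ?_, fun hK z hz => ?_⟩, fun z hz => ?_⟩
  · obtain ⟨a, b, ha, hb, -, -, hW, hg⟩ := hlocal z hz
    exact univalent_ratio ha hb (by rw [hW]; exact one_ne_zero) hg
  · have hpos : 0 < ‖(X₁ (Complex.log z)).1‖ ^ 2 + K * ‖(X₂ (Complex.log z)).1‖ ^ 2 := by
      rw [← hv z hz]
      positivity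
    have hne : (X₁ (Complex.log z)).1 ≠ 0 := by
      intro h
      rw [h, norm_zero] at hpos
      nlinarith [mul_nonneg (neg_nonneg.mpr hK) (sq_nonneg ‖(X₂ (Complex.log z)).1‖)]
    have hn : 0 < ‖(X₁ (Complex.log z)).1‖ ^ 2 := pow_pos (norm_pos_iff.mpr hne) 2
    refine ⟨_, ratio_of_ne hne, ?_⟩
    rw [norm_div, div_pow]
    have : 1 + K * (‖(X₂ (Complex.log z)).1‖ ^ 2 / ‖(X₁ (Complex.log z)).1‖ ^ 2) =
        (‖(X₁ (Complex.log z)).1‖ ^ 2 + K * ‖(X₂ (Complex.log z)).1‖ ^ 2) /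
          ‖(X₁ (Complex.log z)).1‖ ^ 2 := by
      field_simp
    rw [this]
    exact div_pos hpos hn
  · obtain ⟨a, b, ha, hb, ha0, hb0, hW, hg⟩ := hlocal z hz
    rw [conformalFactor_ratio hz ((uniqueDiffOn_puncturedHalfDisk ε).mono_field z hz) ha hb
      (ne_zero_of_wronskian (by rw [hW]; exact one_ne_zero)) hg, hW, ha0, hb0, ← hv z hz]
    have h1 : (2 * Real.exp (-(v z) / 2)) ^ 2 = 4 * Real.exp (-(v z)) := by
      rw [mul_pow, ← Real.exp_nat_mul]
      norm_num
      ring_nf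
    rw [h1, norm_one, one_pow, mul_one, div_mul_eq_div_div, div_self four_ne_zero, Real.exp_neg,
      one_div, inv_inv, Real.log_exp]

end LiouvilleNeumann

end

theorem theorem4p1 (K : ℝ) (hK : K = -1 ∨ K = 0 ∨ K = 1) (ε : ℝ) (hε : 0 < ε) :
    (∀ (c₁ c₂ : ℝ) (v : ℂ → ℝ), LiouvilleNeumann.IsSolution K c₁ c₂ ε v →
      ∃ F g : ℂ → OnePoint ℂ, LiouvilleNeumann.IsAdmissible K ε F g ∧
        LiouvilleNeumann.IsRepresentedBy K ε v g) ∧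
    (∀ (F g : ℂ → OnePoint ℂ) (v : ℂ → ℝ), LiouvilleNeumann.IsAdmissible K ε F g →
      LiouvilleNeumann.IsRepresentedBy K ε v g →
        ∃ c₁ c₂ : ℝ, LiouvilleNeumann.IsSolution K c₁ c₂ ε v) :=
  ⟨fun _ _ _ hs => LiouvilleNeumann.exists_isAdmissible_of_isSolution hε hs,
    fun _ _ _ hg hv => LiouvilleNeumann.isSolution_of_isAdmissible hK hg hv⟩
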